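/- **Setting.** Let $T$ be a (one-sorted) first-order theory that eliminates imaginaries: every definable equivalence relation is the kernel of a definable map. Let $M$ be a model of $T$; for $A\subseteq M$ (in particular for every substructure $A$ of $M$), a definable set of $T_A$ is an $A$-definable subset of some $M^n$. For a definable set $X$, $X(A)$ is the set of its $A$-definable points. (When $T$ has quantifier elimination $T_A$ is complete, every $T$-structure $A$ and every extension $A\subseteq B$ of $T$-structures lies in such an $M$, and this does not depend on $M$.) A *2-simplicial set* consists of sorts $G_0,\dots,G_3$ and maps $d_t:G_j\to G_i$ for the weakly increasing maps $t:[i]\to[j]$ ($i,j\le 3$). It is a *2-groupoid* if the simplicial identities hold, all horns of dimensions $1,2,3$ have fillers, fillers in dimension $3$ are unique, and, with $G_4$ defined to be the set of $4$-cycles in $G_3$, every horn of dimension $4$ has a unique filler. Let $\mathbf G$ be a definable 2-groupoid in $T$. Let $D^r$ be the simplicial set whose $k$-simplices are all functions $[k]\to[r]$. For a 2-groupoid $S$, an object $v$, and $f:D^r\to S$, let $\mathrm{Hom}(v,f)$ be the groupoid with objects the pairs $(i,g)$, $i\in[r]$, $g:v\to f(i)$ in $S_1$; its arrows $(i,g)\to(j,h)$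 are the $\sigma\in S_2$ with faces $\sigma_{01}=g$, $\sigma_{02}=h$, $\sigma_{12}=f(i,j)$; composition is given by filling $3$-horns over $f(i,j,k)$. The expansion $T_{\mathbf G}$ of $T$ has new sorts for a 2-groupoid $\mathbf G^*$, a map $e:\mathbf G\to\mathbf G^*$ and a constant $*\in\mathbf G^*_0$; its axioms say that $\mathbf G^*$ is a 2-groupoid, $e$ is a simplicial map, $\mathbf G^*_0=e(\mathbf G_0)\cup\{*\}$, $e$ is a weak equivalence (bijective on $\pi_k$, $k\le 2$, at all base points), and $e$ is an isomorphism onto the full sub-2-groupoid on $e(\mathbf G_0)$. The family $\Gamma$ of admissible groupoids consists of the $\mathrm{Hom}(*,f)$, $f:D^r\to\mathbf G^*$, $r\ge 0$. An admissible interpretation from the admissible cover of $f'$ to that of $f$ is the co-span with vertex $\mathrm{Hom}(*,F)$, for $F:D^{r'+r+1}\to\mathbf G^*$ restricting to $f'$ on $[r']$ and to $f$ on $[r]$ (the two blocks of $[r'+r+1]$). An interpretation $x$ of $T_{\mathbf G}$ in $T_A$ over $T$ is an $A$-definable model $(x(\mathbf G^*),x(e),x(*))$ of the axioms over $\mathbf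 G$. It is *2-stable* if for any two admissible groupoids the natural map from the $x$-interpretation of the (ind-definable) groupoid of admissible interpretations between them, and definable isomorphisms of these over $T$, to the corresponding groupoid of admissible interpretations between their images, and isomorphisms definable in $T$ with parameters, is an equivalence. For $a\in\mathbf G_0(A)$, $\omega_a$ is the interpretation with $\omega_a(\mathbf G^*)=\mathbf G$, $\omega_a(e)=\mathrm{id}$, $\omega_a(*)=a$. The 2-groupoid $I^2(A)=I^2_{T_{\mathbf G}/T}(A)$ is described, through definable groupoids and co-spans, as follows; everything is $A$-definable, uniformly in $f$ and $F$. * Objects: 2-stable interpretations of $(T_{\mathbf G},\Gamma)$ in $T_A$ over $T$. * Morphisms $u:x\to y$: for every $f:D^r\to\mathbf G$, with $H=\mathrm{Hom}(*,f)$, a co-span of weak equivalences $x(H)\to K_u(H)\leftarrow y(H)$, the objects of $K_u(H)$ being the disjoint union of those of $x(H)$ and $y(H)$; and for every admissible interpretation $X=\mathrm{Hom}(*,F)$, $F:D^{r'+r+1}\to\mathbf G$, from $H'=\mathrm{Hom}(*,f')$ to $H=\mathrm{Hom}(*,f)$, an isomorphism $c_X:K_u(H)\circ x(X)\to y(X)\circ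 K_u(H')$ which is the identity on both ends; the $c_X$ are compatible with composition of admissible interpretations. * 2-morphisms with edges $u:x\to y$, $v:y\to z$, $w:x\to z$: isomorphisms $v\circ u\to w$, that is, families of isomorphisms $K_v(H)\circ K_u(H)\to K_w(H)$, identity on both ends, that intertwine the $c_X$. * Elements of dimension $3$: quadruples $\alpha:v\circ u\to w$, $\beta:s\circ v\to r$, $\gamma:r\circ u\to t$, $\delta:s\circ w\to t$ such that $\delta$ is the composition $s\circ w\to s\circ v\circ u\to r\circ u\to t$ of $s\cdot\alpha^{-1}$, $\beta\cdot u$ and $\gamma$. * Degenerate $1$-simplices are the identity co-spans, and degenerate $2$-simplices are given by the unit isomorphisms. **Proposition.** The $\omega_a$, for $a\in\mathbf G_0(A)$, are objects of $I^2(A)$, and the assignment $a\mapsto\omega_a$ extends to a map of 2-groupoids $\omega:\mathbf G(A)\to I^2_{T_{\mathbf G}/T}(A)$ (a map commuting with all faces and degeneracies and preserving elements of dimension $3$), compatible with extensions of $A$: for $A\subseteq B\subseteq M$ the map for $A$ is the restriction of the map for $B$. More precisely, $\omega$ can be taken to be the following map, up to canonical definable isomorphism. For $t:a\to b$ in $\mathbf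 G_1(A)$, the arrows in $K_{\omega_t}(\mathrm{Hom}(*,f))$ from $g:a\to f(i)$ to $h:b\to f(i)$ are the $\sigma\in\mathbf G_2$ with $\sigma_{01}=t$, $\sigma_{02}=g$, $\sigma_{12}=h$; compositions with the arrows of $\omega_a(\mathrm{Hom}(*,f))$ and $\omega_b(\mathrm{Hom}(*,f))$, and the isomorphisms $c_X$, are given by the elements $\Theta\in\mathbf G_3$ with $\Theta_{01}=t$. For $\alpha\in\mathbf G_2(A)$ with edges $r:a\to b$, $s:b\to c$, $t:a\to c$, the isomorphism $\omega_s\circ\omega_r\to\omega_t$ takes the class of $(\Theta_{013},\Theta_{123})$ to $\Theta_{023}$, for all $\Theta\in\mathbf G_3$ with $\Theta_{012}=\alpha$. -/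

import Mathlib

open FirstOrder

universe u v w

namespace DefGpd

/-! ## Truncated simplicial sets inside a structure

`[i]` is `Fin (i + 1)`, and weakly increasing maps are order homomorphisms. -/

/-- The increasing map `[m] → [m+1]` that omits `k`. -/
def δ {m : ℕ} (k : Fin (m + 2)) : Fin (m + 1) →o Fin (m + 2) :=
  (Fin.succAboveOrderEmb k).toOrderHom

/-- The increasing surjection `[m+1] → [m]` that takes the value `k` twice. -/
def ς {m : ℕ} (k : Fin (m + 1)) : Fin (m + 2) →o Fin (m + 1) :=
  Fin.predAboveOrderHom k

/-- The map `[0] → [m]` with value `k`. -/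
def vx {m : ℕ} (k : Fin (m + 1)) : Fin (0 + 1) →o Fin (m + 1) := OrderHom.const _ k

/-- A structure for the signature of `2`-simplicial sets: sorts in dimensions `0, 1, 2, 3`, each a
set of tuples of elements of `M`, and a map `d t` for each weakly increasing map `t`. -/
structure DSimp (M : Type w) where
  ar : Fin 4 → ℕ
  obj : ∀ i : Fin 4, Set (Fin (ar i) → M)
  d : ∀ {i j : Fin 4}, (Fin ((i : ℕ) + 1) →o Fin ((j : ℕ) + 1)) → obj j → obj i

namespace DSimp

variable {M : Type w} (S : DSimp M)

/-- The `k`-th face of an element of dimension `1`: face `0` is the end, face `1` the origin. -/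
def f1 (k : Fin 2) : S.obj 1 → S.obj 0 := S.d (i := 0) (j := 1) (δ (m := 0) k)

/-- The `k`-th face (opposite to the vertex `k`) of an element of dimension `2`. -/
def f2 (k : Fin 3) : S.obj 2 → S.obj 1 := S.d (i := 1) (j := 2) (δ (m := 1) k)

/-- The `k`-th face (opposite to the vertex `k`) of an element of dimension `3`. -/
def f3 (k : Fin 4) : S.obj 3 → S.obj 2 := S.d (i := 2) (j := 3) (δ (m := 2) k)

/-- The identity morphism of an object. -/
def s0 : S.obj 0 → S.obj 1 := S.d (i := 1) (j := 0) (ς (m := 0) 0)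

/-- The two degeneracies of a morphism. -/
def s1 (k : Fin 2) : S.obj 1 → S.obj 2 := S.d (i := 2) (j := 1) (ς (m := 1) k)

/-- The constant element with value `a` in dimension `i`. -/
def const (i : Fin 4) (a : S.obj 0) : S.obj i := S.d (i := i) (j := 0) (OrderHom.const _ 0) a

/-- The simplicial identities. -/
def Functorial : Prop :=
  (∀ (i : Fin 4) (g : S.obj i), S.d OrderHom.id g = g) ∧
  ∀ (i j k : Fin 4) (s : Fin ((i : ℕ) + 1) →o Fin ((j : ℕ) + 1))
    (t : Fin ((j : ℕ) + 1) →o Fin ((k : ℕ) + 1)) (g : S.obj k),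
    S.d (t.comp s) g = S.d s (S.d t g)

/-- Elements `x j` of dimension `m`, for those `j ∈ [m+1]` that satisfy `p`, agree on the common
faces that they have when `x j` is put in the position of the `j`-th face of an
`(m+1)`-simplex. -/
def Matching (m : Fin 4) (p : Fin ((m : ℕ) + 2) → Prop)
    (x : ∀ j : Fin ((m : ℕ) + 2), p j → S.obj m) : Prop :=
  ∀ (j l : Fin ((m : ℕ) + 2)) (hj : p j) (hl : p l) (q : Fin 4)
    (s s' : Fin ((q : ℕ) + 1) →o Fin ((m : ℕ) + 1)),
    (δ j).comp s = (δ l).comp s' → S.d s (x j hj) = S.d s' (x l hl)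

/-- The theory of `2`-groupoids: the simplicial identities; fillers of all horns in dimensions
`1, 2, 3`; uniqueness of the fillers in dimension `3`; and unique completion of horns of dimension
`4` to cycles (the elements of dimension `4` being the cycles). -/
def IsTwoGroupoid : Prop :=
  S.Functorial ∧
  (∀ (m : Fin 3) (i : Fin ((m : ℕ) + 2))
    (x : ∀ j : Fin ((m : ℕ) + 2), j ≠ i → S.obj m.castSucc),
    S.Matching m.castSucc (fun j => j ≠ i) x →
      ∃ g : S.obj m.succ, ∀ (j : Fin ((m : ℕ) + 2)) (hj : j ≠ i),
        S.d (i := m.castSucc) (j := m.succ) (δ j) g = x j hj) ∧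
  (∀ g g' : S.obj 3, ∀ i : Fin 4, (∀ j, j ≠ i → S.f3 j g = S.f3 j g') → g = g') ∧
  ∀ (i : Fin 5) (x : ∀ j : Fin 5, j ≠ i → S.obj 3),
    S.Matching 3 (fun j => j ≠ i) x →
      ∃! y : Fin 5 → S.obj 3,
        S.Matching 3 (fun _ => True) (fun j _ => y j) ∧ ∀ j hj, y j = x j hj

/-- `g`, of dimension `k`, has constant boundary with value `a`. -/
def IsSphere (a : S.obj 0) {k : Fin 4} (g : S.obj k) : Prop :=
  ∀ (q : Fin 4) (t : Fin ((q : ℕ) + 1) →o Fin ((k : ℕ) + 1)), q < k → S.d t g = S.const q a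

/-- Homotopy relative to the boundary. -/
def Homotopic {k : Fin 3} (α β : S.obj k.castSucc) : Prop :=
  ∃ h : S.obj k.succ,
    S.d (i := k.castSucc) (j := k.succ) (δ 0) h = α ∧
    S.d (i := k.castSucc) (j := k.succ) (δ 1) h = β ∧
    ∀ i : Fin ((k : ℕ) + 2), i ≠ 0 → i ≠ 1 →
      S.d (i := k.castSucc) (j := k.succ) (δ i) h =
        S.d (i := k.castSucc) (j := k.succ) (δ i)
          (S.d (i := k.succ) (j := k.castSucc) (ς (m := (k : ℕ)) 0) α)

/-- The map `e` commutes with all structure maps. -/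
def IsMap {S S' : DSimp M} (e : ∀ i, S.obj i → S'.obj i) : Prop :=
  ∀ (i j : Fin 4) (t : Fin ((i : ℕ) + 1) →o Fin ((j : ℕ) + 1)) (g : S.obj j),
    e i (S.d t g) = S'.d t (e j g)

/-- The map `e` induces a bijection on the homotopy sets `π_k` for `0 ≤ k ≤ 2` and all base
points. -/
def IsWeakEquivalence {S S' : DSimp M} (e : ∀ i, S.obj i → S'.obj i) : Prop :=
  ∀ (a : S.obj 0) (k : Fin 3),
    (∀ g g' : S.obj k.castSucc, S.IsSphere a g → S.IsSphere a g' →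
      S'.Homotopic (e _ g) (e _ g') → S.Homotopic g g') ∧
    ∀ h : S'.obj k.castSucc, S'.IsSphere (e 0 a) h →
      ∃ g : S.obj k.castSucc, S.IsSphere a g ∧ S'.Homotopic (e _ g) h

/-- `S` is definable over the set of parameters `A`. -/
def DefinableOver (L : FirstOrder.Language.{u, v}) [L.Structure M] (A : Set M) : Prop :=
  (∀ i, A.Definable L (S.obj i)) ∧
  ∀ (i j : Fin 4) (t : Fin ((i : ℕ) + 1) →o Fin ((j : ℕ) + 1)),
    A.Definable L {z : Fin (S.ar j) ⊕ Fin (S.ar i) → M |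
      ∃ g : S.obj j, z = Sum.elim (g : Fin (S.ar j) → M) (S.d t g : Fin (S.ar i) → M)}

/-- `g` is an `A`-point: it is definable over `A`. -/
def IsPoint (L : FirstOrder.Language.{u, v}) [L.Structure M] (A : Set M) {i : Fin 4} (g : S.obj i) : Prop :=
  A.Definable L {(g : Fin (S.ar i) → M)}

end DSimp

/-! ## Definable `2`-groupoids in a theory -/

/-- Formulas for the sorts and for the graphs of the structure maps of a `2`-simplicial set. -/
structure SimpFormulas (L : FirstOrder.Language.{u, v}) where
  ar : Fin 4 → ℕ
  carrier : ∀ i : Fin 4, L.Formula (Fin (ar i))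
  graph : ∀ {i j : Fin 4}, (Fin ((i : ℕ) + 1) →o Fin ((j : ℕ) + 1)) →
    L.Formula (Fin (ar j) ⊕ Fin (ar i))

namespace SimpFormulas

variable {L : FirstOrder.Language.{u, v}} (Φ : SimpFormulas L) (M : Type w) [L.Structure M]

/-- In `M`, the formulas `graph t` define maps between the sorts. -/
def Functional : Prop :=
  ∀ (i j : Fin 4) (t : Fin ((i : ℕ) + 1) →o Fin ((j : ℕ) + 1)) (x : Fin (Φ.ar j) → M),
    (Φ.carrier j).Realize x →
      ∃! y : Fin (Φ.ar i) → M, (Φ.carrier i).Realize y ∧ (Φ.graph t).Realize (Sum.elim x y)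

/-- The `2`-simplicial set that the formulas define in `M`. -/
noncomputable def toDSimp (h : Φ.Functional M) : DSimp M where
  ar := Φ.ar
  obj i := {x | (Φ.carrier i).Realize x}
  d t g := ⟨(h _ _ t g.1 g.2).choose, (h _ _ t g.1 g.2).choose_spec.1.1⟩

end SimpFormulas

/-- A definable `2`-groupoid in the theory `T`. -/
structure DefinableTwoGroupoid {L : FirstOrder.Language.{u, v}} (T : L.Theory) where
  formulas : SimpFormulas L
  functional : ∀ (M : Type w) [L.Structure M] [Nonempty M] [M ⊨ T], formulas.Functional M
  isTwoGroupoid : ∀ (M : Type w) [L.Structure M] [Nonempty M] [M ⊨ T],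
    (formulas.toDSimp M (functional M)).IsTwoGroupoid

/-- The `2`-groupoid `G(M)` of points of `G` in a model. -/
noncomputable def DefinableTwoGroupoid.points {L : FirstOrder.Language.{u, v}} {T : L.Theory}
    (G : DefinableTwoGroupoid.{u, v, w} T) (M : Type w) [L.Structure M] [Nonempty M] [M ⊨ T] :
    DSimp M :=
  G.formulas.toDSimp M (G.functional M)

/-- `T` eliminates imaginaries: every definable equivalence relation is the relation of having the
same image under some definable map. -/
def EliminatesImaginaries {L : FirstOrder.Language.{u, v}} (T : L.Theory) : Prop :=
  ∀ (n : ℕ) (E : L.Formula (Fin n ⊕ Fin n)),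
    (∀ (M : Type w) [L.Structure M] [Nonempty M] [M ⊨ T],
      Equivalence fun x y : Fin n → M => E.Realize (Sum.elim x y)) →
    ∃ (m : ℕ) (ψ : L.Formula (Fin n ⊕ Fin m)),
      ∀ (M : Type w) [L.Structure M] [Nonempty M] [M ⊨ T],
        ∃ c : (Fin n → M) → (Fin m → M),
          (∀ x y, ψ.Realize (Sum.elim x y) ↔ c x = y) ∧
          ∀ x x', E.Realize (Sum.elim x x') ↔ c x = c x'

/-! ## Maps from the contractible simplicial sets `D^I`

The `k`-simplices of `D^I` are all functions `[k] → I`; for `I = [r]` this is `D^r`. -/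

/-- A map of simplicial sets from `D^I` to `S`. -/
structure DMap {M : Type w} (I : Type) (S : DSimp M) where
  toFun : ∀ k : Fin 4, (Fin ((k : ℕ) + 1) → I) → S.obj k
  natural : ∀ (i j : Fin 4) (t : Fin ((i : ℕ) + 1) →o Fin ((j : ℕ) + 1))
    (c : Fin ((j : ℕ) + 1) → I), S.d t (toFun j c) = toFun i (c ∘ t)

namespace DMap

variable {M : Type w} {S : DSimp M} {I J : Type} (f : DMap I S)

def vertex (i : I) : S.obj 0 := f.toFun 0 fun _ => i

def edge (i j : I) : S.obj 1 := f.toFun 1 ![i, j]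

def tri (i j k : I) : S.obj 2 := f.toFun 2 ![i, j, k]

/-- Composition with the map `D^J → D^I` given by a function `J → I`. -/
def comp (h : J → I) : DMap J S where
  toFun k c := f.toFun k (h ∘ c)
  natural i j t c := f.natural i j t (h ∘ c)

/-- The coordinates of a map `D^I → S`. -/
abbrev Var (I : Type) (S : DSimp M) : Type :=
  Σ k : Fin 4, (Fin ((k : ℕ) + 1) → I) × Fin (S.ar k)

/-- A map `D^I → S` as a tuple of elements of `M`. -/
def code : Var I S → M := fun z => (f.toFun z.1 z.2.1 : Fin (S.ar z.1) → M) z.2.2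

end DMap

/-! ## Interpretations of the theory `T_G` over the base -/

section Interp

variable {M : Type w}

/-- A model of the theory `T_G` with base part `M`, whose new sorts are sets of tuples from `M`: the
`2`-groupoid `S` (the value of `G^*`), the map `e` from `G` to it and the distinguished object
`star`, satisfying the axioms of `T_G`. When these data are definable over `A`, this is an
interpretation of `T_G` in `T_A` over `T`. -/
structure Interp (G : DSimp M) where
  S : DSimp M
  e : ∀ i, G.obj i → S.obj i
  star : S.obj 0
  isTwoGroupoid : S.IsTwoGroupoid
  isMap : DSimp.IsMap e
  objects : ∀ b : S.obj 0, b ∈ Set.range (e 0) ∨ b = star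
  weakEquivalence : DSimp.IsWeakEquivalence e
  injective : ∀ i, Function.Injective (e i)
  full : ∀ (i : Fin 4) (g : S.obj i),
    g ∈ Set.range (e i) ↔
      ∀ k : Fin ((i : ℕ) + 1), S.d (i := 0) (j := i) (vx k) g ∈ Set.range (e 0)

/-- The relation symbols of the language of `T_G`, as a one-sorted relational language: predicates
for the base sort and the sorts `G^*_i`, the symbols of `L` on the base sort (functions through
their graphs), and the graphs of the structure maps of `G^*`, of the maps `e_i` and of the
constant `*`. -/
inductive CoverRel (L : FirstOrder.Language.{u, v}) (ar : Fin 4 → ℕ) : ℕ → Type (max u v)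
  | base : CoverRel L ar 1
  | sort (i : Fin 4) : CoverRel L ar 1
  | fn {n : ℕ} (f : L.Functions n) : CoverRel L ar (n + 1)
  | rel {n : ℕ} (R : L.Relations n) : CoverRel L ar n
  | d {i j : Fin 4} (t : Fin ((i : ℕ) + 1) →o Fin ((j : ℕ) + 1)) : CoverRel L ar 2
  | e (i : Fin 4) : CoverRel L ar (ar i + 1)
  | star : CoverRel L ar 1

/-- The language of `T_G`. -/
def CoverLang (L : FirstOrder.Language.{u, v}) (ar : Fin 4 → ℕ) : FirstOrder.Language.{0, max u v} :=
  ⟨fun _ => Empty, CoverRel L ar⟩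

namespace Interp

variable {G : DSimp M}

/-- All elements, of all sorts, of a model of `T_G`. -/
def Univ (x : Interp G) : Type w := M ⊕ Σ i : Fin 4, x.S.obj i

/-- An element of the sort `G^*_i`. -/
def inSort (x : Interp G) {i : Fin 4} (g : x.S.obj i) : x.Univ := Sum.inr ⟨i, g⟩

/-- The relations of a model of `T_G`. -/
def relMap (L : FirstOrder.Language.{u, v}) [L.Structure M] (x : Interp G) :
    ∀ {n : ℕ}, CoverRel L G.ar n → (Fin n → x.Univ) → Prop
  | _, .base, z => ∃ m : M, z 0 = Sum.inl m
  | _, .sort i, z => ∃ g : x.S.obj i, z 0 = x.inSort g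
  | _, .fn (n := n) f, z => ∃ m : Fin n → M,
      (∀ k, z k.castSucc = Sum.inl (m k)) ∧ z (Fin.last n) = Sum.inl (FirstOrder.Language.Structure.funMap f m)
  | _, .rel (n := n) R, z => ∃ m : Fin n → M,
      (∀ k, z k = Sum.inl (m k)) ∧ FirstOrder.Language.Structure.RelMap R m
  | _, .d (j := j) t, z => ∃ g : x.S.obj j, z 0 = x.inSort g ∧ z 1 = x.inSort (x.S.d t g)
  | _, .e i, z => ∃ g : G.obj i,
      (∀ k : Fin (G.ar i), z k.castSucc = Sum.inl ((g : Fin (G.ar i) → M) k)) ∧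
        z (Fin.last _) = x.inSort (x.e i g)
  | _, .star, z => z 0 = x.inSort x.star

instance (L : FirstOrder.Language.{u, v}) [L.Structure M] (x : Interp G) :
    (CoverLang L G.ar).Structure x.Univ where
  funMap f := nomatch f
  RelMap R := x.relMap L R

/-- The data of the interpretation are definable over `A`. -/
def DefinableOver (L : FirstOrder.Language.{u, v}) [L.Structure M] (A : Set M) (x : Interp G) : Prop :=
  x.S.DefinableOver L A ∧
  (∀ i, A.Definable L {z : Fin (G.ar i) ⊕ Fin (x.S.ar i) → M |
    ∃ g : G.obj i, z = Sum.elim (g : Fin (G.ar i) → M) (x.e i g : Fin (x.S.ar i) → M)}) ∧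
  x.S.IsPoint L A x.star

/-- `ρ` is the composition of `σ` and then `τ`, as `2`-simplices with initial vertex `*`, over the
`2`-simplex `κ` formed by their faces opposite to `*`. -/
def ComposesOver (x : Interp G) (κ σ τ ρ : x.S.obj 2) : Prop :=
  ∃ Θ : x.S.obj 3, x.S.f3 3 Θ = σ ∧ x.S.f3 1 Θ = τ ∧ x.S.f3 2 Θ = ρ ∧ x.S.f3 0 Θ = κ

/-- The arrows, in the groupoid `Hom(*, F)`, from objects over `i` to objects over `j`. -/
def ArrowSet (x : Interp G) {I : Type} (F : DMap I x.S) (i j : I) : Set (x.S.obj 2) :=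
  {σ | x.S.f1 1 (x.S.f2 2 σ) = x.star ∧ x.S.f2 0 σ = F.edge i j}

/-- A map `F : D^(r'+r+1) → G^*` gives a co-span of admissible groupoids with vertex `Hom(*, F)`,
from the restriction of `F` to `[r']` to its restriction to `[r]`. Given two such maps with the same
restrictions, `R` is (the graph of) an isomorphism of the two co-spans which is the identity on both
ends: `R i' i` relates arrows from objects over `i' ∈ [r']` to objects over `i ∈ [r]`. -/
structure IsCospanIso (x : Interp G) {I' I : Type} (F F' : DMap (I' ⊕ I) x.S)
    (R : I' → I → x.S.obj 2 → x.S.obj 2 → Prop) : Prop where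
  left_eq : F.comp Sum.inl = F'.comp Sum.inl
  right_eq : F.comp Sum.inr = F'.comp Sum.inr
  arrows : ∀ i' i ξ ξ', R i' i ξ ξ' →
    ξ ∈ x.ArrowSet F (Sum.inl i') (Sum.inr i) ∧ ξ' ∈ x.ArrowSet F' (Sum.inl i') (Sum.inr i) ∧
      x.S.f2 2 ξ = x.S.f2 2 ξ' ∧ x.S.f2 1 ξ = x.S.f2 1 ξ'
  total : ∀ i' i, ∀ ξ ∈ x.ArrowSet F (Sum.inl i') (Sum.inr i), ∃! ξ', R i' i ξ ξ'
  bijective : ∀ i' i, ∀ ξ' ∈ x.ArrowSet F' (Sum.inl i') (Sum.inr i), ∃! ξ, R i' i ξ ξ'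
  comp_left : ∀ j' i' i κ ξ ξ' ρ ρ',
    x.ComposesOver (F.tri (Sum.inl j') (Sum.inl i') (Sum.inr i)) κ ξ ρ →
    R i' i ξ ξ' → R j' i ρ ρ' →
    x.ComposesOver (F'.tri (Sum.inl j') (Sum.inl i') (Sum.inr i)) κ ξ' ρ'
  comp_right : ∀ i' i j κ ξ ξ' ρ ρ',
    x.ComposesOver (F.tri (Sum.inl i') (Sum.inr i) (Sum.inr j)) ξ κ ρ →
    R i' i ξ ξ' → R i' j ρ ρ' →
    x.ComposesOver (F'.tri (Sum.inl i') (Sum.inr i) (Sum.inr j)) ξ' κ ρ'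

/-- `x` is `2`-stable with respect to the family of admissible groupoids `Hom(*, f)`, where
`f : D^r → G^*`: the map from the interpretation in `x` of the groupoid of admissible maps between
two admissible groupoids to the groupoid of admissible maps between their interpretations is an
equivalence. The objects of both are the co-spans given by maps `D^(r'+r+1) → x(G^*)`, and the map
is the identity on them and injective on morphisms. So the condition is that each isomorphism of
such co-spans that is definable in the base with parameters is definable with parameters in the
`T_G`-structure `x`, uniformly: those that belong to one definable family in the base (the formulas
`Θ`) are covered by finitely many definable families in `T_G` (the list `Ψ`). -/
def IsTwoStable (L : FirstOrder.Language.{u, v}) [L.Structure M] (x : Interp G) : Prop :=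
  ∀ (r' r k : ℕ)
    (Θ : Fin (r' + 1) → Fin (r + 1) →
      L.Formula ((Fin (x.S.ar 2) ⊕ Fin (x.S.ar 2)) ⊕ Fin k)),
    ∃ Ψ : List (Σ l : ℕ, (CoverLang L G.ar).Formula (Fin 2 ⊕ Fin l)),
      ∀ (F F' : DMap (Fin (r' + 1) ⊕ Fin (r + 1)) x.S)
        (R : Fin (r' + 1) → Fin (r + 1) → x.S.obj 2 → x.S.obj 2 → Prop) (z : Fin k → M),
        x.IsCospanIso F F' R →
        (∀ i' i (ξ ξ' : x.S.obj 2), R i' i ξ ξ' ↔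
          (Θ i' i).Realize (Sum.elim (Sum.elim (ξ : Fin (x.S.ar 2) → M) ξ') z)) →
        ∀ i' i, ∃ ψ ∈ Ψ, ∃ y : Fin ψ.1 → x.Univ, ∀ ξ ξ' : x.S.obj 2,
          R i' i ξ ξ' ↔ ψ.2.Realize (Sum.elim ![x.inSort ξ, x.inSort ξ'] y)

/-- The objects of `I²(A)`: the `2`-stable interpretations of `T_G` in `T_A` over `T`. -/
def IsObjectOver (L : FirstOrder.Language.{u, v}) [L.Structure M] (A : Set M) (x : Interp G) : Prop :=
  x.DefinableOver L A ∧ x.IsTwoStable L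

/-! For a map `f : D^r → G`, the interpretation `x` takes the admissible groupoid `Hom(*, f)` to the
following one. -/

/-- The objects of `Hom(*, f)` over `i`. -/
def Ob (x : Interp G) {I : Type} (f : DMap I G) (i : I) : Type w :=
  {g : x.S.obj 1 // x.S.f1 1 g = x.star ∧ x.S.f1 0 g = x.e 0 (f.vertex i)}

/-- The arrows of `Hom(*, f)`. -/
def Hom (x : Interp G) {I : Type} (f : DMap I G) {i j : I} (g : x.Ob f i) (h : x.Ob f j) : Type w :=
  {σ : x.S.obj 2 //
    x.S.f2 2 σ = g.1 ∧ x.S.f2 1 σ = h.1 ∧ x.S.f2 0 σ = x.e 1 (f.edge i j)}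

/-- For `F` defined on a disjoint union, the arrows of `Hom(*, F)` from an object over the first
part to an object over the second one. -/
def Cross (x : Interp G) {I' I : Type} (F : DMap (I' ⊕ I) G) {i' : I'} {i : I}
    (g' : x.Ob (F.comp Sum.inl) i') (g : x.Ob (F.comp Sum.inr) i) : Type w :=
  {σ : x.S.obj 2 //
    x.S.f2 2 σ = g'.1 ∧ x.S.f2 1 σ = g.1 ∧
      x.S.f2 0 σ = x.e 1 (F.edge (Sum.inl i') (Sum.inr i))}

/-- Composition of arrows of `Hom(*, f)`, first `σ` and then `τ`, where `κ` is the `2`-simplex of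
`f` over which the composition takes place. -/
def Composes (x : Interp G) (κ : G.obj 2) (σ τ ρ : x.S.obj 2) : Prop :=
  x.ComposesOver (x.e 2 κ) σ τ ρ

end Interp

/-! ## Morphisms and `2`-morphisms -/

open Sum in
/-- A morphism `x → y`. For each admissible groupoid `H = Hom(*, f)`, with `f : D^r → G`, there is a
bi-interpretation from `x(H)` to `y(H)`, given by a co-span of weak equivalences
`x(H) → K(H) ← y(H)` such that the objects of `K(H)` are the disjoint union of those of `x(H)` and
`y(H)`. The part of `K(H)` that is not given by `x(H)` and `y(H)` consists of the arrows `P f g h`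
from objects `g` of `x(H)` to objects `h` of `y(H)`, and of their compositions with the arrows of
`x(H)` and of `y(H)`. For each admissible interpretation between admissible groupoids, given by the
co-span with vertex `X = Hom(*, F)` for a map `F` from `D^(r'+r+1)` to `G`, from the restriction
`f'` of `F` to `[r']` to its restriction `f` to `[r]`, there is an isomorphism from the composition
of `x(X)` and `K(Hom(*, f))` to the composition of `K(Hom(*, f'))` and `y(X)`. It is given by its
graph on representatives: `Sq F ξ π π' η` says that it takes the class of `(ξ, π)` to the class of
`(π', η)`. -/
structure Mor {G : DSimp M} (x y : Interp G) where
  ar : ℕ → ℕ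
  P : ∀ {r : ℕ} (f : DMap (Fin (r + 1)) G) {i j : Fin (r + 1)},
    x.Ob f i → y.Ob f j → Set (Fin (ar r) → M)
  pre : ∀ {r : ℕ} {f : DMap (Fin (r + 1)) G} {i i' j : Fin (r + 1)}
    {g : x.Ob f i} {g' : x.Ob f i'} {h : y.Ob f j}, x.Hom f g g' → P f g' h → P f g h
  post : ∀ {r : ℕ} {f : DMap (Fin (r + 1)) G} {i j j' : Fin (r + 1)}
    {g : x.Ob f i} {h : y.Ob f j} {h' : y.Ob f j'}, P f g h → y.Hom f h h' → P f g h'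
  pre_comp : ∀ {r : ℕ} {f : DMap (Fin (r + 1)) G} {i i' i'' j : Fin (r + 1)}
    {g : x.Ob f i} {g' : x.Ob f i'} {g'' : x.Ob f i''} {h : y.Ob f j}
    (σ : x.Hom f g g') (τ : x.Hom f g' g'') (ρ : x.Hom f g g'') (π : P f g'' h),
    x.Composes (f.tri i i' i'') σ.1 τ.1 ρ.1 → pre ρ π = pre σ (pre τ π)
  pre_id : ∀ {r : ℕ} {f : DMap (Fin (r + 1)) G} {i j : Fin (r + 1)}
    {g : x.Ob f i} {h : y.Ob f j} (σ : x.Hom f g g) (π : P f g h),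
    σ.1 = x.S.s1 1 g.1 → pre σ π = π
  post_comp : ∀ {r : ℕ} {f : DMap (Fin (r + 1)) G} {i j j' j'' : Fin (r + 1)}
    {g : x.Ob f i} {h : y.Ob f j} {h' : y.Ob f j'} {h'' : y.Ob f j''}
    (π : P f g h) (σ : y.Hom f h h') (τ : y.Hom f h' h'') (ρ : y.Hom f h h''),
    y.Composes (f.tri j j' j'') σ.1 τ.1 ρ.1 → post π ρ = post (post π σ) τ
  post_id : ∀ {r : ℕ} {f : DMap (Fin (r + 1)) G} {i j : Fin (r + 1)}
    {g : x.Ob f i} {h : y.Ob f j} (π : P f g h) (σ : y.Hom f h h),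
    σ.1 = y.S.s1 1 h.1 → post π σ = π
  pre_post : ∀ {r : ℕ} {f : DMap (Fin (r + 1)) G} {i i' j j' : Fin (r + 1)}
    {g : x.Ob f i} {g' : x.Ob f i'} {h : y.Ob f j} {h' : y.Ob f j'}
    (σ : x.Hom f g g') (π : P f g' h) (τ : y.Hom f h h'),
    pre σ (post π τ) = post (pre σ π) τ
  /- the two maps to `K(H)` are weak equivalences -/
  exists_left : ∀ {r : ℕ} (f : DMap (Fin (r + 1)) G) {j : Fin (r + 1)} (h : y.Ob f j),
    ∃ (i : Fin (r + 1)) (g : x.Ob f i), (P f g h).Nonempty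
  exists_right : ∀ {r : ℕ} (f : DMap (Fin (r + 1)) G) {i : Fin (r + 1)} (g : x.Ob f i),
    ∃ (j : Fin (r + 1)) (h : y.Ob f j), (P f g h).Nonempty
  unique_left : ∀ {r : ℕ} {f : DMap (Fin (r + 1)) G} {i i' j : Fin (r + 1)}
    {g : x.Ob f i} {g' : x.Ob f i'} {h : y.Ob f j} (π : P f g h) (π' : P f g' h),
    ∃! σ : x.Hom f g g', pre σ π' = π
  unique_right : ∀ {r : ℕ} {f : DMap (Fin (r + 1)) G} {i j j' : Fin (r + 1)}
    {g : x.Ob f i} {h : y.Ob f j} {h' : y.Ob f j'} (π : P f g h) (π' : P f g h'),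
    ∃! τ : y.Hom f h h', post π τ = π'
  Sq : ∀ {r' r : ℕ} (F : DMap (Fin (r' + 1) ⊕ Fin (r + 1)) G)
    {i' j' : Fin (r' + 1)} {i j : Fin (r + 1)}
    {g' : x.Ob (F.comp inl) i'} {g : x.Ob (F.comp inr) i}
    {h' : y.Ob (F.comp inl) j'} {h : y.Ob (F.comp inr) j},
    x.Cross F g' g → P (F.comp inr) g h → P (F.comp inl) g' h' → y.Cross F h' h → Prop
  /- `Sq F` is well defined on classes, -/
  sq_mid_right : ∀ {r' r : ℕ} (F : DMap (Fin (r' + 1) ⊕ Fin (r + 1)) G)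
    {i' j' : Fin (r' + 1)} {i i₁ j : Fin (r + 1)}
    {g' : x.Ob (F.comp inl) i'} {g : x.Ob (F.comp inr) i} {g₁ : x.Ob (F.comp inr) i₁}
    {h' : y.Ob (F.comp inl) j'} {h : y.Ob (F.comp inr) j}
    (ξ : x.Cross F g' g) (σ : x.Hom (F.comp inr) g g₁) (ξ₁ : x.Cross F g' g₁)
    (π : P (F.comp inr) g₁ h) (π' : P (F.comp inl) g' h') (η : y.Cross F h' h),
    x.Composes (F.tri (inl i') (inr i) (inr i₁)) ξ.1 σ.1 ξ₁.1 →
    (Sq F ξ₁ π π' η ↔ Sq F ξ (pre σ π) π' η)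
  sq_mid_left : ∀ {r' r : ℕ} (F : DMap (Fin (r' + 1) ⊕ Fin (r + 1)) G)
    {i' j' j₁ : Fin (r' + 1)} {i j : Fin (r + 1)}
    {g' : x.Ob (F.comp inl) i'} {g : x.Ob (F.comp inr) i}
    {h' : y.Ob (F.comp inl) j'} {h₁ : y.Ob (F.comp inl) j₁} {h : y.Ob (F.comp inr) j}
    (ξ : x.Cross F g' g) (π : P (F.comp inr) g h) (π' : P (F.comp inl) g' h')
    (τ : y.Hom (F.comp inl) h' h₁) (η₁ : y.Cross F h₁ h) (η : y.Cross F h' h),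
    y.Composes (F.tri (inl j') (inl j₁) (inr j)) τ.1 η₁.1 η.1 →
    (Sq F ξ π (post π' τ) η₁ ↔ Sq F ξ π π' η)
  /- it is the graph of a bijection, -/
  sq_total : ∀ {r' r : ℕ} (F : DMap (Fin (r' + 1) ⊕ Fin (r + 1)) G)
    {i' j' : Fin (r' + 1)} {i j : Fin (r + 1)}
    {g' : x.Ob (F.comp inl) i'} {g : x.Ob (F.comp inr) i}
    {h' : y.Ob (F.comp inl) j'} {h : y.Ob (F.comp inr) j}
    (ξ : x.Cross F g' g) (π : P (F.comp inr) g h) (π' : P (F.comp inl) g' h'),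
    ∃! η : y.Cross F h' h, Sq F ξ π π' η
  sq_bijective : ∀ {r' r : ℕ} (F : DMap (Fin (r' + 1) ⊕ Fin (r + 1)) G)
    {i' j' : Fin (r' + 1)} {i j : Fin (r + 1)}
    {g' : x.Ob (F.comp inl) i'} {g : x.Ob (F.comp inr) i}
    {h' : y.Ob (F.comp inl) j'} {h : y.Ob (F.comp inr) j}
    (π : P (F.comp inr) g h) (π' : P (F.comp inl) g' h') (η : y.Cross F h' h),
    ∃! ξ : x.Cross F g' g, Sq F ξ π π' η
  /- and it commutes with the arrows of the two ends. -/
  sq_left : ∀ {r' r : ℕ} (F : DMap (Fin (r' + 1) ⊕ Fin (r + 1)) G)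
    {i' i₁ j' : Fin (r' + 1)} {i j : Fin (r + 1)}
    {g' : x.Ob (F.comp inl) i'} {g₁ : x.Ob (F.comp inl) i₁} {g : x.Ob (F.comp inr) i}
    {h' : y.Ob (F.comp inl) j'} {h : y.Ob (F.comp inr) j}
    (σ : x.Hom (F.comp inl) g₁ g') (ξ : x.Cross F g' g) (ξ₁ : x.Cross F g₁ g)
    (π : P (F.comp inr) g h) (π' : P (F.comp inl) g' h') (η : y.Cross F h' h),
    x.Composes (F.tri (inl i₁) (inl i') (inr i)) σ.1 ξ.1 ξ₁.1 →
    (Sq F ξ₁ π (pre σ π') η ↔ Sq F ξ π π' η)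
  sq_right : ∀ {r' r : ℕ} (F : DMap (Fin (r' + 1) ⊕ Fin (r + 1)) G)
    {i' j' : Fin (r' + 1)} {i j j₁ : Fin (r + 1)}
    {g' : x.Ob (F.comp inl) i'} {g : x.Ob (F.comp inr) i}
    {h' : y.Ob (F.comp inl) j'} {h : y.Ob (F.comp inr) j} {h₁ : y.Ob (F.comp inr) j₁}
    (ξ : x.Cross F g' g) (π : P (F.comp inr) g h) (π' : P (F.comp inl) g' h')
    (η : y.Cross F h' h) (τ : y.Hom (F.comp inr) h h₁) (η₁ : y.Cross F h' h₁),
    y.Composes (F.tri (inl j') (inr j) (inr j₁)) η.1 τ.1 η₁.1 →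
    (Sq F ξ (post π τ) π' η₁ ↔ Sq F ξ π π' η)
  /- compatibility with the composition of admissible interpretations -/
  sq_comp : ∀ {r₀ r₁ r₂ : ℕ} (F : DMap (Fin (r₀ + 1) ⊕ (Fin (r₁ + 1) ⊕ Fin (r₂ + 1))) G)
    {i₀ j₀ : Fin (r₀ + 1)} {i₁ j₁ : Fin (r₁ + 1)} {i₂ j₂ : Fin (r₂ + 1)}
    {g₀ : x.Ob (F.comp inl) i₀} {g₁ : x.Ob (F.comp (inr ∘ inl)) i₁}
    {g₂ : x.Ob (F.comp (inr ∘ inr)) i₂}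
    {h₀ : y.Ob (F.comp inl) j₀} {h₁ : y.Ob (F.comp (inr ∘ inl)) j₁}
    {h₂ : y.Ob (F.comp (inr ∘ inr)) j₂}
    (ξ₁ : x.Cross (F.comp (Sum.map id inl)) g₀ g₁) (ξ₂ : x.Cross (F.comp inr) g₁ g₂)
    (ξ : x.Cross (F.comp (Sum.map id inr)) g₀ g₂)
    (η₁ : y.Cross (F.comp (Sum.map id inl)) h₀ h₁) (η₂ : y.Cross (F.comp inr) h₁ h₂)
    (η : y.Cross (F.comp (Sum.map id inr)) h₀ h₂)
    (π₀ : P (F.comp inl) g₀ h₀) (π₁ : P (F.comp (inr ∘ inl)) g₁ h₁)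
    (π₂ : P (F.comp (inr ∘ inr)) g₂ h₂),
    x.Composes (F.tri (inl i₀) (inr (inl i₁)) (inr (inr i₂))) ξ₁.1 ξ₂.1 ξ.1 →
    y.Composes (F.tri (inl j₀) (inr (inl j₁)) (inr (inr j₂))) η₁.1 η₂.1 η.1 →
    Sq (F.comp (Sum.map id inl)) ξ₁ π₁ π₀ η₁ → Sq (F.comp inr) ξ₂ π₂ π₁ η₂ →
    Sq (F.comp (Sum.map id inr)) ξ π₂ π₀ η

namespace Mor

variable {G : DSimp M}

open Sum in
/-- All the data of the morphism are definable over `A`, uniformly in the admissible groupoids and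
in the admissible interpretations between them. -/
structure DefinableOver (L : FirstOrder.Language.{u, v}) [L.Structure M] (A : Set M) {x y : Interp G}
    (m : Mor x y) : Prop where
  P : ∀ (r : ℕ) (i j : Fin (r + 1)),
    A.Definable L {z : DMap.Var (Fin (r + 1)) G ⊕ Fin (x.S.ar 1) ⊕ Fin (y.S.ar 1) ⊕
        Fin (m.ar r) → M |
      ∃ (f : DMap (Fin (r + 1)) G) (g : x.Ob f i) (h : y.Ob f j) (π : m.P f g h),
        z = Sum.elim f.code (Sum.elim g.1.1 (Sum.elim h.1.1 π.1))}
  pre : ∀ (r : ℕ) (i i' j : Fin (r + 1)),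
    A.Definable L {z : DMap.Var (Fin (r + 1)) G ⊕ Fin (x.S.ar 2) ⊕ Fin (y.S.ar 1) ⊕
        Fin (m.ar r) ⊕ Fin (m.ar r) → M |
      ∃ (f : DMap (Fin (r + 1)) G) (g : x.Ob f i) (g' : x.Ob f i') (h : y.Ob f j)
        (σ : x.Hom f g g') (π : m.P f g' h),
        z = Sum.elim f.code (Sum.elim σ.1.1 (Sum.elim h.1.1 (Sum.elim π.1 (m.pre σ π).1)))}
  post : ∀ (r : ℕ) (i j j' : Fin (r + 1)),
    A.Definable L {z : DMap.Var (Fin (r + 1)) G ⊕ Fin (x.S.ar 1) ⊕ Fin (y.S.ar 2) ⊕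
        Fin (m.ar r) ⊕ Fin (m.ar r) → M |
      ∃ (f : DMap (Fin (r + 1)) G) (g : x.Ob f i) (h : y.Ob f j) (h' : y.Ob f j')
        (π : m.P f g h) (τ : y.Hom f h h'),
        z = Sum.elim f.code (Sum.elim g.1.1 (Sum.elim τ.1.1 (Sum.elim π.1 (m.post π τ).1)))}
  Sq : ∀ (r' r : ℕ) (i' j' : Fin (r' + 1)) (i j : Fin (r + 1)),
    A.Definable L {z : DMap.Var (Fin (r' + 1) ⊕ Fin (r + 1)) G ⊕ Fin (x.S.ar 2) ⊕
        Fin (m.ar r) ⊕ Fin (m.ar r') ⊕ Fin (y.S.ar 2) → M |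
      ∃ (F : DMap (Fin (r' + 1) ⊕ Fin (r + 1)) G)
        (g' : x.Ob (F.comp inl) i') (g : x.Ob (F.comp inr) i)
        (h' : y.Ob (F.comp inl) j') (h : y.Ob (F.comp inr) j)
        (ξ : x.Cross F g' g) (π : m.P (F.comp inr) g h) (π' : m.P (F.comp inl) g' h')
        (η : y.Cross F h' h), m.Sq F ξ π π' η ∧
        z = Sum.elim F.code (Sum.elim ξ.1.1 (Sum.elim π.1 (Sum.elim π'.1 η.1.1)))}

/-- `π` is the arrow `σ`, when the arrows of `K(H)` from one copy of `x(H)` to the other are those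
of `x(H)`. -/
def IsArrow {x : Interp G} (m : Mor x x) {r : ℕ} {f : DMap (Fin (r + 1)) G} {i j : Fin (r + 1)}
    {g : x.Ob f i} {h : x.Ob f j} (π : m.P f g h) (σ : x.Hom f g h) : Prop :=
  ∃ hr : m.ar r = x.S.ar 2, π.1 = (σ.1 : Fin (x.S.ar 2) → M) ∘ Fin.cast hr

open Sum in
/-- `m` is the identity morphism of `x` (the degenerate `1`-simplex on `x`): for each `H`, the
co-span of the identity interpretation, in which the arrows from one copy of `x(H)` to the other one
are those of `x(H)`. -/
structure IsIdentity {x : Interp G} (m : Mor x x) : Prop where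
  ar_eq : ∀ r, m.ar r = x.S.ar 2
  arrow : ∀ {r : ℕ} {f : DMap (Fin (r + 1)) G} {i j : Fin (r + 1)}
    {g : x.Ob f i} {h : x.Ob f j} (π : m.P f g h), ∃ σ : x.Hom f g h, m.IsArrow π σ
  all : ∀ {r : ℕ} {f : DMap (Fin (r + 1)) G} {i j : Fin (r + 1)}
    {g : x.Ob f i} {h : x.Ob f j} (σ : x.Hom f g h), ∃ π : m.P f g h, m.IsArrow π σ
  pre : ∀ {r : ℕ} {f : DMap (Fin (r + 1)) G} {i i' j : Fin (r + 1)}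
    {g : x.Ob f i} {g' : x.Ob f i'} {h : x.Ob f j}
    (τ : x.Hom f g g') (π : m.P f g' h) (σ : x.Hom f g' h) (ρ : x.Hom f g h),
    m.IsArrow π σ → x.Composes (f.tri i i' j) τ.1 σ.1 ρ.1 → m.IsArrow (m.pre τ π) ρ
  post : ∀ {r : ℕ} {f : DMap (Fin (r + 1)) G} {i j j' : Fin (r + 1)}
    {g : x.Ob f i} {h : x.Ob f j} {h' : x.Ob f j'}
    (π : m.P f g h) (σ : x.Hom f g h) (τ : x.Hom f h h') (ρ : x.Hom f g h'),
    m.IsArrow π σ → x.Composes (f.tri i j j') σ.1 τ.1 ρ.1 → m.IsArrow (m.post π τ) ρ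
  Sq : ∀ {r' r : ℕ} (F : DMap (Fin (r' + 1) ⊕ Fin (r + 1)) G)
    {i' j' : Fin (r' + 1)} {i j : Fin (r + 1)}
    {g' : x.Ob (F.comp inl) i'} {g : x.Ob (F.comp inr) i}
    {h' : x.Ob (F.comp inl) j'} {h : x.Ob (F.comp inr) j}
    (ξ : x.Cross F g' g) (π : m.P (F.comp inr) g h) (π' : m.P (F.comp inl) g' h')
    (η : x.Cross F h' h) (σ : x.Hom (F.comp inr) g h) (σ' : x.Hom (F.comp inl) g' h'),
    m.IsArrow π σ → m.IsArrow π' σ' →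
    (m.Sq F ξ π π' η ↔ ∃ ζ : x.S.obj 2,
      x.Composes (F.tri (inl i') (inr i) (inr j)) ξ.1 σ.1 ζ ∧
      x.Composes (F.tri (inl i') (inl j') (inr j)) σ'.1 η.1 ζ)

end Mor

open Sum in
/-- A `2`-morphism with edges `a : x → y`, `b : y → z` and `c : x → z`: an isomorphism from the
composition of `a` and `b` to `c`. For each admissible `H`, the co-span of `b ∘ a` has as arrows
from `x(H)` to `z(H)` the classes of pairs of an arrow of `a` and an arrow of `b`, modulo the arrows
of `y(H)`. So an isomorphism to the co-span of `c` is a map `m` on pairs that commutes with the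
arrows of `x(H)`, `y(H)`, `z(H)` (it is then bijective on classes); it is required to be compatible
with the isomorphisms attached to the admissible interpretations. -/
structure Cell {G : DSimp M} {x y z : Interp G} (a : Mor x y) (b : Mor y z) (c : Mor x z) where
  m : ∀ {r : ℕ} {f : DMap (Fin (r + 1)) G} {i j k : Fin (r + 1)}
    {g : x.Ob f i} {h : y.Ob f j} {l : z.Ob f k}, a.P f g h → b.P f h l → c.P f g l
  m_pre : ∀ {r : ℕ} {f : DMap (Fin (r + 1)) G} {i i' j k : Fin (r + 1)}
    {g : x.Ob f i} {g' : x.Ob f i'} {h : y.Ob f j} {l : z.Ob f k}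
    (σ : x.Hom f g g') (π : a.P f g' h) (ρ : b.P f h l), m (a.pre σ π) ρ = c.pre σ (m π ρ)
  m_mid : ∀ {r : ℕ} {f : DMap (Fin (r + 1)) G} {i j j' k : Fin (r + 1)}
    {g : x.Ob f i} {h : y.Ob f j} {h' : y.Ob f j'} {l : z.Ob f k}
    (π : a.P f g h) (σ : y.Hom f h h') (ρ : b.P f h' l), m (a.post π σ) ρ = m π (b.pre σ ρ)
  m_post : ∀ {r : ℕ} {f : DMap (Fin (r + 1)) G} {i j k k' : Fin (r + 1)}
    {g : x.Ob f i} {h : y.Ob f j} {l : z.Ob f k} {l' : z.Ob f k'}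
    (π : a.P f g h) (ρ : b.P f h l) (σ : z.Hom f l l'), m π (b.post ρ σ) = c.post (m π ρ) σ
  m_sq : ∀ {r' r : ℕ} (F : DMap (Fin (r' + 1) ⊕ Fin (r + 1)) G)
    {i' j' k' : Fin (r' + 1)} {i j k : Fin (r + 1)}
    {g' : x.Ob (F.comp inl) i'} {g : x.Ob (F.comp inr) i}
    {h' : y.Ob (F.comp inl) j'} {h : y.Ob (F.comp inr) j}
    {l' : z.Ob (F.comp inl) k'} {l : z.Ob (F.comp inr) k}
    (ξ : x.Cross F g' g) (η : y.Cross F h' h) (ζ : z.Cross F l' l)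
    (π : a.P (F.comp inr) g h) (π' : a.P (F.comp inl) g' h')
    (ρ : b.P (F.comp inr) h l) (ρ' : b.P (F.comp inl) h' l'),
    a.Sq F ξ π π' η → b.Sq F η ρ ρ' ζ → c.Sq F ξ (m π ρ) (m π' ρ') ζ

namespace Cell

variable {G : DSimp M}

/-- The `2`-morphism is definable over `A`, uniformly in the admissible groupoids. -/
def DefinableOver (L : FirstOrder.Language.{u, v}) [L.Structure M] (A : Set M) {x y z : Interp G}
    {a : Mor x y} {b : Mor y z} {c : Mor x z} (α : Cell a b c) : Prop :=
  ∀ (r : ℕ) (i j k : Fin (r + 1)),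
    A.Definable L {z' : DMap.Var (Fin (r + 1)) G ⊕ Fin (x.S.ar 1) ⊕ Fin (y.S.ar 1) ⊕
        Fin (z.S.ar 1) ⊕ Fin (a.ar r) ⊕ Fin (b.ar r) ⊕ Fin (c.ar r) → M |
      ∃ (f : DMap (Fin (r + 1)) G) (g : x.Ob f i) (h : y.Ob f j) (l : z.Ob f k)
        (π : a.P f g h) (ρ : b.P f h l),
        z' = Sum.elim f.code (Sum.elim g.1.1 (Sum.elim h.1.1 (Sum.elim l.1.1
          (Sum.elim π.1 (Sum.elim ρ.1 (α.m π ρ).1)))))}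

/-- The four `2`-morphisms are the faces of a `3`-simplex: the face `023` is the `2`-composition of
the three others. -/
def IsTetrahedron {x₀ x₁ x₂ x₃ : Interp G} {a₀₁ : Mor x₀ x₁} {a₀₂ : Mor x₀ x₂} {a₀₃ : Mor x₀ x₃}
    {a₁₂ : Mor x₁ x₂} {a₁₃ : Mor x₁ x₃} {a₂₃ : Mor x₂ x₃} (α₀₁₂ : Cell a₀₁ a₁₂ a₀₂)
    (α₀₁₃ : Cell a₀₁ a₁₃ a₀₃) (α₀₂₃ : Cell a₀₂ a₂₃ a₀₃) (α₁₂₃ : Cell a₁₂ a₂₃ a₁₃) : Prop :=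
  ∀ {r : ℕ} {f : DMap (Fin (r + 1)) G} {i j k l : Fin (r + 1)}
    {g₀ : x₀.Ob f i} {g₁ : x₁.Ob f j} {g₂ : x₂.Ob f k} {g₃ : x₃.Ob f l}
    (π : a₀₁.P f g₀ g₁) (ρ : a₁₂.P f g₁ g₂) (τ : a₂₃.P f g₂ g₃),
    α₀₂₃.m (α₀₁₂.m π ρ) τ = α₀₁₃.m π (α₁₂₃.m ρ τ)

/-- `α` is the degenerate `2`-simplex on `b` whose first edge is the identity `a`. -/
def IsLeftDegenerate {x y : Interp G} {a : Mor x x} {b : Mor x y} (α : Cell a b b) : Prop :=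
  a.IsIdentity ∧
  ∀ {r : ℕ} {f : DMap (Fin (r + 1)) G} {i j k : Fin (r + 1)}
    {g : x.Ob f i} {h : x.Ob f j} {l : y.Ob f k} (π : a.P f g h) (σ : x.Hom f g h)
    (ρ : b.P f h l), a.IsArrow π σ → α.m π ρ = b.pre σ ρ

/-- `α` is the degenerate `2`-simplex on `a` whose second edge is the identity `b`. -/
def IsRightDegenerate {x y : Interp G} {a : Mor x y} {b : Mor y y} (α : Cell a b a) : Prop :=
  b.IsIdentity ∧
  ∀ {r : ℕ} {f : DMap (Fin (r + 1)) G} {i j k : Fin (r + 1)}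
    {g : x.Ob f i} {h : y.Ob f j} {l : y.Ob f k} (π : a.P f g h) (ρ : b.P f h l)
    (σ : y.Hom f h l), b.IsArrow ρ σ → α.m π ρ = a.post π σ

end Cell

end Interp

/-! ## The map `ω` -/

section Omega

variable {M : Type w}

theorem DSimp.homotopic_refl {S : DSimp M} (hS : S.IsTwoGroupoid) {k : Fin 3}
    (α : S.obj k.castSucc) : S.Homotopic α α := by
  refine ⟨S.d (i := k.succ) (j := k.castSucc) (ς (m := (k : ℕ)) 0) α, ?_, ?_, fun i _ _ => rfl⟩
  · have h := hS.1.2 k.castSucc k.succ k.castSucc (δ (m := (k : ℕ)) 0) (ς (m := (k : ℕ)) 0) α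
    have e : (ς (m := (k : ℕ)) 0).comp (δ (m := (k : ℕ)) 0) = OrderHom.id := by
      ext v
      simp [ς, δ]
    exact h.symm.trans ((congrArg (fun t => S.d (i := k.castSucc) (j := k.castSucc) t α) e).trans
      (hS.1.1 _ _))
  · have h := hS.1.2 k.castSucc k.succ k.castSucc (δ (m := (k : ℕ)) 1) (ς (m := (k : ℕ)) 0) α
    have e : (ς (m := (k : ℕ)) 0).comp (δ (m := (k : ℕ)) 1) = OrderHom.id := by
      ext v
      refine Fin.cases ?_ (fun v => ?_) v <;> simp [ς, δ]
    exact h.symm.trans ((congrArg (fun t => S.d (i := k.castSucc) (j := k.castSucc) t α) e).trans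
      (hS.1.1 _ _))

/-- The interpretation `ω_a`: it takes `G^*` to `G` and `*` to `a`. -/
def omegaObj {G : DSimp M} (hG : G.IsTwoGroupoid) (a : G.obj 0) : Interp G where
  S := G
  e _ g := g
  star := a
  isTwoGroupoid := hG
  isMap _ _ _ _ := rfl
  objects b := Or.inl ⟨b, rfl⟩
  weakEquivalence _ _ :=
    ⟨fun _ _ _ _ h => h, fun h hh => ⟨h, hh, DSimp.homotopic_refl hG h⟩⟩
  injective _ _ _ h := h
  full _ g := ⟨fun _ _ => ⟨_, rfl⟩, fun _ => ⟨g, rfl⟩⟩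

/-- The morphisms of `G` from `a` to `b`. -/
def Edge (G : DSimp M) (a b : G.obj 0) : Type w :=
  {t : G.obj 1 // G.f1 1 t = a ∧ G.f1 0 t = b}

/-- The `2`-morphisms of `G` with edges `r : a → b`, `s : b → c`, `t : a → c`. -/
def Triangle (G : DSimp M) {a b c : G.obj 0} (r : Edge G a b) (s : Edge G b c) (t : Edge G a c) :
    Type w :=
  {σ : G.obj 2 // G.f2 2 σ = r.1 ∧ G.f2 0 σ = s.1 ∧ G.f2 1 σ = t.1}

/-- A map of `2`-groupoids from `G(M)` to `I²(M)` that extends `a ↦ ω_a`: it preserves faces (by its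
type), degeneracies, and the elements of dimension `3`. -/
structure OmegaMap {G : DSimp M} (hG : G.IsTwoGroupoid) where
  mor : ∀ {a b : G.obj 0}, Edge G a b → Mor (omegaObj hG a) (omegaObj hG b)
  cell : ∀ {a b c : G.obj 0} {r : Edge G a b} {s : Edge G b c} {t : Edge G a c},
    Triangle G r s t → Cell (mor r) (mor s) (mor t)
  identity : ∀ {a : G.obj 0} (t : Edge G a a), t.1 = G.s0 a → (mor t).IsIdentity
  degenerate_left : ∀ {a b : G.obj 0} {r : Edge G a a} {t : Edge G a b} (σ : Triangle G r t t),
    σ.1 = G.s1 0 t.1 → (cell σ).IsLeftDegenerate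
  degenerate_right : ∀ {a b : G.obj 0} {t : Edge G a b} {s : Edge G b b} (σ : Triangle G t s t),
    σ.1 = G.s1 1 t.1 → (cell σ).IsRightDegenerate
  tetrahedron : ∀ {a₀ a₁ a₂ a₃ : G.obj 0} {t₀₁ : Edge G a₀ a₁} {t₀₂ : Edge G a₀ a₂}
    {t₀₃ : Edge G a₀ a₃} {t₁₂ : Edge G a₁ a₂} {t₁₃ : Edge G a₁ a₃} {t₂₃ : Edge G a₂ a₃}
    (σ₀₁₂ : Triangle G t₀₁ t₁₂ t₀₂) (σ₀₁₃ : Triangle G t₀₁ t₁₃ t₀₃)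
    (σ₀₂₃ : Triangle G t₀₂ t₂₃ t₀₃) (σ₁₂₃ : Triangle G t₁₂ t₂₃ t₁₃) (Θ : G.obj 3),
    G.f3 3 Θ = σ₀₁₂.1 → G.f3 2 Θ = σ₀₁₃.1 → G.f3 1 Θ = σ₀₂₃.1 → G.f3 0 Θ = σ₁₂₃.1 →
    (cell σ₀₁₂).IsTetrahedron (cell σ₀₁₃) (cell σ₀₂₃) (cell σ₁₂₃)

/-- For `t : a → b` and objects `g : a → f(i)` of `ω_a(Hom(*, f))` and `h : b → f(i)` of
`ω_b(Hom(*, f))`: the `2`-morphisms of `G` with edges `t`, `h`, `g`. These are the arrows from `g`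
to `h` in the groupoid induced by `t`. -/
def ArrowsOver {G : DSimp M} (hG : G.IsTwoGroupoid) {a b : G.obj 0} (t : Edge G a b) {I : Type}
    {f : DMap I G} {i : I} (g : (omegaObj hG a).Ob f i) (h : (omegaObj hG b).Ob f i) : Type w :=
  {σ : G.obj 2 // G.f2 2 σ = t.1 ∧ G.f2 1 σ = g.1 ∧ G.f2 0 σ = h.1}

open Sum in
/-- The map `ω` is the one induced by the `2`-groupoid structure: for each `t : a → b`, the co-spans
of `ω_t` are identified with those formed by the `2`-morphisms of `G` over `t`, in such a way that
all compositions in `ω_t`, the isomorphisms attached to the admissible interpretations, and the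
values of `ω` on `2`-morphisms are given by the elements of dimension `3` of `G`. -/
structure OmegaMap.Canonical {G : DSimp M} {hG : G.IsTwoGroupoid} (ω : OmegaMap hG) where
  arrows : ∀ {a b : G.obj 0} (t : Edge G a b) {r : ℕ} {f : DMap (Fin (r + 1)) G} {i : Fin (r + 1)}
    {g : (omegaObj hG a).Ob f i} {h : (omegaObj hG b).Ob f i},
    ArrowsOver hG t g h ≃ (ω.mor t).P f g h
  comp : ∀ {a b : G.obj 0} (t : Edge G a b) {r : ℕ} {f : DMap (Fin (r + 1)) G} {i j : Fin (r + 1)}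
    {g : (omegaObj hG a).Ob f i} {h : (omegaObj hG b).Ob f i}
    {g' : (omegaObj hG a).Ob f j} {h' : (omegaObj hG b).Ob f j}
    (σ : ArrowsOver hG t g h) (σ' : ArrowsOver hG t g' h')
    (τ : (omegaObj hG a).Hom f g g') (ρ : (omegaObj hG b).Hom f h h') (Θ : G.obj 3),
    G.f3 3 Θ = σ.1 → G.f3 2 Θ = σ'.1 → G.f3 1 Θ = τ.1 → G.f3 0 Θ = ρ.1 →
    (ω.mor t).post (arrows t σ) ρ = (ω.mor t).pre τ (arrows t σ')
  sq : ∀ {a b : G.obj 0} (t : Edge G a b) {r' r : ℕ}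
    (F : DMap (Fin (r' + 1) ⊕ Fin (r + 1)) G) {i' : Fin (r' + 1)} {i : Fin (r + 1)}
    {g' : (omegaObj hG a).Ob (F.comp inl) i'} {h' : (omegaObj hG b).Ob (F.comp inl) i'}
    {g : (omegaObj hG a).Ob (F.comp inr) i} {h : (omegaObj hG b).Ob (F.comp inr) i}
    (σ' : ArrowsOver hG t g' h') (σ : ArrowsOver hG t g h)
    (ξ : (omegaObj hG a).Cross F g' g) (η : (omegaObj hG b).Cross F h' h) (Θ : G.obj 3),
    G.f3 3 Θ = σ'.1 → G.f3 2 Θ = σ.1 → G.f3 1 Θ = ξ.1 → G.f3 0 Θ = η.1 →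
    (ω.mor t).Sq F ξ (arrows t σ) (arrows t σ') η
  cell : ∀ {a b c : G.obj 0} {r : Edge G a b} {s : Edge G b c} {t : Edge G a c}
    (α : Triangle G r s t) {q : ℕ} {f : DMap (Fin (q + 1)) G} {i : Fin (q + 1)}
    {g : (omegaObj hG a).Ob f i} {h : (omegaObj hG b).Ob f i} {l : (omegaObj hG c).Ob f i}
    (ρ : ArrowsOver hG r g h) (σ : ArrowsOver hG s h l) (τ : ArrowsOver hG t g l) (Θ : G.obj 3),
    G.f3 3 Θ = α.1 → G.f3 2 Θ = ρ.1 → G.f3 0 Θ = σ.1 → G.f3 1 Θ = τ.1 →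
    (ω.cell α).m (arrows r ρ) (arrows s σ) = arrows t τ

/-- The identifications for `ω_t` are definable over `A`, uniformly. -/
def OmegaMap.Canonical.DefinableOver (L : FirstOrder.Language.{u, v}) [L.Structure M] (A : Set M)
    {G : DSimp M} {hG : G.IsTwoGroupoid} {ω : OmegaMap hG} (c : ω.Canonical) {a b : G.obj 0}
    (t : Edge G a b) : Prop :=
  ∀ (r : ℕ) (i : Fin (r + 1)),
    A.Definable L {z : DMap.Var (Fin (r + 1)) G ⊕ Fin (G.ar 2) ⊕ Fin ((ω.mor t).ar r) → M |
      ∃ (f : DMap (Fin (r + 1)) G) (g : (omegaObj hG a).Ob f i) (h : (omegaObj hG b).Ob f i)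
        (σ : ArrowsOver hG t g h), z = Sum.elim f.code (Sum.elim σ.1.1 (c.arrows t σ).1)}

end Omega

end DefGpd

/-!
The map `ω` is the action of `G` on its own groupoids `Hom(a, f)` by composition with the arrows
`t : a → b`, where composition is only defined up to a `2`-morphism; the work is to make everything
definable and strict where the statement requires equality.

Fix `t : a → b` and `f : D^r → G`. An arrow of the co-span of `ω_t` from `g : a → f(i)` to
`h : b → f(j)` should be a `2`-morphism between the two paths `f(i, j) ∘ g` and `h ∘ t`. Compositions
are not given as objects, so it is represented by a *square*: a pair of triangles `τ` (with edges
`g`, `f(i, j)`) and `σ` (with edges `t`, `h`) that share the diagonal `02`. Two squares represent the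
same arrow when they differ by a change of the diagonal (`DSimp.SameClass`). Composition with arrows
`g' → g` and `h → h'` and composition of squares along a triangle `α` of edges of `G` are given by
elements of `G_3` (`Coding.Pre`, `DSimp.Transport`, `Coding.MulRel`). Each law that they satisfy says
that, in a `4`-simplex, four commuting faces force the fifth one to commute (`tet_0124`, `tet_0134`,
`tet_0234`); this is the unique completion of horns of dimension `4`. When `i = j`, each class of
squares contains exactly one whose side `f(i, i)` and the triangle `τ` on it are degenerate, and this
identifies the classes with the triangles of the canonical description (`Coding.arr`).

An admissible interpretation is a map `F` on a disjoint union. Both ways around, an arrow of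
`Hom(a, F)` across the two parts followed by an arrow of `ω_t`, and an arrow of `ω_t` followed by an
arrow of `Hom(b, F)` across the two parts, are classes of squares over `F`; the isomorphism `c_X` is
equality of the resulting classes (`morOfCoding`).

The classes are coded by tuples through elimination of imaginaries, which applies to formulas that
define equivalence relations in all models. This is arranged by replacing a definable relation by the
relation of having the same fibre under it (`EliminatesImaginaries.exists_code`), so that the codes
are uniform in `t`. For a degenerate edge `t`, the identity morphism has to be the co-span whose
arrows are literally those of `Hom(a, f)`, so another coding is used: the square is coded by the
triangle that it amounts to once the degenerate edge is contracted
(`exists_unit_coding`, `isIdentity_morOfCoding`).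

The interpretation `ω_a` is `2`-stable because in it `e` is the identity: formulas of the base can be
relativized to the base sort of the language of `T_G` (`Interp.BaseDefinable.formula`) and
transported along `e` (`omegaObj_isTwoStable`).
-/

namespace DefGpd

/-! ### Matching faces -/

namespace DSimp

variable {M : Type w} {S : DSimp M}

theorem exists_δ_comp {q n : ℕ} (k : Fin (n + 2)) (s : Fin (q + 1) →o Fin (n + 2))
    (hs : ∀ x, s x ≠ k) : ∃ u : Fin (q + 1) →o Fin (n + 1), (δ k).comp u = s := by
  choose u hu using fun x => Fin.exists_succAbove_eq (hs x)
  refine ⟨⟨u, fun x y hxy => ?_⟩, ?_⟩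
  · have := s.monotone hxy
    rw [← hu x, ← hu y] at this
    exact (Fin.succAboveOrderEmb k).le_iff_le.mp this
  · ext x
    exact congrArg Fin.val (hu x)

theorem δ_comp_injective {q n : ℕ} (k : Fin (n + 2)) {s s' : Fin (q + 1) →o Fin (n + 1)}
    (h : (δ k).comp s = (δ k).comp s') : s = s' := by
  ext x
  have := DFunLike.congr_fun h x
  exact congrArg Fin.val (Fin.succAbove_right_injective (p := k) this)

theorem δ_comp_δ {n : ℕ} {j l : Fin (n + 2)} (h : j ≤ l) :
    (δ (m := n + 1) l.succ).comp (δ j) = (δ (m := n + 1) j.castSucc).comp (δ l) := by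
  ext x
  simp only [δ, OrderHom.comp_coe, Function.comp, OrderEmbedding.toOrderHom_coe,
    Fin.succAboveOrderEmb_apply, Fin.succAbove, Fin.lt_def, Fin.le_def, apply_ite Fin.val,
    Fin.val_succ, Fin.val_castSucc] at *
  split_ifs <;> simp_all <;> omega

/-- Agreement on faces of codimension one suffices for elements to be matching. -/
theorem matching_of_faces (hS : S.Functorial) (m : Fin 3) (p : Fin ((m.succ : ℕ) + 2) → Prop)
    (x : ∀ j : Fin ((m.succ : ℕ) + 2), p j → S.obj m.succ)
    (h : ∀ (j l : Fin ((m : ℕ) + 2)) (_ : j ≤ l) (hj : p j.castSucc) (hl : p l.succ),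
      S.d (i := m.castSucc) (j := m.succ) (δ (m := m) j) (x l.succ hl) =
        S.d (i := m.castSucc) (j := m.succ) (δ (m := m) l) (x j.castSucc hj)) :
    S.Matching m.succ p x := by
  have key : ∀ (j l : Fin ((m.succ : ℕ) + 2)) (hj : p j) (hl : p l) (q : Fin 4)
      (s s' : Fin ((q : ℕ) + 1) →o Fin ((m.succ : ℕ) + 1)), j < l →
      (δ j).comp s = (δ l).comp s' → S.d s (x j hj) = S.d s' (x l hl) := by
    intro j l hj hl q s s' hjl he
    obtain ⟨l, rfl⟩ : ∃ l' : Fin ((m : ℕ) + 2), l = l'.succ :=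
      ⟨l.pred (Fin.ne_zero_of_lt hjl), by simp⟩
    obtain ⟨j, rfl⟩ : ∃ j' : Fin ((m : ℕ) + 2), j = j'.castSucc :=
      ⟨j.castPred (Fin.ne_last_of_lt hjl), by simp⟩
    have hle : j ≤ l := Nat.lt_succ_iff.mp (show (j : ℕ) < (l : ℕ) + 1 from hjl)
    have hs : ∀ y, s y ≠ l := by
      intro y hy
      have h1 := DFunLike.congr_fun he y
      have h2 : (δ (m := (m : ℕ) + 1) j.castSucc) (s y) = l.succ := by
        rw [hy]
        exact Fin.succAbove_of_le_castSucc _ _ (show (j : ℕ) ≤ (l : ℕ) from hle)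
      exact Fin.succAbove_ne l.succ (s' y) (h1.symm.trans h2)
    obtain ⟨u, rfl⟩ := exists_δ_comp (n := m) l s hs
    have hs' : s' = (δ (m := m) j).comp u := by
      apply δ_comp_injective (n := (m : ℕ) + 1) l.succ
      rw [← he, ← OrderHom.comp_assoc, ← OrderHom.comp_assoc]
      exact congrArg (fun t => t.comp u) (δ_comp_δ hle).symm
    rw [hs']
    have e1 := hS.2 q m.castSucc m.succ u (δ (m := m) l) (x j.castSucc hj)
    have e2 := hS.2 q m.castSucc m.succ u (δ (m := m) j) (x l.succ hl)
    exact e1.trans ((congrArg (S.d u) (h j l hle hj hl).symm).trans e2.symm)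
  intro j l hj hl q s s' he
  rcases lt_trichotomy j l with hjl | rfl | hjl
  · exact key j l hj hl q s s' hjl he
  · rw [δ_comp_injective _ he]
  · exact (key l j hl hj q s' s hjl he.symm).symm


theorem f1_f2 (hS : S.Functorial) {j l : Fin 2} (h : j ≤ l) (σ : S.obj 2) :
    S.f1 j (S.f2 l.succ σ) = S.f1 l (S.f2 j.castSucc σ) :=
  (hS.2 0 1 2 (δ (m := 0) j) (δ (m := 1) l.succ) σ).symm.trans
    ((congrArg (fun t => S.d (i := 0) (j := 2) t σ) (δ_comp_δ h)).trans
      (hS.2 0 1 2 (δ (m := 0) l) (δ (m := 1) j.castSucc) σ))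

theorem f2_f3 (hS : S.Functorial) {j l : Fin 3} (h : j ≤ l) (Θ : S.obj 3) :
    S.f2 j (S.f3 l.succ Θ) = S.f2 l (S.f3 j.castSucc Θ) :=
  (hS.2 1 2 3 (δ (m := 1) j) (δ (m := 2) l.succ) Θ).symm.trans
    ((congrArg (fun t => S.d (i := 1) (j := 3) t Θ) (δ_comp_δ h)).trans
      (hS.2 1 2 3 (δ (m := 1) l) (δ (m := 2) j.castSucc) Θ))

theorem origin_eq (hS : S.Functorial) (σ : S.obj 2) : S.f1 1 (S.f2 2 σ) = S.f1 1 (S.f2 1 σ) :=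
  f1_f2 hS (j := 1) (l := 1) le_rfl σ

theorem middle_eq (hS : S.Functorial) (σ : S.obj 2) : S.f1 0 (S.f2 2 σ) = S.f1 1 (S.f2 0 σ) :=
  f1_f2 hS (j := 0) (l := 1) (by decide) σ

theorem end_eq (hS : S.Functorial) (σ : S.obj 2) : S.f1 0 (S.f2 1 σ) = S.f1 0 (S.f2 0 σ) :=
  f1_f2 hS (j := 0) (l := 0) le_rfl σ

/-! ### Fillers of horns of dimension two -/

theorem exists_triangle_01_12 (hS : S.IsTwoGroupoid) (p q : S.obj 1) (h : S.f1 0 p = S.f1 1 q) :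
    ∃ σ : S.obj 2, S.f2 2 σ = p ∧ S.f2 0 σ = q := by
  obtain ⟨g, hg⟩ := hS.2.1 1 1 (fun j _ => (![q, q, p] : Fin 3 → S.obj 1) j)
    (matching_of_faces hS.1 0 _ _ (by
      intro j l
      fin_cases j <;> fin_cases l <;> intro hle hj hl <;>
        first | exact absurd rfl hj | exact absurd rfl hl | exact absurd hle (by decide) | exact h))
  exact ⟨g, hg 2 (by decide), hg 0 (by decide)⟩

theorem exists_triangle_01_02 (hS : S.IsTwoGroupoid) (p q : S.obj 1) (h : S.f1 1 p = S.f1 1 q) :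
    ∃ σ : S.obj 2, S.f2 2 σ = p ∧ S.f2 1 σ = q := by
  obtain ⟨g, hg⟩ := hS.2.1 1 0 (fun j _ => (![q, q, p] : Fin 3 → S.obj 1) j)
    (matching_of_faces hS.1 0 _ _ (by
      intro j l
      fin_cases j <;> fin_cases l <;> intro hle hj hl <;>
        first | exact absurd rfl hj | exact absurd rfl hl | exact absurd hle (by decide) | exact h))
  exact ⟨g, hg 2 (by decide), hg 1 (by decide)⟩

/-! ### Commutative tetrahedra -/

/-- The triangles are the faces `012`, `013`, `023`, `123` of an element of dimension `3`. Since
fillers in dimension `3` are unique, this is the relation of commutativity of a tetrahedron: any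
three of the triangles that fit together determine the fourth. -/
def Tet (S : DSimp M) (p q r s : S.obj 2) : Prop :=
  ∃ Θ : S.obj 3, S.f3 3 Θ = p ∧ S.f3 2 Θ = q ∧ S.f3 1 Θ = r ∧ S.f3 0 Θ = s

namespace Tet

variable {p q r s : S.obj 2}

theorem e01 (hS : S.Functorial) (h : S.Tet p q r s) : S.f2 2 p = S.f2 2 q := by
  obtain ⟨Θ, rfl, rfl, rfl, rfl⟩ := h
  exact f2_f3 hS (j := 2) (l := 2) le_rfl Θ

theorem e02 (hS : S.Functorial) (h : S.Tet p q r s) : S.f2 1 p = S.f2 2 r := by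
  obtain ⟨Θ, rfl, rfl, rfl, rfl⟩ := h
  exact f2_f3 hS (j := 1) (l := 2) (by decide) Θ

theorem e03 (hS : S.Functorial) (h : S.Tet p q r s) : S.f2 1 q = S.f2 1 r := by
  obtain ⟨Θ, rfl, rfl, rfl, rfl⟩ := h
  exact f2_f3 hS (j := 1) (l := 1) le_rfl Θ

theorem e12 (hS : S.Functorial) (h : S.Tet p q r s) : S.f2 0 p = S.f2 2 s := by
  obtain ⟨Θ, rfl, rfl, rfl, rfl⟩ := h
  exact f2_f3 hS (j := 0) (l := 2) (by decide) Θ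

theorem e13 (hS : S.Functorial) (h : S.Tet p q r s) : S.f2 0 q = S.f2 1 s := by
  obtain ⟨Θ, rfl, rfl, rfl, rfl⟩ := h
  exact f2_f3 hS (j := 0) (l := 1) (by decide) Θ

theorem e23 (hS : S.Functorial) (h : S.Tet p q r s) : S.f2 0 r = S.f2 0 s := by
  obtain ⟨Θ, rfl, rfl, rfl, rfl⟩ := h
  exact f2_f3 hS (j := 0) (l := 0) le_rfl Θ

theorem unique_012 (hS : S.IsTwoGroupoid) {p' : S.obj 2} (h : S.Tet p q r s)
    (h' : S.Tet p' q r s) : p = p' := by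
  obtain ⟨Θ, rfl, rfl, rfl, rfl⟩ := h
  obtain ⟨Θ', rfl, h2, h1, h0⟩ := h'
  rw [hS.2.2.1 Θ Θ' 3]
  intro j
  fin_cases j <;> intro hj <;> first | exact absurd rfl hj | (symm; assumption)

theorem unique_013 (hS : S.IsTwoGroupoid) {q' : S.obj 2} (h : S.Tet p q r s)
    (h' : S.Tet p q' r s) : q = q' := by
  obtain ⟨Θ, rfl, rfl, rfl, rfl⟩ := h
  obtain ⟨Θ', h2, rfl, h1, h0⟩ := h'
  rw [hS.2.2.1 Θ Θ' 2]
  intro j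
  fin_cases j <;> intro hj <;> first | exact absurd rfl hj | (symm; assumption)

theorem unique_023 (hS : S.IsTwoGroupoid) {r' : S.obj 2} (h : S.Tet p q r s)
    (h' : S.Tet p q r' s) : r = r' := by
  obtain ⟨Θ, rfl, rfl, rfl, rfl⟩ := h
  obtain ⟨Θ', h2, h1, rfl, h0⟩ := h'
  rw [hS.2.2.1 Θ Θ' 1]
  intro j
  fin_cases j <;> intro hj <;> first | exact absurd rfl hj | (symm; assumption)

theorem unique_123 (hS : S.IsTwoGroupoid) {s' : S.obj 2} (h : S.Tet p q r s)
    (h' : S.Tet p q r s') : s = s' := by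
  obtain ⟨Θ, rfl, rfl, rfl, rfl⟩ := h
  obtain ⟨Θ', h2, h1, h0, rfl⟩ := h'
  rw [hS.2.2.1 Θ Θ' 0]
  intro j
  fin_cases j <;> intro hj <;> first | exact absurd rfl hj | (symm; assumption)

theorem exists_012 (hS : S.IsTwoGroupoid) (h03 : S.f2 1 q = S.f2 1 r) (h13 : S.f2 0 q = S.f2 1 s)
    (h23 : S.f2 0 r = S.f2 0 s) : ∃ p, S.Tet p q r s := by
  obtain ⟨g, hg⟩ := hS.2.1 2 3 (fun j _ => (![s, r, q, q] : Fin 4 → S.obj 2) j)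
    (matching_of_faces hS.1 1 _ _ (by
      intro j l
      fin_cases j <;> fin_cases l <;> intro hle hj hl <;>
        first | exact absurd rfl hj | exact absurd rfl hl | exact absurd hle (by decide)
              | exact h03 | exact h13 | exact h23))
  exact ⟨_, g, rfl, hg 2 (by decide), hg 1 (by decide), hg 0 (by decide)⟩

theorem exists_013 (hS : S.IsTwoGroupoid) (h02 : S.f2 1 p = S.f2 2 r) (h12 : S.f2 0 p = S.f2 2 s)
    (h23 : S.f2 0 r = S.f2 0 s) : ∃ q, S.Tet p q r s := by
  obtain ⟨g, hg⟩ := hS.2.1 2 2 (fun j _ => (![s, r, p, p] : Fin 4 → S.obj 2) j)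
    (matching_of_faces hS.1 1 _ _ (by
      intro j l
      fin_cases j <;> fin_cases l <;> intro hle hj hl <;>
        first | exact absurd rfl hj | exact absurd rfl hl | exact absurd hle (by decide)
              | exact h02 | exact h12 | exact h23))
  exact ⟨_, g, hg 3 (by decide), rfl, hg 1 (by decide), hg 0 (by decide)⟩

theorem exists_023 (hS : S.IsTwoGroupoid) (h01 : S.f2 2 p = S.f2 2 q) (h12 : S.f2 0 p = S.f2 2 s)
    (h13 : S.f2 0 q = S.f2 1 s) : ∃ r, S.Tet p q r s := by
  obtain ⟨g, hg⟩ := hS.2.1 2 1 (fun j _ => (![s, p, q, p] : Fin 4 → S.obj 2) j)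
    (matching_of_faces hS.1 1 _ _ (by
      intro j l
      fin_cases j <;> fin_cases l <;> intro hle hj hl <;>
        first | exact absurd rfl hj | exact absurd rfl hl | exact absurd hle (by decide)
              | exact h01 | exact h12 | exact h13))
  exact ⟨_, g, hg 3 (by decide), hg 2 (by decide), rfl, hg 0 (by decide)⟩

theorem exists_123 (hS : S.IsTwoGroupoid) (h01 : S.f2 2 p = S.f2 2 q) (h02 : S.f2 1 p = S.f2 2 r)
    (h03 : S.f2 1 q = S.f2 1 r) : ∃ s, S.Tet p q r s := by
  obtain ⟨g, hg⟩ := hS.2.1 2 0 (fun j _ => (![p, r, q, p] : Fin 4 → S.obj 2) j)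
    (matching_of_faces hS.1 1 _ _ (by
      intro j l
      fin_cases j <;> fin_cases l <;> intro hle hj hl <;>
        first | exact absurd rfl hj | exact absurd rfl hl | exact absurd hle (by decide)
              | exact h01 | exact h02 | exact h03))
  exact ⟨_, g, hg 3 (by decide), hg 2 (by decide), hg 1 (by decide), rfl⟩

end Tet

/-! ### Coherence in dimension four -/

/-- Completion of a horn of dimension `4`, in terms of faces. -/
theorem exists_face_of_horn (hS : S.IsTwoGroupoid) (i : Fin 5) (Θ : Fin 5 → S.obj 3)
    (h : ∀ j l : Fin 4, j ≤ l → j.castSucc ≠ i → l.succ ≠ i →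
      S.f3 j (Θ l.succ) = S.f3 l (Θ j.castSucc)) :
    ∃ Θ' : S.obj 3,
      (∀ j l : Fin 4, j ≤ l → l.succ = i → S.f3 j Θ' = S.f3 l (Θ j.castSucc)) ∧
      ∀ j l : Fin 4, j ≤ l → j.castSucc = i → S.f3 j (Θ l.succ) = S.f3 l Θ' := by
  obtain ⟨y, ⟨hy, hyx⟩, -⟩ := hS.2.2.2 i (fun j _ => Θ j)
    (matching_of_faces hS.1 2 _ _ fun j l hle hj hl => h j l hle hj hl)
  have hm : ∀ j l : Fin 4, j ≤ l → S.f3 j (y l.succ) = S.f3 l (y j.castSucc) := fun j l hjl =>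
    hy l.succ j.castSucc trivial trivial 2 (δ (m := 2) j) (δ (m := 2) l) (δ_comp_δ hjl)
  have hne : ∀ j l : Fin 4, j ≤ l → j.castSucc ≠ l.succ := fun j l hjl he => by
    have h1 : (j : ℕ) ≤ l := hjl
    have h2 : (j : ℕ) = l + 1 := congrArg Fin.val he
    omega
  refine ⟨y i, ?_, ?_⟩
  · rintro j l hjl rfl
    rw [hm j l hjl, hyx _ (hne j l hjl)]
  · rintro j l hjl rfl
    rw [← hm j l hjl, hyx _ (hne j l hjl).symm]

/-! In a `4`-simplex with vertices `0, …, 4`, four commutative tetrahedra force the fifth one to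
commute: it is `0124`, `0134`, `0234` in the following lemmas. In each of them the entry of the
vector of tetrahedra at the place to be filled is irrelevant. -/

section Coherence

variable {s012 s013 s014 s023 s024 s034 s123 s124 s134 s234 : S.obj 2}

theorem tet_0124 (hS : S.IsTwoGroupoid)
    (h0123 : S.Tet s012 s013 s023 s123)
    (h0134 : S.Tet s013 s014 s034 s134)
    (h0234 : S.Tet s023 s024 s034 s234)
    (h1234 : S.Tet s123 s124 s134 s234) :
    S.Tet s012 s014 s024 s124 := by
  obtain ⟨Θ4, a4, b4, c4, d4⟩ := h0123
  obtain ⟨Θ2, a2, b2, c2, d2⟩ := h0134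
  obtain ⟨Θ1, a1, b1, c1, d1⟩ := h0234
  obtain ⟨Θ0, a0, b0, c0, d0⟩ := h1234
  obtain ⟨Θ, hl, hr⟩ := exists_face_of_horn hS 3 ![Θ0, Θ1, Θ2, Θ4, Θ4] (by
    intro j l
    fin_cases j <;> fin_cases l <;> intro hle hj hl <;>
      first | exact absurd rfl hj | exact absurd rfl hl | exact absurd hle (by decide)
            | exact b4.trans a2.symm | exact c4.trans a1.symm
            | exact c2.trans c1.symm | exact d4.trans a0.symm
            | exact d2.trans c0.symm | exact d1.trans d0.symm)
  exact ⟨Θ, (hr 3 3 (by decide) rfl).symm.trans a4,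
    (hl 2 2 (by decide) rfl).trans b2,
    (hl 1 2 (by decide) rfl).trans b1,
    (hl 0 2 (by decide) rfl).trans b0⟩

theorem tet_0134 (hS : S.IsTwoGroupoid)
    (h0123 : S.Tet s012 s013 s023 s123)
    (h0124 : S.Tet s012 s014 s024 s124)
    (h0234 : S.Tet s023 s024 s034 s234)
    (h1234 : S.Tet s123 s124 s134 s234) :
    S.Tet s013 s014 s034 s134 := by
  obtain ⟨Θ4, a4, b4, c4, d4⟩ := h0123
  obtain ⟨Θ3, a3, b3, c3, d3⟩ := h0124
  obtain ⟨Θ1, a1, b1, c1, d1⟩ := h0234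
  obtain ⟨Θ0, a0, b0, c0, d0⟩ := h1234
  obtain ⟨Θ, hl, hr⟩ := exists_face_of_horn hS 2 ![Θ0, Θ1, Θ4, Θ3, Θ4] (by
    intro j l
    fin_cases j <;> fin_cases l <;> intro hle hj hl <;>
      first | exact absurd rfl hj | exact absurd rfl hl | exact absurd hle (by decide)
            | exact a4.trans a3.symm | exact c4.trans a1.symm
            | exact c3.trans b1.symm | exact d4.trans a0.symm
            | exact d3.trans b0.symm | exact d1.trans d0.symm)
  exact ⟨Θ, (hr 2 3 (by decide) rfl).symm.trans b4,
    (hr 2 2 (by decide) rfl).symm.trans b3,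
    (hl 1 1 (by decide) rfl).trans c1,
    (hl 0 1 (by decide) rfl).trans c0⟩

theorem tet_0234 (hS : S.IsTwoGroupoid)
    (h0123 : S.Tet s012 s013 s023 s123)
    (h0124 : S.Tet s012 s014 s024 s124)
    (h0134 : S.Tet s013 s014 s034 s134)
    (h1234 : S.Tet s123 s124 s134 s234) :
    S.Tet s023 s024 s034 s234 := by
  obtain ⟨Θ4, a4, b4, c4, d4⟩ := h0123
  obtain ⟨Θ3, a3, b3, c3, d3⟩ := h0124
  obtain ⟨Θ2, a2, b2, c2, d2⟩ := h0134
  obtain ⟨Θ0, a0, b0, c0, d0⟩ := h1234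
  obtain ⟨Θ, hl, hr⟩ := exists_face_of_horn hS 1 ![Θ0, Θ4, Θ2, Θ3, Θ4] (by
    intro j l
    fin_cases j <;> fin_cases l <;> intro hle hj hl <;>
      first | exact absurd rfl hj | exact absurd rfl hl | exact absurd hle (by decide)
            | exact a4.trans a3.symm | exact b4.trans a2.symm
            | exact b3.trans b2.symm | exact d4.trans a0.symm
            | exact d3.trans b0.symm | exact d2.trans c0.symm)
  exact ⟨Θ, (hr 1 3 (by decide) rfl).symm.trans c4,
    (hr 1 2 (by decide) rfl).symm.trans c3,
    (hr 1 1 (by decide) rfl).symm.trans c2,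
    (hl 0 0 (by decide) rfl).trans d0⟩

end Coherence

/-! ### Degenerate elements -/

theorem d_eq_self (hS : S.Functorial) {i j : Fin 4} (s : Fin ((i : ℕ) + 1) →o Fin ((j : ℕ) + 1))
    (t : Fin ((j : ℕ) + 1) →o Fin ((i : ℕ) + 1)) (g : S.obj i) (h : t.comp s = OrderHom.id) :
    S.d s (S.d t g) = g := by
  rw [← hS.2, h, hS.1]

theorem d_d_eq (hS : S.Functorial) {i j j' k : Fin 4} (s : Fin ((i : ℕ) + 1) →o Fin ((j : ℕ) + 1))
    (t : Fin ((j : ℕ) + 1) →o Fin ((k : ℕ) + 1)) (s' : Fin ((i : ℕ) + 1) →o Fin ((j' : ℕ) + 1))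
    (t' : Fin ((j' : ℕ) + 1) →o Fin ((k : ℕ) + 1)) (g : S.obj k) (h : t.comp s = t'.comp s') :
    S.d s (S.d t g) = S.d s' (S.d t' g) := by
  rw [← hS.2, h, hS.2]

theorem f1_s0 (hS : S.Functorial) (k : Fin 2) (a : S.obj 0) : S.f1 k (S.s0 a) = a :=
  d_eq_self hS (i := 0) (j := 1) _ _ _ (by fin_cases k <;> decide)

theorem f2_s1_0_2 (hS : S.Functorial) (g : S.obj 1) : S.f2 2 (S.s1 0 g) = S.s0 (S.f1 1 g) :=
  d_d_eq hS (i := 1) (j := 2) (j' := 0) (k := 1) _ _ _ _ _ (by decide)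

theorem f2_s1_0_1 (hS : S.Functorial) (g : S.obj 1) : S.f2 1 (S.s1 0 g) = g :=
  d_eq_self hS (i := 1) (j := 2) _ _ _ (by decide)

theorem f2_s1_0_0 (hS : S.Functorial) (g : S.obj 1) : S.f2 0 (S.s1 0 g) = g :=
  d_eq_self hS (i := 1) (j := 2) _ _ _ (by decide)

theorem f2_s1_1_2 (hS : S.Functorial) (g : S.obj 1) : S.f2 2 (S.s1 1 g) = g :=
  d_eq_self hS (i := 1) (j := 2) _ _ _ (by decide)

theorem f2_s1_1_1 (hS : S.Functorial) (g : S.obj 1) : S.f2 1 (S.s1 1 g) = g :=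
  d_eq_self hS (i := 1) (j := 2) _ _ _ (by decide)

theorem f2_s1_1_0 (hS : S.Functorial) (g : S.obj 1) : S.f2 0 (S.s1 1 g) = S.s0 (S.f1 0 g) :=
  d_d_eq hS (i := 1) (j := 2) (j' := 0) (k := 1) _ _ _ _ _ (by decide)

theorem tet_s0 (hS : S.Functorial) (σ : S.obj 2) :
    S.Tet (S.s1 0 (S.f2 2 σ)) (S.s1 0 (S.f2 1 σ)) σ σ :=
  ⟨S.d (i := 3) (j := 2) (ς (m := 2) 0) σ,
    d_d_eq hS (i := 2) (j := 3) (j' := 1) (k := 2) _ _ _ _ _ (by decide),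
    d_d_eq hS (i := 2) (j := 3) (j' := 1) (k := 2) _ _ _ _ _ (by decide),
    d_eq_self hS (i := 2) (j := 3) _ _ _ (by decide),
    d_eq_self hS (i := 2) (j := 3) _ _ _ (by decide)⟩

theorem tet_s1 (hS : S.Functorial) (σ : S.obj 2) :
    S.Tet (S.s1 1 (S.f2 2 σ)) σ σ (S.s1 0 (S.f2 0 σ)) :=
  ⟨S.d (i := 3) (j := 2) (ς (m := 2) 1) σ,
    d_d_eq hS (i := 2) (j := 3) (j' := 1) (k := 2) _ _ _ _ _ (by decide),
    d_eq_self hS (i := 2) (j := 3) _ _ _ (by decide),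
    d_eq_self hS (i := 2) (j := 3) _ _ _ (by decide),
    d_d_eq hS (i := 2) (j := 3) (j' := 1) (k := 2) _ _ _ _ _ (by decide)⟩

theorem tet_s2 (hS : S.Functorial) (σ : S.obj 2) :
    S.Tet σ σ (S.s1 1 (S.f2 1 σ)) (S.s1 1 (S.f2 0 σ)) :=
  ⟨S.d (i := 3) (j := 2) (ς (m := 2) 2) σ,
    d_eq_self hS (i := 2) (j := 3) _ _ _ (by decide),
    d_eq_self hS (i := 2) (j := 3) _ _ _ (by decide),
    d_d_eq hS (i := 2) (j := 3) (j' := 1) (k := 2) _ _ _ _ _ (by decide),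
    d_d_eq hS (i := 2) (j := 3) (j' := 1) (k := 2) _ _ _ _ _ (by decide)⟩

end DSimp

/-! ### Maps from contractible simplicial sets -/

namespace DMap

variable {M : Type w} {S : DSimp M} {I J : Type} (f : DMap I S)

theorem d_toFun {i j : Fin 4} (t : Fin ((i : ℕ) + 1) →o Fin ((j : ℕ) + 1))
    (c : Fin ((j : ℕ) + 1) → I) (c' : Fin ((i : ℕ) + 1) → I) (h : c ∘ t = c') :
    S.d t (f.toFun j c) = f.toFun i c' := by
  rw [f.natural, h]

@[simp] theorem f1_edge_1 (i j : I) : S.f1 1 (f.edge i j) = f.vertex i :=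
  f.d_toFun (i := 0) (j := 1) _ _ _ (by ext x; fin_cases x; rfl)

@[simp] theorem f1_edge_0 (i j : I) : S.f1 0 (f.edge i j) = f.vertex j :=
  f.d_toFun (i := 0) (j := 1) _ _ _ (by ext x; fin_cases x; rfl)

@[simp] theorem f2_tri_2 (i j k : I) : S.f2 2 (f.tri i j k) = f.edge i j :=
  f.d_toFun (i := 1) (j := 2) _ _ _ (by ext x; fin_cases x <;> rfl)

@[simp] theorem f2_tri_1 (i j k : I) : S.f2 1 (f.tri i j k) = f.edge i k :=
  f.d_toFun (i := 1) (j := 2) _ _ _ (by ext x; fin_cases x <;> rfl)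

@[simp] theorem f2_tri_0 (i j k : I) : S.f2 0 (f.tri i j k) = f.edge j k :=
  f.d_toFun (i := 1) (j := 2) _ _ _ (by ext x; fin_cases x <;> rfl)

theorem edge_self (i : I) : f.edge i i = S.s0 (f.vertex i) :=
  (f.d_toFun (i := 1) (j := 0) _ _ _ (by ext x; fin_cases x <;> rfl)).symm

theorem tri_self_left (i j : I) : f.tri i i j = S.s1 0 (f.edge i j) :=
  (f.d_toFun (i := 2) (j := 1) _ _ _ (by ext x; fin_cases x <;> rfl)).symm

theorem tri_self_right (i j : I) : f.tri i j j = S.s1 1 (f.edge i j) :=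
  (f.d_toFun (i := 2) (j := 1) _ _ _ (by ext x; fin_cases x <;> rfl)).symm

theorem tet (i j k l : I) : S.Tet (f.tri i j k) (f.tri i j l) (f.tri i k l) (f.tri j k l) :=
  ⟨f.toFun 3 ![i, j, k, l],
    f.d_toFun (i := 2) (j := 3) _ _ _ (by ext x; fin_cases x <;> rfl),
    f.d_toFun (i := 2) (j := 3) _ _ _ (by ext x; fin_cases x <;> rfl),
    f.d_toFun (i := 2) (j := 3) _ _ _ (by ext x; fin_cases x <;> rfl),
    f.d_toFun (i := 2) (j := 3) _ _ _ (by ext x; fin_cases x <;> rfl)⟩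

theorem edge_comp (h : J → I) (i j : J) : (f.comp h).edge i j = f.edge (h i) (h j) :=
  congrArg (f.toFun 1) (by ext x; fin_cases x <;> rfl)

theorem tri_comp (h : J → I) (i j k : J) : (f.comp h).tri i j k = f.tri (h i) (h j) (h k) :=
  congrArg (f.toFun 2) (by ext x; fin_cases x <;> rfl)

end DMap

/-! ### Squares and their transport -/

namespace DSimp

variable {M : Type w} {S : DSimp M}

/-- The triangles `τ` and `σ` form a square: `σ` has first edge `t`, and `σ` and `τ` share the
edge `02`, the diagonal. The square has the sides `g = τ₀₁` and `e = τ₁₂` on one side of the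
diagonal and `t` and `h = σ₁₂` on the other, so it fills the gap between the compositions `e ∘ g`
and `h ∘ t`. -/
def IsSquare (S : DSimp M) (t : S.obj 1) (τ σ : S.obj 2) : Prop :=
  S.f2 2 σ = t ∧ S.f2 1 σ = S.f2 1 τ

/-- The square `(τ', σ')` is obtained from the square `(τ, σ)`, which has the same side `g`, by
composition with `β`, over the triangle `κ₀` of the base. -/
def Transport (S : DSimp M) (κ₀ τ σ τ' σ' β : S.obj 2) : Prop :=
  ∃ κ, S.Tet τ τ' κ κ₀ ∧ S.Tet σ σ' κ β

/-- Two squares with the same sides are equivalent when they differ by a change of the diagonal. -/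
def SameClass (S : DSimp M) (τ σ τ' σ' : S.obj 2) : Prop :=
  S.Transport (S.s1 1 (S.f2 0 τ)) τ σ τ' σ' (S.s1 1 (S.f2 0 σ))

variable {t : S.obj 1} {τ σ τ' σ' τ₁ σ₁ τ₁' σ₁' τ'' σ'' β β' γ ρ κ₀ κ₁ κ₂ κ₃ α : S.obj 2}

namespace Transport

theorem isSquare (hS : S.IsTwoGroupoid) (h : S.Transport κ₀ τ σ τ' σ' β)
    (hx : S.IsSquare t τ σ) : S.IsSquare t τ' σ' := by
  obtain ⟨κ, h1, h2⟩ := h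
  exact ⟨(h2.e01 hS.1).symm.trans hx.1, (h2.e03 hS.1).trans (h1.e03 hS.1).symm⟩

/-- Transport along `β` and then along `γ` is transport along their composition `ρ`. -/
theorem comp (hS : S.IsTwoGroupoid) (h : S.Transport κ₀ τ σ τ' σ' β)
    (h' : S.Transport κ₁ τ' σ' τ'' σ'' γ) (hκ : S.Tet κ₀ κ₂ κ₁ κ₃) (hβ : S.Tet β ρ γ κ₃) :
    S.Transport κ₂ τ σ τ'' σ'' ρ := by
  obtain ⟨κ, h1, h2⟩ := h
  obtain ⟨κ', h1', h2'⟩ := h'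
  obtain ⟨κ'', h3⟩ := Tet.exists_013 hS (p := κ) (r := κ') (s := κ₃)
    ((h1.e03 hS.1).symm.trans (h1'.e02 hS.1)) ((h1.e23 hS.1).trans (hκ.e12 hS.1))
    ((h1'.e23 hS.1).trans (hκ.e23 hS.1))
  exact ⟨κ'', tet_0124 hS h1 h1' h3 hκ, tet_0124 hS h2 h2' h3 hβ⟩

theorem unique (hS : S.IsTwoGroupoid) (h : S.Transport κ₀ τ σ τ' σ' β)
    (h' : S.Transport κ₀ τ σ τ' σ' β') : β = β' := by
  obtain ⟨κ, h1, h2⟩ := h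
  obtain ⟨κ', h1', h2'⟩ := h'
  obtain rfl := h1.unique_023 hS h1'
  exact h2.unique_123 hS h2'

/-- Two squares on the same side `g` are related by a unique transport. -/
theorem exists_arrow (hS : S.IsTwoGroupoid) (hx : S.IsSquare t τ σ) (hy : S.IsSquare t τ' σ')
    (hg : S.f2 2 τ = S.f2 2 τ') (he : S.f2 0 τ = S.f2 2 κ₀) (he' : S.f2 0 τ' = S.f2 1 κ₀) :
    ∃ β, S.Transport κ₀ τ σ τ' σ' β := by
  obtain ⟨κ, h1⟩ := Tet.exists_023 hS hg he he'
  obtain ⟨β, h2⟩ := Tet.exists_123 hS (p := σ) (q := σ') (r := κ) (hx.1.trans hy.1.symm)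
    (hx.2.trans (h1.e02 hS.1)) (hy.2.trans (h1.e03 hS.1))
  exact ⟨β, κ, h1, h2⟩

/-- A square can be composed with any `β` that starts at its side `h`. -/
theorem exists_square (hS : S.IsTwoGroupoid) (hx : S.IsSquare t τ σ)
    (he : S.f2 0 τ = S.f2 2 κ₀) (hβ : S.f2 2 β = S.f2 0 σ) (hβ' : S.f2 0 β = S.f2 0 κ₀) :
    ∃ τ' σ', S.Transport κ₀ τ σ τ' σ' β := by
  obtain ⟨σ', h1, h2⟩ := exists_triangle_01_12 hS (S.f2 2 σ) (S.f2 1 β) (by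
    rw [middle_eq hS.1, ← hβ, origin_eq hS.1])
  obtain ⟨κ, h3⟩ := Tet.exists_023 hS (p := σ) (q := σ') (s := β) h1.symm hβ.symm h2
  obtain ⟨τ', h4⟩ := Tet.exists_013 hS (p := τ) (r := κ) (s := κ₀)
    (hx.2.symm.trans (h3.e02 hS.1)) he ((h3.e23 hS.1).trans hβ')
  exact ⟨τ', σ', κ, h4, h3⟩

/-- Transport commutes with composition with `α` on the side of `g`. -/
theorem pre (hS : S.IsTwoGroupoid) (h : S.Transport κ₃ τ σ τ₁ σ₁ β) (h1 : S.Tet α τ' τ κ₀)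
    (h2 : S.Tet α τ₁' τ₁ κ₁) (hκ : S.Tet κ₀ κ₁ κ₂ κ₃) : S.Transport κ₂ τ' σ τ₁' σ₁ β := by
  obtain ⟨κ, h3, h4⟩ := h
  exact ⟨κ, tet_0134 hS h1 h2 h3 hκ, h4⟩

end Transport

theorem tet_degenerate (hS : S.IsTwoGroupoid) (g : S.obj 1) :
    S.Tet (S.s1 1 g) (S.s1 1 g) (S.s1 1 g) (S.s1 1 (S.s0 (S.f1 0 g))) := by
  have := tet_s2 hS.1 (S.s1 1 g)
  rwa [f2_s1_1_1 hS.1, f2_s1_1_0 hS.1] at this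

namespace SameClass

theorem refl (hS : S.IsTwoGroupoid) (hx : S.IsSquare t τ σ) : S.SameClass τ σ τ σ :=
  ⟨S.s1 1 (S.f2 1 τ), tet_s2 hS.1 τ, by rw [← hx.2]; exact tet_s2 hS.1 σ⟩

theorem side_01 (hS : S.IsTwoGroupoid) (h : S.SameClass τ σ τ' σ') : S.f2 2 τ = S.f2 2 τ' := by
  obtain ⟨κ, h1, h2⟩ := h
  exact h1.e01 hS.1

theorem side_12 (hS : S.IsTwoGroupoid) (h : S.SameClass τ σ τ' σ') : S.f2 0 τ = S.f2 0 τ' := by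
  obtain ⟨κ, h1, h2⟩ := h
  rw [h1.e13 hS.1, f2_s1_1_1 hS.1]

theorem side (hS : S.IsTwoGroupoid) (h : S.SameClass τ σ τ' σ') : S.f2 0 σ = S.f2 0 σ' := by
  obtain ⟨κ, h1, h2⟩ := h
  rw [h2.e13 hS.1, f2_s1_1_1 hS.1]

theorem trans (hS : S.IsTwoGroupoid) (hx : S.IsSquare t τ σ) (h : S.SameClass τ σ τ' σ')
    (h' : S.SameClass τ' σ' τ'' σ'') : S.SameClass τ σ τ'' σ'' := by
  have e1 := h.side_12 hS
  have e2 := h.side hS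
  unfold SameClass at h'
  rw [← e1, ← e2] at h'
  refine Transport.comp hS h h' (tet_degenerate hS _) ?_
  have := tet_degenerate hS (S.f2 0 σ)
  rw [← end_eq hS.1, hx.2, end_eq hS.1] at this
  exact this

theorem comp_transport (hS : S.IsTwoGroupoid)
    (h : S.SameClass τ' σ' τ σ) (h' : S.Transport κ₀ τ σ τ₁ σ₁ β) :
    S.Transport κ₀ τ' σ' τ₁ σ₁ β := by
  have e1 := h.side_12 hS
  have e2 := h.side hS
  unfold SameClass at h
  obtain ⟨κ, h1, h2⟩ := id h'
  rw [e1, e2, h1.e12 hS.1, h2.e12 hS.1] at h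
  refine Transport.comp hS h h' (tet_s1 hS.1 κ₀) ?_
  have := tet_s1 hS.1 β
  rwa [← h2.e23 hS.1, h1.e23 hS.1] at this

theorem transport_comp (hS : S.IsTwoGroupoid) (h' : S.Transport κ₀ τ σ τ₁ σ₁ β)
    (h : S.SameClass τ₁ σ₁ τ' σ') : S.Transport κ₀ τ σ τ' σ' β := by
  unfold SameClass at h
  obtain ⟨κ, h1, h2⟩ := id h'
  rw [h1.e13 hS.1, h2.e13 hS.1] at h
  refine Transport.comp hS h' h (κ₃ := S.s1 1 (S.f2 0 κ₀)) (tet_s2 hS.1 κ₀) ?_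
  have := tet_s2 hS.1 β
  rwa [← h2.e23 hS.1, h1.e23 hS.1] at this

theorem symm (hS : S.IsTwoGroupoid) (hx : S.IsSquare t τ σ) (h : S.SameClass τ σ τ' σ') :
    S.SameClass τ' σ' τ σ := by
  have hy := Transport.isSquare hS h hx
  have e1 := h.side_12 hS
  have e2 := h.side hS
  obtain ⟨β, hβ⟩ := Transport.exists_arrow hS (κ₀ := S.s1 1 (S.f2 0 τ')) hy hx
    (h.side_01 hS).symm (f2_s1_1_2 hS.1 _).symm (by rw [f2_s1_1_1 hS.1, e1])
  have h1 := h.comp_transport hS hβ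
  have h2 := SameClass.refl hS hx
  unfold SameClass at h2
  rw [← e1] at h1
  obtain rfl := h1.unique hS h2
  unfold SameClass
  rwa [← e2]

end SameClass

/-- A coding, by tuples of elements of `M`, of the equivalence classes of squares on the edge `t`.
-/
structure Coding (S : DSimp M) (t : S.obj 1) where
  n : ℕ
  code : S.obj 2 → S.obj 2 → Fin n → M
  code_eq_iff : ∀ {τ σ τ' σ' : S.obj 2}, S.IsSquare t τ σ → S.IsSquare t τ' σ' →
    (code τ σ = code τ' σ' ↔ S.SameClass τ σ τ' σ')

/-- The elements of dimension `2` over `f(i, j)` with first edge `g` and edge `02` equal to `h`: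
the arrows from `g` to `h` in a groupoid `Hom(a, f)`. -/
def IsHom {I : Type} (f : DMap I S) (i j : I) (g h : S.obj 1) (α : S.obj 2) : Prop :=
  S.f2 2 α = g ∧ S.f2 1 α = h ∧ S.f2 0 α = f.edge i j

namespace IsHom

variable {I : Type} {f : DMap I S} {i j k : I} {g h m : S.obj 1}

theorem exists_comp (hS : S.IsTwoGroupoid) (hα : IsHom f i j g h α) (hβ : IsHom f j k h m β) :
    ∃ ρ, IsHom f i k g m ρ ∧ S.Tet α ρ β (f.tri i j k) := by
  obtain ⟨ρ, h3⟩ := Tet.exists_013 hS (p := α) (r := β) (s := f.tri i j k)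
    (hα.2.1.trans hβ.1.symm) (by simp [hα.2.2]) (by simp [hβ.2.2])
  exact ⟨ρ, ⟨(h3.e01 hS.1).symm.trans hα.1, (h3.e03 hS.1).trans hβ.2.1,
    by rw [h3.e13 hS.1, f.f2_tri_1]⟩, h3⟩

theorem id (hS : S.Functorial) (hg : S.f1 0 g = f.vertex i) : IsHom f i i g g (S.s1 1 g) :=
  ⟨f2_s1_1_2 hS g, f2_s1_1_1 hS g, by rw [f2_s1_1_0 hS, hg, f.edge_self]⟩

theorem id_comp (hS : S.Functorial) (hα : IsHom f i j g h α) :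
    S.Tet (S.s1 1 g) α α (f.tri i i j) := by
  rw [← hα.1, f.tri_self_left, ← hα.2.2]
  exact tet_s1 hS α

end IsHom

namespace Coding

variable (C : S.Coding t)

/-- The codes of the squares with sides `g`, `e`, `h`. -/
def arrows (e g h : S.obj 1) : Set (Fin C.n → M) :=
  {c | ∃ τ σ, S.IsSquare t τ σ ∧ S.f2 2 τ = g ∧ S.f2 0 τ = e ∧ S.f2 0 σ = h ∧ C.code τ σ = c}

/-- The graph of the composition of classes of squares with `α` on the side of `g`. -/
def Pre (κ₀ α : S.obj 2) (c c' : Fin C.n → M) : Prop :=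
  ∃ τ σ τ', S.IsSquare t τ σ ∧ S.Tet α τ' τ κ₀ ∧ C.code τ σ = c ∧ C.code τ' σ = c'

/-- The graph of the composition of classes of squares with `β` on the side of `h`. -/
def Post (κ₀ β : S.obj 2) (c c' : Fin C.n → M) : Prop :=
  ∃ τ σ τ' σ', S.IsSquare t τ σ ∧ S.Transport κ₀ τ σ τ' σ' β ∧ C.code τ σ = c ∧ C.code τ' σ' = c'

/-- Composition of the class with code `c` with `α`, on the side of `g`. -/
noncomputable def pre (κ₀ α : S.obj 2) (c : Fin C.n → M) : Fin C.n → M :=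
  @Classical.epsilon _ ⟨c⟩ (C.Pre κ₀ α c)

/-- Composition of the class with code `c` with `β`, on the side of `h`. -/
noncomputable def post (κ₀ β : S.obj 2) (c : Fin C.n → M) : Fin C.n → M :=
  @Classical.epsilon _ ⟨c⟩ (C.Post κ₀ β c)

/-- The class of a square whose side `e` is degenerate, given by the triangle `σ`. -/
def arr (σ : S.obj 2) : Fin C.n → M := C.code (S.s1 1 (S.f2 1 σ)) σ

theorem isSquare_arr (hS : S.IsTwoGroupoid) (h : S.f2 2 σ = t) :
    S.IsSquare t (S.s1 1 (S.f2 1 σ)) σ :=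
  ⟨h, (f2_s1_1_1 hS.1 _).symm⟩

theorem isSquare_pre (hS : S.IsTwoGroupoid) (hx : S.IsSquare t τ σ) (h : S.Tet α τ' τ κ₀) :
    S.IsSquare t τ' σ := ⟨hx.1, hx.2.trans (h.e03 hS.1).symm⟩

/-- Composition with `α` respects the equivalence of squares. -/
theorem pre_code (hS : S.IsTwoGroupoid) (hx : S.IsSquare t τ σ) (h : S.Tet α τ' τ κ₀) :
    C.pre κ₀ α (C.code τ σ) = C.code τ' σ := by
  have hex : ∃ c', C.Pre κ₀ α (C.code τ σ) c' := ⟨_, τ, σ, τ', hx, h, rfl, rfl⟩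
  obtain ⟨τ₁, σ₁, τ₁', hx₁, h₁, hc, hc'⟩ := Classical.epsilon_spec hex
  refine hc'.symm.trans ((C.code_eq_iff (isSquare_pre hS hx₁ h₁) (isSquare_pre hS hx h)).2 ?_)
  have hs := (C.code_eq_iff hx₁ hx).1 hc
  unfold SameClass at hs ⊢
  rw [h₁.e23 hS.1] at hs
  rw [h₁.e13 hS.1]
  exact Transport.pre hS hs h₁ h (tet_s2 hS.1 κ₀)

/-- Composition with `β` respects the equivalence of squares. -/
theorem post_code (hS : S.IsTwoGroupoid) (hx : S.IsSquare t τ σ)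
    (h : S.Transport κ₀ τ σ τ' σ' β) : C.post κ₀ β (C.code τ σ) = C.code τ' σ' := by
  have hex : ∃ c', C.Post κ₀ β (C.code τ σ) c' := ⟨_, τ, σ, τ', σ', hx, h, rfl, rfl⟩
  obtain ⟨τ₁, σ₁, τ₁', σ₁', hx₁, h₁, hc, hc'⟩ := Classical.epsilon_spec hex
  have hy := h.isSquare hS hx
  have hy₁ := h₁.isSquare hS hx₁
  refine hc'.symm.trans ((C.code_eq_iff hy₁ hy).2 ?_)
  have hs := ((C.code_eq_iff hx₁ hx).1 hc).comp_transport hS h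
  -- both squares are transports of `(τ₁, σ₁)` along `β`
  obtain ⟨κ, a1, a2⟩ := h₁
  obtain ⟨κ', b1, b2⟩ := hs
  obtain ⟨ν, c1⟩ := Tet.exists_023 hS (p := τ₁') (q := τ') (s := S.s1 1 (S.f2 0 τ₁'))
    ((a1.e01 hS.1).symm.trans (b1.e01 hS.1)) (f2_s1_1_2 hS.1 _).symm
    (by rw [f2_s1_1_1 hS.1, a1.e13 hS.1, b1.e13 hS.1])
  refine ⟨ν, c1, ?_⟩
  rw [a1.e13 hS.1] at c1
  have c2 := tet_0234 hS a1 b1 c1 (tet_s2 hS.1 κ₀)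
  have c3 := tet_s2 hS.1 β
  rw [← a2.e23 hS.1, a1.e23 hS.1] at c3
  rw [a2.e13 hS.1]
  exact tet_0134 hS a2 b2 c2 c3

section Laws

variable {I : Type} {f : DMap I S} {i i' i'' j j' j'' k : I} {g g' g'' h h' h'' : S.obj 1}
  {c c' : Fin C.n → M}

theorem exists_pre (hS : S.IsTwoGroupoid) (hα : IsHom f i i' g g' α) (h1 : S.f2 2 τ = g')
    (h2 : S.f2 0 τ = f.edge i' j) : ∃ τ', S.Tet α τ' τ (f.tri i i' j) :=
  Tet.exists_013 hS (hα.2.1.trans h1.symm) (by simp [hα.2.2]) (by simp [h2])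

theorem pre_mem (hS : S.IsTwoGroupoid) (hα : IsHom f i i' g g' α)
    (hc : c ∈ C.arrows (f.edge i' j) g' h) :
    C.pre (f.tri i i' j) α c ∈ C.arrows (f.edge i j) g h := by
  obtain ⟨τ, σ, hx, h1, h2, h3, rfl⟩ := hc
  obtain ⟨τ', h4⟩ := exists_pre hS hα h1 h2
  rw [C.pre_code hS hx h4]
  refine ⟨τ', σ, isSquare_pre hS hx h4, (h4.e01 hS.1).symm.trans hα.1, ?_, h3, rfl⟩
  rw [h4.e13 hS.1, f.f2_tri_1]

theorem exists_post (hS : S.IsTwoGroupoid) (hx : S.IsSquare t τ σ) (h1 : S.f2 0 τ = f.edge i j)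
    (h2 : S.f2 0 σ = h) (hβ : IsHom f j j' h h' β) :
    ∃ τ' σ', S.Transport (f.tri i j j') τ σ τ' σ' β :=
  Transport.exists_square hS hx (by simp [h1]) (hβ.1.trans h2.symm) (by simp [hβ.2.2])

theorem mem_of_transport (hS : S.IsTwoGroupoid) (hx : S.IsSquare t τ σ)
    (h1 : S.f2 2 τ = g) (hβ : IsHom f j j' h h' β)
    (ht : S.Transport (f.tri i j j') τ σ τ' σ' β) :
    C.code τ' σ' ∈ C.arrows (f.edge i j') g h' := by
  refine ⟨τ', σ', ht.isSquare hS hx, ?_, ?_, ?_, rfl⟩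
  all_goals obtain ⟨κ, h4, h5⟩ := ht
  · rw [← h4.e01 hS.1, h1]
  · rw [h4.e13 hS.1, f.f2_tri_1]
  · rw [h5.e13 hS.1, hβ.2.1]

theorem post_mem (hS : S.IsTwoGroupoid) (hc : c ∈ C.arrows (f.edge i j) g h)
    (hβ : IsHom f j j' h h' β) :
    C.post (f.tri i j j') β c ∈ C.arrows (f.edge i j') g h' := by
  obtain ⟨τ, σ, hx, h1, h2, h3, rfl⟩ := hc
  obtain ⟨τ', σ', ht⟩ := exists_post hS hx h2 h3 hβ
  rw [C.post_code hS hx ht]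
  exact C.mem_of_transport hS hx h1 hβ ht

theorem pre_comp (hS : S.IsTwoGroupoid) (hσ : IsHom f i i' g g' α) (hτ : IsHom f i' i'' g' g'' β)
    (hρ : S.Tet α ρ β (f.tri i i' i'')) (hc : c ∈ C.arrows (f.edge i'' j) g'' h) :
    C.pre (f.tri i i'' j) ρ c = C.pre (f.tri i i' j) α (C.pre (f.tri i' i'' j) β c) := by
  obtain ⟨τ, σ, hx, h1, h2, h3, rfl⟩ := hc
  obtain ⟨τ', h4⟩ := exists_pre hS hτ h1 h2
  obtain ⟨τ'', h5⟩ := exists_pre hS hσ (τ := τ') (j := j) ((h4.e01 hS.1).symm.trans hτ.1)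
    (by rw [h4.e13 hS.1, f.f2_tri_1])
  rw [C.pre_code hS hx h4, C.pre_code hS (isSquare_pre hS hx h4) h5]
  exact C.pre_code hS hx (tet_0134 hS hρ h5 h4 (f.tet _ _ _ _))

theorem pre_id (hS : S.IsTwoGroupoid) (hc : c ∈ C.arrows (f.edge i j) g h) :
    C.pre (f.tri i i j) (S.s1 1 g) c = c := by
  obtain ⟨τ, σ, hx, h1, h2, h3, rfl⟩ := hc
  refine C.pre_code hS hx ?_
  rw [f.tri_self_left, ← h1, ← h2]
  exact tet_s1 hS.1 τ

theorem post_comp (hS : S.IsTwoGroupoid) (hc : c ∈ C.arrows (f.edge i j) g h)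
    (hα : IsHom f j j' h h' α) (hβ : IsHom f j' j'' h' h'' β)
    (hρ : S.Tet α ρ β (f.tri j j' j'')) :
    C.post (f.tri i j j'') ρ c = C.post (f.tri i j' j'') β (C.post (f.tri i j j') α c) := by
  obtain ⟨τ, σ, hx, h1, h2, h3, rfl⟩ := hc
  obtain ⟨τ', σ', h4⟩ := exists_post hS hx h2 h3 hα
  have hx' := h4.isSquare hS hx
  obtain ⟨τ'', σ'', h5⟩ := exists_post hS hx' (i := i) (j := j') (by
    obtain ⟨κ, a, b⟩ := h4
    rw [a.e13 hS.1, f.f2_tri_1]) (by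
    obtain ⟨κ, a, b⟩ := h4
    rw [b.e13 hS.1, hα.2.1]) hβ
  rw [C.post_code hS hx h4, C.post_code hS hx' h5]
  exact C.post_code hS hx (h4.comp hS h5 (f.tet _ _ _ _) hρ)

theorem post_id (hS : S.IsTwoGroupoid) (hc : c ∈ C.arrows (f.edge i j) g h) :
    C.post (f.tri i j j) (S.s1 1 h) c = c := by
  obtain ⟨τ, σ, hx, h1, h2, h3, rfl⟩ := hc
  refine C.post_code hS hx ?_
  rw [f.tri_self_right, ← h3, ← h2]
  exact SameClass.refl hS hx

theorem pre_post (hS : S.IsTwoGroupoid) (hα : IsHom f i i' g g' α)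
    (hc : c ∈ C.arrows (f.edge i' j) g' h) (hβ : IsHom f j j' h h' β) :
    C.pre (f.tri i i' j') α (C.post (f.tri i' j j') β c) =
      C.post (f.tri i j j') β (C.pre (f.tri i i' j) α c) := by
  obtain ⟨τ, σ, hx, h1, h2, h3, rfl⟩ := hc
  obtain ⟨τ', h4⟩ := exists_pre hS hα h1 h2
  obtain ⟨τ₁, σ₁, h5⟩ := exists_post hS hx h2 h3 hβ
  have hx₁ := h5.isSquare hS hx
  obtain ⟨τ₁', h6⟩ := exists_pre hS hα (τ := τ₁) (j := j') (by
    obtain ⟨κ, a, b⟩ := h5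
    rw [← a.e01 hS.1, h1]) (by
    obtain ⟨κ, a, b⟩ := h5
    rw [a.e13 hS.1, f.f2_tri_1])
  rw [C.pre_code hS hx h4, C.post_code hS hx h5, C.pre_code hS hx₁ h6]
  exact (C.post_code hS (isSquare_pre hS hx h4) (h5.pre hS h4 h6 (f.tet _ _ _ _))).symm

theorem exists_left (hS : S.IsTwoGroupoid) (h : S.obj 1) (ht : S.f1 0 t = S.f1 1 h)
    (hj : S.f1 0 h = f.vertex j) :
    ∃ g, S.f1 1 g = S.f1 1 t ∧ S.f1 0 g = f.vertex j ∧ (C.arrows (f.edge j j) g h).Nonempty := by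
  obtain ⟨σ, h1, h2⟩ := exists_triangle_01_12 hS t h ht
  have h3 : S.f1 0 (S.f2 1 σ) = f.vertex j := by rw [end_eq hS.1, h2, hj]
  refine ⟨S.f2 1 σ, by rw [← origin_eq hS.1, h1], h3, _, _, σ, isSquare_arr hS h1,
    f2_s1_1_2 hS.1 _, ?_, h2, rfl⟩
  rw [f2_s1_1_0 hS.1, h3, f.edge_self]

theorem exists_right (hS : S.IsTwoGroupoid) (g : S.obj 1) (ht : S.f1 1 t = S.f1 1 g)
    (hi : S.f1 0 g = f.vertex i) :
    ∃ h, S.f1 1 h = S.f1 0 t ∧ S.f1 0 h = f.vertex i ∧ (C.arrows (f.edge i i) g h).Nonempty := by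
  obtain ⟨σ, h1, h2⟩ := exists_triangle_01_02 hS t g ht
  refine ⟨S.f2 0 σ, by rw [← middle_eq hS.1, h1], by rw [← end_eq hS.1, h2, hi], _, _, σ,
    isSquare_arr hS h1, by rw [f2_s1_1_2 hS.1, h2], ?_, rfl, rfl⟩
  rw [f2_s1_1_0 hS.1, h2, hi, f.edge_self]

theorem exists_pre_eq (hS : S.IsTwoGroupoid) (hc : c ∈ C.arrows (f.edge i j) g h)
    (hc' : c' ∈ C.arrows (f.edge i' j) g' h) :
    ∃ α, IsHom f i i' g g' α ∧ C.pre (f.tri i i' j) α c' = c := by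
  obtain ⟨τ, σ, hx, h1, h2, h3, rfl⟩ := hc
  obtain ⟨τ', σ', hx', h1', h2', h3', rfl⟩ := hc'
  obtain ⟨κ, h4⟩ := Tet.exists_023 hS (p := σ) (q := σ') (s := S.s1 1 h)
    (hx.1.trans hx'.1.symm) (by rw [h3, f2_s1_1_2 hS.1]) (by rw [h3', f2_s1_1_1 hS.1])
  have hv : S.f1 0 h = f.vertex j := by
    rw [← h3, ← end_eq hS.1, hx.2, end_eq hS.1, h2, f.f1_edge_0]
  obtain ⟨τ'', h5⟩ := Tet.exists_013 hS (p := τ) (r := κ) (s := S.s1 1 (f.edge i j))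
    (hx.2.symm.trans (h4.e02 hS.1)) (by rw [h2, f2_s1_1_2 hS.1])
    (by rw [h4.e23 hS.1, f2_s1_1_0 hS.1, f2_s1_1_0 hS.1, hv, f.f1_edge_0])
  obtain ⟨α, h6⟩ := Tet.exists_012 hS (q := τ'') (r := τ') (s := f.tri i i' j)
    (by rw [h5.e03 hS.1, ← h4.e03 hS.1, hx'.2])
    (by rw [h5.e13 hS.1, f2_s1_1_1 hS.1, f.f2_tri_1]) (by rw [h2', f.f2_tri_0])
  refine ⟨α, ⟨?_, ?_, ?_⟩, ?_⟩
  · rw [h6.e01 hS.1, ← h5.e01 hS.1, h1]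
  · rw [h6.e02 hS.1, h1']
  · rw [h6.e12 hS.1, f.f2_tri_2]
  · rw [C.pre_code hS hx' h6, eq_comm, C.code_eq_iff hx (isSquare_pre hS hx' h6)]
    exact ⟨κ, by rwa [h2], by rwa [h3]⟩

theorem pre_injective (hS : S.IsTwoGroupoid) {α' : S.obj 2} (hα : IsHom f i i' g g' α)
    (hα' : IsHom f i i' g g' α') (hc : c ∈ C.arrows (f.edge i' j) g' h)
    (he : C.pre (f.tri i i' j) α c = C.pre (f.tri i i' j) α' c) : α = α' := by
  obtain ⟨τ, σ, hx, h1, h2, h3, rfl⟩ := hc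
  obtain ⟨τ', h4⟩ := exists_pre hS hα h1 h2
  obtain ⟨τ'', h5⟩ := exists_pre hS hα' h1 h2
  rw [C.pre_code hS hx h4, C.pre_code hS hx h5,
    C.code_eq_iff (isSquare_pre hS hx h4) (isSquare_pre hS hx h5)] at he
  obtain ⟨κ, h6, h7⟩ := he
  obtain rfl := h7.unique_023 hS (tet_s2 hS.1 σ)
  have h8 := tet_s2 hS.1 τ'
  rw [← (isSquare_pre hS hx h4).2] at h8
  obtain rfl : τ'' = τ' := by
    exact h6.unique_013 hS h8
  exact h4.unique_012 hS h5

theorem exists_post_eq (hS : S.IsTwoGroupoid) (hc : c ∈ C.arrows (f.edge i j) g h)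
    (hc' : c' ∈ C.arrows (f.edge i j') g h') :
    ∃ β, IsHom f j j' h h' β ∧ C.post (f.tri i j j') β c = c' := by
  obtain ⟨τ, σ, hx, h1, h2, h3, rfl⟩ := hc
  obtain ⟨τ', σ', hx', h1', h2', h3', rfl⟩ := hc'
  obtain ⟨β, h4⟩ := Transport.exists_arrow hS hx hx' (κ₀ := f.tri i j j') (h1.trans h1'.symm)
    (by simp [h2]) (by simp [h2'])
  refine ⟨β, ?_, C.post_code hS hx h4⟩
  obtain ⟨κ, a, b⟩ := h4
  exact ⟨by rw [← b.e12 hS.1, h3], by rw [← b.e13 hS.1, h3'],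
    by rw [← b.e23 hS.1, a.e23 hS.1, f.f2_tri_0]⟩

theorem post_injective (hS : S.IsTwoGroupoid) (hβ : IsHom f j j' h h' β)
    (hβ' : IsHom f j j' h h' β') (hc : c ∈ C.arrows (f.edge i j) g h)
    (he : C.post (f.tri i j j') β c = C.post (f.tri i j j') β' c) : β = β' := by
  obtain ⟨τ, σ, hx, h1, h2, h3, rfl⟩ := hc
  obtain ⟨τ', σ', h4⟩ := exists_post hS hx h2 h3 hβ
  obtain ⟨τ'', σ'', h5⟩ := exists_post hS hx h2 h3 hβ'
  rw [C.post_code hS hx h4, C.post_code hS hx h5,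
    C.code_eq_iff (h4.isSquare hS hx) (h5.isSquare hS hx)] at he
  exact (SameClass.transport_comp hS h4 he).unique hS h5

theorem pre_cancel (hS : S.IsTwoGroupoid) (hα : IsHom f i i' g g' α)
    (hc : c ∈ C.arrows (f.edge i' j) g' h) (hc' : c' ∈ C.arrows (f.edge i' j) g' h)
    (he : C.pre (f.tri i i' j) α c = C.pre (f.tri i i' j) α c') : c = c' := by
  obtain ⟨τ, σ, hx, h1, h2, h3, rfl⟩ := hc
  obtain ⟨τ₁, σ₁, hx₁, h1', h2', h3', rfl⟩ := hc'
  obtain ⟨τ', h4⟩ := exists_pre hS hα h1 h2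
  obtain ⟨τ₁', h5⟩ := exists_pre hS hα h1' h2'
  have hx' := isSquare_pre hS hx h4
  rw [C.pre_code hS hx h4, C.pre_code hS hx₁ h5,
    C.code_eq_iff hx' (isSquare_pre hS hx₁ h5)] at he
  obtain ⟨β, h6⟩ := Transport.exists_arrow hS hx hx₁ (κ₀ := f.tri i' j j) (h1.trans h1'.symm)
    (by simp [h2]) (by simp [h2'])
  have h7 := h6.pre hS h4 h5 (f.tet i i' j j)
  unfold SameClass at he
  rw [h4.e13 hS.1, f.f2_tri_1, ← f.tri_self_right] at he
  obtain rfl := h7.unique hS he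
  refine (C.code_eq_iff hx hx₁).2 ?_
  unfold SameClass
  rwa [h2, ← f.tri_self_right]

theorem post_cancel (hS : S.IsTwoGroupoid) (hβ : IsHom f j j' h h' β)
    (hc : c ∈ C.arrows (f.edge i j) g h) (hc' : c' ∈ C.arrows (f.edge i j) g h)
    (he : C.post (f.tri i j j') β c = C.post (f.tri i j j') β c') : c = c' := by
  obtain ⟨γ, h1, h2⟩ := C.exists_post_eq hS hc hc'
  obtain ⟨ρ, hρ, h3⟩ := h1.exists_comp hS hβ
  rw [← h2, ← C.post_comp hS hc h1 hβ h3] at he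
  obtain rfl := C.post_injective hS hβ hρ hc he
  obtain rfl := h3.unique_012 hS (hβ.id_comp hS.1)
  rw [← h2, C.post_id hS hc]

/-- Every class is the composition of an arrow of `Hom(a, f)` and of a class given by a triangle. -/
theorem code_eq_pre_arr (hS : S.IsTwoGroupoid) (hx : S.IsSquare t τ σ)
    (he : S.f2 0 τ = f.edge i j) : C.code τ σ = C.pre (f.tri i j j) τ (C.arr σ) := by
  refine (C.pre_code hS (isSquare_arr hS hx.1) ?_).symm
  have := tet_s2 hS.1 τ
  rwa [← hx.2, he, ← f.tri_self_right] at this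

theorem arr_mem (hS : S.IsTwoGroupoid) (h1 : S.f2 2 σ = t) (h2 : S.f2 1 σ = g)
    (h3 : S.f2 0 σ = h) (hi : S.f1 0 g = f.vertex i) :
    C.arr σ ∈ C.arrows (f.edge i i) g h := by
  refine ⟨_, σ, isSquare_arr hS h1, ?_, ?_, h3, rfl⟩
  · rw [f2_s1_1_2 hS.1, h2]
  · rw [f2_s1_1_0 hS.1, h2, hi, f.edge_self]

theorem arr_injective (hS : S.IsTwoGroupoid) (h1 : S.f2 2 σ = t) (h2 : S.f2 1 σ = g)
    (h1' : S.f2 2 σ' = t) (h2' : S.f2 1 σ' = g) (he : C.arr σ = C.arr σ') :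
    σ = σ' := by
  obtain ⟨κ, h3, h4⟩ := (C.code_eq_iff (isSquare_arr hS h1) (isSquare_arr hS h1')).1 he
  rw [h2, h2'] at h3
  have h5 := tet_s2 hS.1 (S.s1 1 g)
  obtain rfl := h3.unique_023 hS h5
  have h6 := tet_s2 hS.1 σ
  rw [f2_s1_1_1 hS.1] at h4
  rw [h2] at h6
  obtain rfl := h4.unique_013 hS h6
  rfl

theorem exists_arr_eq (hS : S.IsTwoGroupoid) (hc : c ∈ C.arrows (f.edge i i) g h) :
    ∃ σ, S.f2 2 σ = t ∧ S.f2 1 σ = g ∧ S.f2 0 σ = h ∧ C.arr σ = c := by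
  obtain ⟨τ, σ, hx, h1, h2, h3, rfl⟩ := hc
  have hv : S.f1 0 h = f.vertex i := by
    rw [← h3, ← end_eq hS.1, hx.2, end_eq hS.1, h2, f.f1_edge_0]
  obtain ⟨σ', h4⟩ := Tet.exists_012 hS (q := σ) (r := τ) (s := S.s1 1 h) hx.2
    (by rw [h3, f2_s1_1_1 hS.1]) (by rw [h2, f2_s1_1_0 hS.1, f.edge_self, hv])
  have h5 : S.f2 2 σ' = t := (h4.e01 hS.1).trans hx.1
  have h6 : S.f2 1 σ' = g := (h4.e02 hS.1).trans h1
  have h7 : S.f2 0 σ' = h := by rw [h4.e12 hS.1, f2_s1_1_2 hS.1]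
  refine ⟨σ', h5, h6, h7, (C.code_eq_iff (isSquare_arr hS h5) hx).2 ⟨τ, ?_, by rwa [h7]⟩⟩
  have h8 := tet_s1 hS.1 τ
  have h9 : S.f1 0 g = f.vertex i := by
    rw [← h1, middle_eq hS.1, h2, f.f1_edge_1]
  rw [h6, f2_s1_1_0 hS.1, h9, ← f.edge_self]
  rw [h1, h2] at h8
  rwa [← f.tri_self_right, f.tri_self_left]

theorem post_arr (hS : S.IsTwoGroupoid) (h1 : S.f2 2 σ = t) (hT : S.Tet σ σ' τ ρ)
    (he : S.f2 0 τ = f.edge i j) :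
    C.post (f.tri i i j) ρ (C.arr σ) = C.pre (f.tri i j j) τ (C.arr σ') := by
  have hx : S.IsSquare t τ σ' := ⟨(hT.e01 hS.1).symm.trans h1, hT.e03 hS.1⟩
  rw [← C.code_eq_pre_arr hS hx he]
  refine C.post_code hS (isSquare_arr hS h1) ⟨τ, ?_, hT⟩
  rw [hT.e02 hS.1, f.tri_self_left, ← he]
  exact tet_s1 hS.1 τ

end Laws

end Coding

end DSimp

namespace DSimp

namespace Coding

variable {M : Type w} {S : DSimp M}

/-! ### Composition of squares along a triangle -/

section Mul

variable {r s t : S.obj 1} (A : S.Coding r) (B : S.Coding s) (C : S.Coding t)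

/-- The graph of the composition of classes of squares on the edges `r` and `s` along a triangle `α`
with first edge `r` and last edge `s`. -/
def MulRel (α κ₀ : S.obj 2) (c : Fin A.n → M) (c' : Fin B.n → M) (d : Fin C.n → M) : Prop :=
  ∃ τ σ τ₂ σ₂ τ' σ' ζ, S.IsSquare r τ σ ∧ S.IsSquare s τ₂ σ₂ ∧
    S.Transport κ₀ τ σ τ' σ' τ₂ ∧ S.Tet α σ' ζ σ₂ ∧
    A.code τ σ = c ∧ B.code τ₂ σ₂ = c' ∧ C.code τ' ζ = d

/-- Composition of classes of squares along the triangle `α`, over the triangle `κ₀` of the base. -/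
noncomputable def mul (α κ₀ : S.obj 2) (c : Fin A.n → M) (c' : Fin B.n → M) : Fin C.n → M :=
  @Classical.epsilon _ ⟨C.code α α⟩ (MulRel A B C α κ₀ c c')

variable {A B C} {I : Type} {f : DMap I S} {i i' j j' k k' l : I} {g g' h h' m : S.obj 1}
  {c : Fin A.n → M} {c' : Fin B.n → M}
  {α β ν ρ ω τ σ τ' σ' τ₁ σ₁ τ₁' σ₁' τ₂ σ₂ τ₂' σ₂' ζ ζ₁ : S.obj 2}

/-- Composition of squares is compatible with a change of both factors: the first one is transported
along `β`, the second one is composed with `β` on one side and transported along `ν` on the other. -/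
theorem transport_mul (hS : S.IsTwoGroupoid) (hx : S.Transport (f.tri i j j') τ σ τ₁ σ₁ β)
    (hω : S.Tet β ω τ₂' (f.tri j j' k'))
    (hy : S.Transport (f.tri j k k') τ₂ σ₂ ω σ₂' ν)
    (h1 : S.Transport (f.tri i j k) τ σ τ' σ' τ₂)
    (h2 : S.Transport (f.tri i j' k') τ₁ σ₁ τ₁' σ₁' τ₂')
    (hz : S.Tet α σ' ζ σ₂) (hz₁ : S.Tet α σ₁' ζ₁ σ₂') :
    S.Transport (f.tri i k k') τ' ζ τ₁' ζ₁ ν := by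
  obtain ⟨κ₁, a1, b1⟩ := hx.comp hS h2 (f.tet _ _ _ _) hω
  obtain ⟨κ, a, b⟩ := h1
  obtain ⟨l, a2, b2⟩ := hy
  obtain ⟨μ, a3⟩ := Tet.exists_023 hS (p := τ') (q := τ₁') (s := f.tri i k k')
    ((a.e01 hS.1).symm.trans (a1.e01 hS.1)) (by rw [a.e13 hS.1]; simp)
    (by rw [a1.e13 hS.1]; simp)
  have h3 := tet_0234 hS a a1 a3 (f.tet _ _ _ _)
  have h4 := tet_0134 hS b b1 h3 a2
  exact ⟨μ, a3, tet_0234 hS hz hz₁ h4 b2⟩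

theorem isSquare_mul (hS : S.IsTwoGroupoid) (hα : S.f2 1 α = t) (h : S.IsSquare r τ' σ')
    (hz : S.Tet α σ' ζ σ₂) : S.IsSquare t τ' ζ :=
  ⟨(hz.e02 hS.1).symm.trans hα, (hz.e03 hS.1).symm.trans h.2⟩

/-- Composition of squares respects equivalence. Equivalent factors differ by transports along
degenerate arrows, to which `transport_mul` applies. -/
theorem mul_code (hS : S.IsTwoGroupoid) (hα : S.f2 1 α = t)
    (hx : S.IsSquare r τ σ) (hy : S.IsSquare s τ₂ σ₂)
    (ht : S.Transport (f.tri i j k) τ σ τ' σ' τ₂) (hz : S.Tet α σ' ζ σ₂) :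
    mul A B C α (f.tri i j k) (A.code τ σ) (B.code τ₂ σ₂) = C.code τ' ζ := by
  have hex : ∃ d, MulRel A B C α (f.tri i j k) (A.code τ σ) (B.code τ₂ σ₂) d :=
    ⟨_, τ, σ, τ₂, σ₂, τ', σ', ζ, hx, hy, ht, hz, rfl, rfl, rfl⟩
  obtain ⟨τ₁, σ₁, τ₃, σ₃, τ₁', σ₁', ζ₁, hx₁, hy₁, ht₁, hz₁, e1, e2, e3⟩ :=
    Classical.epsilon_spec hex
  refine e3.symm.trans ((C.code_eq_iff (isSquare_mul hS hα (ht₁.isSquare hS hx₁) hz₁)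
    (isSquare_mul hS hα (ht.isSquare hS hx) hz)).2 ?_)
  have hs := (A.code_eq_iff hx₁ hx).1 e1
  have hs' := (B.code_eq_iff hy₁ hy).1 e2
  obtain ⟨κ, a, b⟩ := id ht
  obtain ⟨κ₁, a₁, b₁⟩ := id ht₁
  have q1 : S.f2 0 τ₁ = f.edge i j := by rw [a₁.e12 hS.1, f.f2_tri_2]
  have q2 : S.f2 0 τ₃ = f.edge j k := by rw [← b₁.e23 hS.1, a₁.e23 hS.1, f.f2_tri_0]
  have q3 : S.f2 0 τ₁' = f.edge i k := by rw [a₁.e13 hS.1, f.f2_tri_1]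
  unfold SameClass at hs hs' ⊢
  rw [q1, ← f.tri_self_right] at hs
  rw [q2, ← f.tri_self_right] at hs'
  rw [q3, ← f.tri_self_right, hz₁.e23 hS.1]
  refine transport_mul hS hs ?_ hs' ht₁ ht hz₁ hz
  have := tet_s1 hS.1 τ₂
  rwa [← b.e23 hS.1, a.e23 hS.1, f.f2_tri_0, ← f.tri_self_left, ← b.e12 hS.1,
    ← ((A.code_eq_iff hx₁ hx).1 e1).side hS] at this

theorem exists_mul (hS : S.IsTwoGroupoid) (h01 : S.f2 2 α = r) (h12 : S.f2 0 α = s)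
    (hx : S.IsSquare r τ σ) (hy : S.IsSquare s τ₂ σ₂)
    (h1 : S.f2 0 τ = f.edge i j) (h2 : S.f2 0 σ = h) (h3 : S.f2 2 τ₂ = h)
    (h4 : S.f2 0 τ₂ = f.edge j k) :
    ∃ τ' σ' ζ, S.Transport (f.tri i j k) τ σ τ' σ' τ₂ ∧ S.Tet α σ' ζ σ₂ := by
  obtain ⟨τ', σ', h5⟩ := exists_post hS (f := f) (i := i) (j := j) (j' := k) (h' := S.f2 1 τ₂)
    hx h1 h2 ⟨h3, rfl, h4⟩
  have h6 := h5.isSquare hS hx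
  obtain ⟨κ, a, b⟩ := id h5
  obtain ⟨ζ, h7⟩ := Tet.exists_023 hS (p := α) (q := σ') (s := σ₂) (h01.trans h6.1.symm)
    (h12.trans hy.1.symm) (by rw [b.e13 hS.1, hy.2])
  exact ⟨τ', σ', ζ, h5, h7⟩

section

variable (hS : S.IsTwoGroupoid) (h01 : S.f2 2 α = r) (h12 : S.f2 0 α = s) (h02 : S.f2 1 α = t)
include hS h01 h12 h02

theorem mul_mem (hc : c ∈ A.arrows (f.edge i j) g h) (hc' : c' ∈ B.arrows (f.edge j k) h m) :
    mul A B C α (f.tri i j k) c c' ∈ C.arrows (f.edge i k) g m := by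
  obtain ⟨τ, σ, hx, h1, h2, h3, rfl⟩ := hc
  obtain ⟨τ₂, σ₂, hy, h4, h5, h6, rfl⟩ := hc'
  obtain ⟨τ', σ', ζ, h7, h8⟩ := exists_mul hS h01 h12 hx hy h2 h3 h4 h5
  rw [mul_code hS h02 hx hy h7 h8]
  refine ⟨τ', ζ, isSquare_mul hS h02 (h7.isSquare hS hx) h8, ?_, ?_, ?_, rfl⟩
  · obtain ⟨κ, a, b⟩ := h7
    rw [← a.e01 hS.1, h1]
  · obtain ⟨κ, a, b⟩ := h7
    rw [a.e13 hS.1, f.f2_tri_1]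
  · rw [h8.e23 hS.1, h6]

theorem mul_pre (hρ : IsHom f i i' g g' ρ) (hc : c ∈ A.arrows (f.edge i' j) g' h)
    (hc' : c' ∈ B.arrows (f.edge j k) h m) :
    mul A B C α (f.tri i j k) (A.pre (f.tri i i' j) ρ c) c' =
      C.pre (f.tri i i' k) ρ (mul A B C α (f.tri i' j k) c c') := by
  obtain ⟨τ, σ, hx, h1, h2, h3, rfl⟩ := hc
  obtain ⟨τ₂, σ₂, hy, h4, h5, h6, rfl⟩ := hc'
  obtain ⟨τ', σ', ζ, h7, h8⟩ := exists_mul hS h01 h12 hx hy h2 h3 h4 h5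
  obtain ⟨τ₁, h9⟩ := exists_pre hS hρ h1 h2
  obtain ⟨τ₁', h10⟩ := exists_pre hS hρ (τ := τ') (j := k) (by
    obtain ⟨κ, a, b⟩ := h7
    rw [← a.e01 hS.1, h1]) (by
    obtain ⟨κ, a, b⟩ := h7
    rw [a.e13 hS.1, f.f2_tri_1])
  have hx' := isSquare_mul hS h02 (h7.isSquare hS hx) h8
  rw [mul_code hS h02 hx hy h7 h8, A.pre_code hS hx h9, C.pre_code hS hx' h10]
  exact mul_code hS h02 (isSquare_pre hS hx h9) hy (h7.pre hS h9 h10 (f.tet _ _ _ _)) h8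

theorem mul_mid (hc : c ∈ A.arrows (f.edge i j) g h) (hρ : IsHom f j j' h h' ρ)
    (hc' : c' ∈ B.arrows (f.edge j' k) h' m) :
    mul A B C α (f.tri i j' k) (A.post (f.tri i j j') ρ c) c' =
      mul A B C α (f.tri i j k) c (B.pre (f.tri j j' k) ρ c') := by
  obtain ⟨τ, σ, hx, h1, h2, h3, rfl⟩ := hc
  obtain ⟨τ₂, σ₂, hy, h4, h5, h6, rfl⟩ := hc'
  obtain ⟨τ₁, σ₁, h7⟩ := exists_post hS hx h2 h3 hρ
  have hx₁ := h7.isSquare hS hx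
  obtain ⟨τ', σ', ζ, h8, h9⟩ := exists_mul hS h01 h12 (i := i) (j := j') (f := f) (h := h') hx₁ hy
    (by
      obtain ⟨κ, a, b⟩ := h7
      rw [a.e13 hS.1, f.f2_tri_1]) (by
      obtain ⟨κ, a, b⟩ := h7
      rw [b.e13 hS.1, hρ.2.1]) h4 h5
  obtain ⟨ω, h10⟩ := exists_pre hS hρ h4 h5
  rw [A.post_code hS hx h7, mul_code hS h02 hx₁ hy h8 h9, B.pre_code hS hy h10]
  exact (mul_code hS h02 hx (isSquare_pre hS hy h10) (h7.comp hS h8 (f.tet _ _ _ _) h10) h9).symm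

theorem mul_post (hc : c ∈ A.arrows (f.edge i j) g h) (hc' : c' ∈ B.arrows (f.edge j k) h m)
    {m' : S.obj 1} (hρ : IsHom f k k' m m' ρ) :
    mul A B C α (f.tri i j k') c (B.post (f.tri j k k') ρ c') =
      C.post (f.tri i k k') ρ (mul A B C α (f.tri i j k) c c') := by
  obtain ⟨τ, σ, hx, h1, h2, h3, rfl⟩ := hc
  obtain ⟨τ₂, σ₂, hy, h4, h5, h6, rfl⟩ := hc'
  obtain ⟨τ', σ', ζ, h7, h8⟩ := exists_mul hS h01 h12 hx hy h2 h3 h4 h5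
  obtain ⟨τ₂', σ₂', h9⟩ := exists_post hS hy h5 h6 hρ
  have hy' := h9.isSquare hS hy
  obtain ⟨κ, a, b⟩ := id h9
  have e1 : S.f2 0 τ₂' = f.edge j k' := by rw [a.e13 hS.1, f.f2_tri_1]
  have e2 : S.f2 2 τ₂' = h := by rw [← a.e01 hS.1, h4]
  obtain ⟨τ₁', σ₁', ζ₁, h10, h11⟩ := exists_mul hS h01 h12 hx hy' h2 h3 e2 e1
  have hx' := isSquare_mul hS h02 (h7.isSquare hS hx) h8
  rw [B.post_code hS hy h9, mul_code hS h02 hx hy h7 h8, mul_code hS h02 hx hy' h10 h11]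
  refine (C.post_code hS hx' (transport_mul hS (β := S.s1 1 h) (ω := τ₂') ?_ ?_ h9 h7 h10 h8
    h11)).symm
  · have := SameClass.refl hS hx
    unfold SameClass at this
    rwa [h2, h3, ← f.tri_self_right] at this
  · have := tet_s1 hS.1 τ₂'
    rwa [e1, e2, ← f.tri_self_left] at this

theorem mul_arr (hi : S.f1 0 (S.f2 1 ρ) = f.vertex i) (hT : S.Tet α ρ τ σ) :
    mul A B C α (f.tri i i i) (A.arr ρ) (B.arr σ) = C.arr τ := by
  have h1 : S.f2 2 ρ = r := (hT.e01 hS.1).symm.trans h01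
  have h2 : S.f2 2 σ = s := (hT.e12 hS.1).symm.trans h12
  have h3 := SameClass.refl hS (isSquare_arr hS h1)
  unfold SameClass at h3
  rw [f2_s1_1_0 hS.1, hi, ← f.edge_self, ← f.tri_self_right, hT.e13 hS.1] at h3
  have := mul_code (A := A) (B := B) (C := C) hS h02 (isSquare_arr hS h1) (isSquare_arr hS h2) h3 hT
  unfold arr
  rwa [hT.e03 hS.1] at this ⊢

end

end Mul

/-! ### Identities and associativity -/

section Unit

variable {r s t : S.obj 1} {A : S.Coding r} {B : S.Coding s} {C : S.Coding t}
  {I : Type} {f : DMap I S} {i i' j j' k : I} {g g' h h' m : S.obj 1}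
  {c : Fin C.n → M} {α β ρ ρ' τ σ : S.obj 2}

/-- `c` is the class of the squares which, up to the triangle with degenerate first edge on their
side `g`, amount to the triangle `ρ`. This is of interest when the edge `t` is degenerate. -/
def IsUnitArrow (C : S.Coding t) (c : Fin C.n → M) (ρ : S.obj 2) : Prop :=
  ∃ τ σ, S.IsSquare t τ σ ∧ S.Tet (S.s1 0 (S.f2 2 τ)) σ τ ρ ∧ C.code τ σ = c

theorem exists_isUnitArrow (hS : S.IsTwoGroupoid) (ht : t = S.s0 (S.f1 1 g))
    (hc : c ∈ C.arrows (f.edge i j) g h) : ∃ ρ, IsHom f i j g h ρ ∧ C.IsUnitArrow c ρ := by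
  obtain ⟨τ, σ, hx, h1, h2, h3, rfl⟩ := hc
  obtain ⟨ρ, h4⟩ := Tet.exists_123 hS (p := S.s1 0 g) (q := σ) (r := τ)
    (by rw [f2_s1_0_2 hS.1, hx.1, ht]) (by rw [f2_s1_0_1 hS.1, h1]) hx.2
  refine ⟨ρ, ⟨?_, ?_, ?_⟩, τ, σ, hx, by rwa [h1], rfl⟩
  · rw [← h4.e12 hS.1, f2_s1_0_0 hS.1]
  · rw [← h4.e13 hS.1, h3]
  · rw [← h4.e23 hS.1, h2]

theorem isUnitArrow_s1 (hS : S.IsTwoGroupoid) (ht : t = S.s0 (S.f1 1 g)) :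
    C.IsUnitArrow (C.arr (S.s1 0 g)) (S.s1 1 g) := by
  have h1 := isSquare_arr hS (σ := S.s1 0 g) ((f2_s1_0_2 hS.1 g).trans ht.symm)
  refine ⟨_, _, h1, ?_, rfl⟩
  rw [f2_s1_0_1 hS.1, f2_s1_1_2 hS.1]
  have := tet_s0 hS.1 (S.s1 1 g)
  rwa [f2_s1_1_2 hS.1, f2_s1_1_1 hS.1] at this

/-- The class with code `c` is the composition of the class of the degenerate triangle with `ρ`. -/
theorem IsUnitArrow.eq_post (hS : S.IsTwoGroupoid) (hc : C.IsUnitArrow c ρ)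
    (hρ : IsHom f i j g h ρ) : c = C.post (f.tri i i j) ρ (C.arr (S.s1 0 g)) := by
  obtain ⟨τ, σ, hx, h1, rfl⟩ := hc
  have h2 : S.f2 0 τ = f.edge i j := by rw [h1.e23 hS.1, hρ.2.2]
  have h3 : S.f2 2 τ = g := by rw [← hρ.1, ← h1.e12 hS.1, f2_s1_0_0 hS.1]
  rw [h3] at h1
  rw [C.post_arr hS ((h1.e01 hS.1).trans hx.1) h1 h2, C.code_eq_pre_arr hS hx h2]

theorem IsUnitArrow.pre (hS : S.IsTwoGroupoid) (hc : C.IsUnitArrow c ρ)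
    (hρ : IsHom f i' j g' h ρ) (hα : IsHom f i i' g g' α) (hT : S.Tet α ρ' ρ (f.tri i i' j)) :
    C.IsUnitArrow (C.pre (f.tri i i' j) α c) ρ' := by
  obtain ⟨τ, σ, hx, h1, rfl⟩ := hc
  have h2 : S.f2 0 τ = f.edge i' j := by rw [h1.e23 hS.1, hρ.2.2]
  have h3 : S.f2 2 τ = g' := by rw [← hρ.1, ← h1.e12 hS.1, f2_s1_0_0 hS.1]
  obtain ⟨τ', h4⟩ := exists_pre hS hα h3 h2
  rw [C.pre_code hS hx h4]
  refine ⟨τ', σ, isSquare_pre hS hx h4, ?_, rfl⟩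
  rw [← h4.e01 hS.1, hα.1]
  rw [h3] at h1
  have h5 := tet_s0 hS.1 α
  rw [hα.1, hα.2.1] at h5
  exact tet_0124 hS h5 h1 h4 hT

theorem IsUnitArrow.post (hS : S.IsTwoGroupoid) (hc : C.IsUnitArrow c ρ)
    (hρ : IsHom f i j g h ρ) (hβ : IsHom f j j' h h' β) (hT : S.Tet ρ ρ' β (f.tri i j j')) :
    C.IsUnitArrow (C.post (f.tri i j j') β c) ρ' := by
  obtain ⟨τ, σ, hx, h1, rfl⟩ := hc
  have h2 : S.f2 0 τ = f.edge i j := by rw [h1.e23 hS.1, hρ.2.2]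
  have h3 : S.f2 0 σ = h := by rw [h1.e13 hS.1, hρ.2.1]
  obtain ⟨τ', σ', h4⟩ := exists_post hS hx h2 h3 hβ
  rw [C.post_code hS hx h4]
  refine ⟨τ', σ', h4.isSquare hS hx, ?_, rfl⟩
  obtain ⟨κ, a, b⟩ := h4
  rw [← a.e01 hS.1]
  exact tet_0124 hS h1 b a hT

/-- The class of the degenerate triangle is a unit for the composition of squares. -/
theorem arr_mul (hS : S.IsTwoGroupoid) (hr : r = S.s0 (S.f1 1 g))
    (hc : c ∈ C.arrows (f.edge i j) g h) :
    mul A C C (S.s1 0 t) (f.tri i i j) (A.arr (S.s1 0 g)) c = c := by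
  obtain ⟨τ, σ, hx, h1, h2, h3, rfl⟩ := hc
  refine mul_code hS (f2_s1_0_1 hS.1 t)
    (isSquare_arr hS ((f2_s1_0_2 hS.1 g).trans hr.symm)) hx (σ' := S.s1 0 (S.f2 1 τ)) ⟨τ, ?_, ?_⟩ ?_
  · rw [f2_s1_0_1 hS.1, f.tri_self_left, ← h1, ← h2]
    exact tet_s1 hS.1 τ
  · rw [← h1]
    exact tet_s0 hS.1 τ
  · rw [← hx.1, ← hx.2]
    exact tet_s0 hS.1 σ

theorem mul_of_isUnitArrow_left (hS : S.IsTwoGroupoid) {c' : Fin A.n → M}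
    (ht : S.f1 1 t = S.f1 1 g) (hr : r = S.s0 (S.f1 1 g)) (hi : S.f1 0 g = f.vertex i)
    (hc' : A.IsUnitArrow c' ρ) (hρ : IsHom f i j g h ρ) (hc : c ∈ C.arrows (f.edge j k) h m) :
    mul A C C (S.s1 0 t) (f.tri i j k) c' c = C.pre (f.tri i j k) ρ c := by
  rw [hc'.eq_post hS hρ, mul_mid hS (g := g) (h := g) (h' := h) (m := m) _ _ _
    (A.arr_mem hS _ (f2_s1_0_1 hS.1 g) (f2_s1_0_0 hS.1 g) hi) hρ hc,
    arr_mul hS hr (C.pre_mem hS hρ hc)]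
  · rw [f2_s1_0_2 hS.1, hr, ht]
  · exact f2_s1_0_0 hS.1 t
  · exact f2_s1_0_1 hS.1 t
  · rw [f2_s1_0_2 hS.1, hr]

theorem mul_of_isUnitArrow_right (hS : S.IsTwoGroupoid) {c' : Fin B.n → M}
    (hs : s = S.s0 (S.f1 0 t)) (hc : c ∈ C.arrows (f.edge i j) g h) (hc' : B.IsUnitArrow c' ρ)
    (hρ : IsHom f j k h m ρ) :
    mul C B C (S.s1 1 t) (f.tri i j k) c c' = C.post (f.tri i j k) ρ c := by
  obtain ⟨τ, σ, hx, h1, h2, h3, rfl⟩ := hc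
  obtain ⟨τ₂, σ₂, hy, h4, rfl⟩ := hc'
  have h5 : S.f2 2 τ₂ = h := by rw [← hρ.1, ← h4.e12 hS.1, f2_s1_0_0 hS.1]
  have h6 : S.f2 0 τ₂ = f.edge j k := by rw [h4.e23 hS.1, hρ.2.2]
  obtain ⟨τ', σ', ζ, h7, h8⟩ := exists_mul hS (α := S.s1 1 t) (f2_s1_1_2 hS.1 t)
    ((f2_s1_1_0 hS.1 t).trans hs.symm) hx hy h2 h3 h5 h6
  rw [mul_code hS (f2_s1_1_1 hS.1 t) hx hy h7 h8]
  refine (C.post_code hS hx ?_).symm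
  obtain ⟨κ, a, b⟩ := h7
  refine ⟨κ, a, ?_⟩
  have h9 := tet_s1 hS.1 σ
  rw [hx.1, h3, ← h5] at h9
  exact tet_0234 hS h9 h8 b h4

end Unit

section Assoc

variable {t₀₁ t₀₂ t₀₃ t₁₂ t₁₃ t₂₃ : S.obj 1} {C₀₁ : S.Coding t₀₁} {C₀₂ : S.Coding t₀₂}
  {C₀₃ : S.Coding t₀₃} {C₁₂ : S.Coding t₁₂} {C₁₃ : S.Coding t₁₃} {C₂₃ : S.Coding t₂₃}
  {I : Type} {f : DMap I S} {i j k l : I} {g₀ g₁ g₂ g₃ : S.obj 1}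
  {c : Fin C₀₁.n → M} {c' : Fin C₁₂.n → M} {c'' : Fin C₂₃.n → M}
  {α₀₁₂ α₀₁₃ α₀₂₃ α₁₂₃ : S.obj 2}

/-- Associativity of the composition of squares is coherence for the `4`-simplices whose first four
vertices span the given tetrahedron. -/
theorem mul_assoc (hS : S.IsTwoGroupoid) (hT : S.Tet α₀₁₂ α₀₁₃ α₀₂₃ α₁₂₃)
    (e01 : S.f2 2 α₀₁₂ = t₀₁) (e12 : S.f2 0 α₀₁₂ = t₁₂) (e02 : S.f2 1 α₀₁₂ = t₀₂)
    (e03 : S.f2 1 α₀₁₃ = t₀₃) (e13 : S.f2 0 α₀₁₃ = t₁₃) (e23 : S.f2 0 α₀₂₃ = t₂₃)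
    (hc : c ∈ C₀₁.arrows (f.edge i j) g₀ g₁) (hc' : c' ∈ C₁₂.arrows (f.edge j k) g₁ g₂)
    (hc'' : c'' ∈ C₂₃.arrows (f.edge k l) g₂ g₃) :
    mul C₀₂ C₂₃ C₀₃ α₀₂₃ (f.tri i k l) (mul C₀₁ C₁₂ C₀₂ α₀₁₂ (f.tri i j k) c c') c'' =
      mul C₀₁ C₁₃ C₀₃ α₀₁₃ (f.tri i j l) c (mul C₁₂ C₂₃ C₁₃ α₁₂₃ (f.tri j k l) c' c'') := by
  have d01 : S.f2 2 α₀₁₃ = t₀₁ := (hT.e01 hS.1).symm.trans e01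
  have d02 : S.f2 2 α₀₂₃ = t₀₂ := (hT.e02 hS.1).symm.trans e02
  have d03 : S.f2 1 α₀₂₃ = t₀₃ := (hT.e03 hS.1).symm.trans e03
  have d12 : S.f2 2 α₁₂₃ = t₁₂ := (hT.e12 hS.1).symm.trans e12
  have d13 : S.f2 1 α₁₂₃ = t₁₃ := (hT.e13 hS.1).symm.trans e13
  have d23 : S.f2 0 α₁₂₃ = t₂₃ := (hT.e23 hS.1).symm.trans e23
  obtain ⟨τ, σ, hx, h1, h2, h3, rfl⟩ := hc
  obtain ⟨τ₂, σ₂, hy, h4, h5, h6, rfl⟩ := hc'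
  obtain ⟨τ₃, σ₃, hz, h7, h8, h9, rfl⟩ := hc''
  obtain ⟨τ', σ', ζ, m1, n1⟩ := exists_mul hS e01 e12 hx hy h2 h3 h4 h5
  obtain ⟨τ₂', σ₂', ξ, m2, n2⟩ := exists_mul hS d12 d23 hy hz h5 h6 h7 h8
  have hy' := m2.isSquare hS hy
  have hw := isSquare_mul hS d13 hy' n2
  obtain ⟨κ, a, b⟩ := id m2
  have p1 : S.f2 2 τ₂' = g₁ := by rw [← a.e01 hS.1, h4]
  have p2 : S.f2 0 τ₂' = f.edge j l := by rw [a.e13 hS.1, f.f2_tri_1]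
  obtain ⟨τ₄, σ₄, ζ₄, m3, n3⟩ := exists_mul hS e01 e12 hx hy' h2 h3 p1 p2
  obtain ⟨υ, n4⟩ := Tet.exists_023 hS (p := α₀₁₃) (q := σ₄) (s := ξ)
    (d01.trans (m3.isSquare hS hx).1.symm) (by rw [e13, ← d13, n2.e02 hS.1])
    (by
      obtain ⟨_, _, b'⟩ := m3
      rw [b'.e13 hS.1, ← hy'.2, n2.e03 hS.1])
  have n5 := tet_0234 hS hT n3 n4 n2
  have m4 : S.Transport (f.tri i k l) τ' ζ τ₄ ζ₄ τ₃ := by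
    refine transport_mul hS (β := S.s1 1 g₁) (ω := τ₂') (j' := j) (τ₁ := τ) (σ₁ := σ)
      ?_ ?_ m2 m1 m3 n1 n3
    · have := SameClass.refl hS hx
      unfold SameClass at this
      rwa [h2, h3, ← f.tri_self_right] at this
    · have := tet_s1 hS.1 τ₂'
      rwa [p1, p2, ← f.tri_self_left] at this
  rw [mul_code hS e02 hx hy m1 n1, mul_code hS d13 hy hz m2 n2,
    mul_code hS d03 (isSquare_mul hS e02 (m1.isSquare hS hx) n1) hz m4 n5,
    mul_code hS e03 hx hw m3 n4]

end Assoc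

end Coding

end DSimp

/-! ### The morphisms and `2`-morphisms of the map `ω` -/

section Omega

variable {M : Type w} {G : DSimp M} (hG : G.IsTwoGroupoid)

theorem composes_iff_tet {a : G.obj 0} {κ σ τ ρ : G.obj 2} :
    (omegaObj hG a).Composes κ σ τ ρ ↔ G.Tet σ ρ τ κ :=
  ⟨fun ⟨Θ, h1, h2, h3, h4⟩ => ⟨Θ, h1, h3, h2, h4⟩, fun ⟨Θ, h1, h3, h2, h4⟩ => ⟨Θ, h1, h2, h3, h4⟩⟩

variable {a b c : G.obj 0}

theorem Hom.isHom {I : Type} {f : DMap I G} {i j : I} {g : (omegaObj hG a).Ob f i}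
    {h : (omegaObj hG a).Ob f j} (σ : (omegaObj hG a).Hom f g h) :
    DSimp.IsHom f i j g.1 h.1 σ.1 := σ.2

theorem Cross.isHom {I' I : Type} {F : DMap (I' ⊕ I) G} {i' : I'} {i : I}
    {g' : (omegaObj hG a).Ob (F.comp Sum.inl) i'} {g : (omegaObj hG a).Ob (F.comp Sum.inr) i}
    (σ : (omegaObj hG a).Cross F g' g) :
    DSimp.IsHom F (Sum.inl i') (Sum.inr i) g'.1 g.1 σ.1 := σ.2

theorem mem_comp {I J : Type} {t : G.obj 1} {C : G.Coding t} {F : DMap I G} {e : J → I} {i j : J}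
    {g h : G.obj 1} {c : Fin C.n → M} (hc : c ∈ C.arrows ((F.comp e).edge i j) g h) :
    c ∈ C.arrows (F.edge (e i) (e j)) g h := by
  rwa [DMap.edge_comp] at hc

theorem isHom_comp {I J : Type} {F : DMap I G} {e : J → I} {i j : J}
    {g h : G.obj 1} {α : G.obj 2} (hα : DSimp.IsHom (F.comp e) i j g h α) :
    DSimp.IsHom F (e i) (e j) g h α := by
  rwa [DSimp.IsHom, DMap.edge_comp] at hα

open Sum in
/-- The morphism `ω_t`, for a coding of the squares on `t`: the arrows from `g` to `h` in the
co-span of `Hom(*, f)` are the classes of squares with sides `g`, `f(i, j)` and `t`, `h`. The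
compositions of a cross arrow with such classes on its two sides are classes of squares for the map
`F`, and `Sq F` is equality of these. -/
noncomputable def morOfCoding (t : Edge G a b) (C : G.Coding t.1) :
    Mor (omegaObj hG a) (omegaObj hG b) where
  ar _ := C.n
  P f i j g h := C.arrows (f.edge i j) g.1 h.1
  pre {r f i i' j g g' h} σ π :=
    ⟨C.pre (f.tri i i' j) σ.1 π.1, C.pre_mem hG (Hom.isHom hG σ) π.2⟩
  post {r f i j j' g h h'} π σ :=
    ⟨C.post (f.tri i j j') σ.1 π.1, C.post_mem hG π.2 (Hom.isHom hG σ)⟩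
  pre_comp σ τ ρ π h := Subtype.ext (C.pre_comp hG (Hom.isHom hG σ) (Hom.isHom hG τ)
    ((composes_iff_tet hG).1 h) π.2)
  pre_id {r f i j g h} σ π hσ := Subtype.ext (by
    change C.pre _ σ.1 _ = _
    rw [hσ]
    exact C.pre_id hG π.2)
  post_comp π σ τ ρ h := Subtype.ext (C.post_comp hG π.2 (Hom.isHom hG σ) (Hom.isHom hG τ)
    ((composes_iff_tet hG).1 h))
  post_id π σ hσ := Subtype.ext (by
    change C.post _ σ.1 _ = _
    rw [hσ]
    exact C.post_id hG π.2)
  pre_post σ π τ := Subtype.ext (C.pre_post hG (Hom.isHom hG σ) π.2 (Hom.isHom hG τ))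
  exists_left f j h := by
    obtain ⟨g, h1, h2, c, hc⟩ := C.exists_left (f := f) hG h.1 (t.2.2.trans h.2.1.symm) h.2.2
    exact ⟨j, ⟨g, h1.trans t.2.1, h2⟩, c, hc⟩
  exists_right f i g := by
    obtain ⟨h, h1, h2, c, hc⟩ := C.exists_right (f := f) hG g.1 (t.2.1.trans g.2.1.symm) g.2.2
    exact ⟨i, ⟨h, h1.trans t.2.2, h2⟩, c, hc⟩
  unique_left π π' := by
    obtain ⟨σ, h1, h2⟩ := C.exists_pre_eq hG π.2 π'.2
    refine ⟨⟨σ, h1⟩, Subtype.ext h2, fun σ' h => Subtype.ext ?_⟩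
    exact C.pre_injective hG (Hom.isHom hG σ') h1 π'.2
      ((congrArg Subtype.val h).trans h2.symm)
  unique_right π π' := by
    obtain ⟨σ, h1, h2⟩ := C.exists_post_eq hG π.2 π'.2
    refine ⟨⟨σ, h1⟩, Subtype.ext h2, fun σ' h => Subtype.ext ?_⟩
    exact C.post_injective hG (Hom.isHom hG σ') h1 π.2
      ((congrArg Subtype.val h).trans h2.symm)
  Sq {r' r} F {i' j' i j g' g h' h} ξ π π' η :=
    C.pre (F.tri (inl i') (inr i) (inr j)) ξ.1 π.1 =
      C.post (F.tri (inl i') (inl j') (inr j)) η.1 π'.1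
  sq_mid_right {r' r} F {i' j' i i₁ j g' g g₁ h' h} ξ σ ξ₁ π π' η hc := by
    change _ = _ ↔ C.pre _ _ (C.pre ((F.comp inr).tri i i₁ j) _ _) = _
    rw [C.pre_comp hG (Cross.isHom hG ξ) (isHom_comp (Hom.isHom hG σ))
      ((composes_iff_tet hG).1 hc) (mem_comp π.2), DMap.tri_comp]
  sq_mid_left {r' r} F {i' j' j₁ i j g' g h' h₁ h} ξ π π' τ η₁ η hc := by
    change _ = C.post _ _ (C.post ((F.comp inl).tri i' j' j₁) _ _) ↔ _ = _
    rw [C.post_comp hG (mem_comp π'.2) (isHom_comp (Hom.isHom hG τ)) (Cross.isHom hG η₁)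
      ((composes_iff_tet hG).1 hc), DMap.tri_comp]
  sq_total {r' r} F {i' j' i j g' g h' h} ξ π π' := by
    obtain ⟨η, h1, h2⟩ := C.exists_post_eq hG (mem_comp π'.2)
      (C.pre_mem hG (Cross.isHom hG ξ) (mem_comp π.2))
    refine ⟨⟨η, h1⟩, h2.symm, fun η' h => Subtype.ext ?_⟩
    exact C.post_injective hG (Cross.isHom hG η') h1 (mem_comp π'.2) (h.symm.trans h2.symm)
  sq_bijective {r' r} F {i' j' i j g' g h' h} π π' η := by
    obtain ⟨ξ, h1, h2⟩ := C.exists_pre_eq hG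
      (C.post_mem hG (mem_comp π'.2) (Cross.isHom hG η)) (mem_comp π.2)
    refine ⟨⟨ξ, h1⟩, h2, fun ξ' h => Subtype.ext ?_⟩
    exact C.pre_injective hG (Cross.isHom hG ξ') h1 (mem_comp π.2) (h.trans h2.symm)
  sq_left {r' r} F {i' i₁ j' i j g' g₁ g h' h} σ ξ ξ₁ π π' η hc := by
    change C.pre _ _ _ = C.post _ _ (C.pre ((F.comp inl).tri i₁ i' j') _ _) ↔ _ = _
    have hσ := isHom_comp (Hom.isHom hG σ)
    rw [C.pre_comp hG hσ (Cross.isHom hG ξ) ((composes_iff_tet hG).1 hc) (mem_comp π.2),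
      DMap.tri_comp, ← C.pre_post hG hσ (mem_comp π'.2) (Cross.isHom hG η)]
    exact ⟨C.pre_cancel hG hσ (C.pre_mem hG (Cross.isHom hG ξ) (mem_comp π.2))
      (C.post_mem hG (mem_comp π'.2) (Cross.isHom hG η)), congrArg _⟩
  sq_right {r' r} F {i' j' i j j₁ g' g h' h h₁} ξ π π' η τ η₁ hc := by
    change C.pre _ _ (C.post ((F.comp inr).tri i j j₁) _ _) = _ ↔ _ = _
    have hτ := isHom_comp (Hom.isHom hG τ)
    rw [C.post_comp hG (mem_comp π'.2) (Cross.isHom hG η) hτ ((composes_iff_tet hG).1 hc),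
      DMap.tri_comp, C.pre_post hG (Cross.isHom hG ξ) (mem_comp π.2) hτ]
    exact ⟨C.post_cancel hG hτ (C.pre_mem hG (Cross.isHom hG ξ) (mem_comp π.2))
      (C.post_mem hG (mem_comp π'.2) (Cross.isHom hG η)), congrArg _⟩
  sq_comp {r₀ r₁ r₂} F {i₀ j₀ i₁ j₁ i₂ j₂ g₀ g₁ g₂ h₀ h₁ h₂} ξ₁ ξ₂ ξ η₁ η₂ η π₀ π₁ π₂
      hξ hη e₁ e₂ := by
    have kξ₁ : DSimp.IsHom F (inl i₀) (inr (inl i₁)) g₀.1 g₁.1 ξ₁.1 :=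
      isHom_comp (Cross.isHom hG ξ₁)
    have kξ₂ : DSimp.IsHom F (inr (inl i₁)) (inr (inr i₂)) g₁.1 g₂.1 ξ₂.1 :=
      isHom_comp (Cross.isHom hG ξ₂)
    have kη₁ : DSimp.IsHom F (inl j₀) (inr (inl j₁)) h₀.1 h₁.1 η₁.1 :=
      isHom_comp (Cross.isHom hG η₁)
    have kη₂ : DSimp.IsHom F (inr (inl j₁)) (inr (inr j₂)) h₁.1 h₂.1 η₂.1 :=
      isHom_comp (Cross.isHom hG η₂)
    have m₀ := mem_comp (e := inl) π₀.2
    have m₁ : π₁.1 ∈ C.arrows (F.edge (inr (inl i₁)) (inr (inl j₁))) g₁.1 h₁.1 :=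
      mem_comp (e := inr ∘ inl) π₁.2
    have m₂ : π₂.1 ∈ C.arrows (F.edge (inr (inr i₂)) (inr (inr j₂))) g₂.1 h₂.1 :=
      mem_comp (e := inr ∘ inr) π₂.2
    change C.pre ((F.comp _).tri _ _ _) _ _ = C.post ((F.comp _).tri _ _ _) _ _ at e₁ e₂ ⊢
    rw [DMap.tri_comp, DMap.tri_comp] at e₁ e₂ ⊢
    change C.pre (F.tri (inl i₀) (inr (inl i₁)) (inr (inl j₁))) _ _ =
      C.post (F.tri (inl i₀) (inl j₀) (inr (inl j₁))) _ _ at e₁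
    change C.pre (F.tri (inl i₀) (inr (inr i₂)) (inr (inr j₂))) _ _ =
      C.post (F.tri (inl i₀) (inl j₀) (inr (inr j₂))) _ _
    rw [C.pre_comp hG kξ₁ kξ₂ ((composes_iff_tet hG).1 hξ) m₂, e₂,
      C.pre_post hG kξ₁ m₁ kη₂, e₁, C.post_comp hG m₀ kη₁ kη₂ ((composes_iff_tet hG).1 hη)]

/-- The `2`-morphism `ω_α`: composition of squares along the triangle `α`. -/
noncomputable def cellOfTriangle {r : Edge G a b} {s : Edge G b c} {t : Edge G a c}
    (A : G.Coding r.1) (B : G.Coding s.1) (C : G.Coding t.1) (α : Triangle G r s t) :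
    Cell (morOfCoding hG r A) (morOfCoding hG s B) (morOfCoding hG t C) where
  m {q f i j k g h l} π ρ := ⟨DSimp.Coding.mul A B C α.1 (f.tri i j k) π.1 ρ.1,
    DSimp.Coding.mul_mem hG α.2.1 α.2.2.1 α.2.2.2 π.2 ρ.2⟩
  m_pre σ π ρ := Subtype.ext
    (DSimp.Coding.mul_pre hG α.2.1 α.2.2.1 α.2.2.2 (Hom.isHom hG σ) π.2 ρ.2)
  m_mid π σ ρ := Subtype.ext
    (DSimp.Coding.mul_mid hG α.2.1 α.2.2.1 α.2.2.2 π.2 (Hom.isHom hG σ) ρ.2)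
  m_post π ρ σ := Subtype.ext
    (DSimp.Coding.mul_post hG α.2.1 α.2.2.1 α.2.2.2 π.2 ρ.2 (Hom.isHom hG σ))
  m_sq {r' q} F {i' j' k' i j k g' g h' h l' l} ξ η ζ π π' ρ ρ' e₁ e₂ := by
    change C.pre _ _ (DSimp.Coding.mul A B C _ ((F.comp Sum.inr).tri _ _ _) _ _) =
      C.post _ _ (DSimp.Coding.mul A B C _ ((F.comp Sum.inl).tri _ _ _) _ _)
    change A.pre _ _ _ = A.post _ _ _ at e₁
    change B.pre _ _ _ = B.post _ _ _ at e₂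
    have hξ := Cross.isHom hG ξ
    have hη := Cross.isHom hG η
    have hζ := Cross.isHom hG ζ
    rw [DMap.tri_comp, DMap.tri_comp,
      ← DSimp.Coding.mul_pre hG α.2.1 α.2.2.1 α.2.2.2 hξ (mem_comp π.2) (mem_comp ρ.2), e₁,
      DSimp.Coding.mul_mid hG α.2.1 α.2.2.1 α.2.2.2 (mem_comp π'.2) hη (mem_comp ρ.2), e₂,
      DSimp.Coding.mul_post hG α.2.1 α.2.2.1 α.2.2.2 (mem_comp π'.2) (mem_comp ρ'.2) hζ]

/-- A coding for a degenerate edge which takes squares to the triangles they amount to. -/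
def DSimp.Coding.IsUnit {t : G.obj 1} (C : G.Coding t) : Prop :=
  ∃ hn : C.n = G.ar 2, ∀ (d : Fin C.n → M) (ρ : G.obj 2), C.IsUnitArrow d ρ →
    d = (ρ : Fin (G.ar 2) → M) ∘ Fin.cast hn

theorem isArrow_iff {t : Edge G a a} {C : G.Coding t.1} (ht : t.1 = G.s0 a) (hC : C.IsUnit)
    {r : ℕ} {f : DMap (Fin (r + 1)) G} {i j : Fin (r + 1)}
    {g : (omegaObj hG a).Ob f i} {h : (omegaObj hG a).Ob f j}
    (π : (morOfCoding hG t C).P f g h) (σ : (omegaObj hG a).Hom f g h) :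
    (morOfCoding hG t C).IsArrow π σ ↔ C.IsUnitArrow π.1 σ.1 := by
  obtain ⟨hn, hC⟩ := hC
  have hg : G.f1 1 g.1 = a := g.2.1
  obtain ⟨ρ, hρ, hu⟩ := C.exists_isUnitArrow hG (g := g.1) (by rw [ht, hg]) π.2
  constructor
  · rintro ⟨hr, h1⟩
    have h2 := hC _ _ hu
    have : ρ = σ.1 := by
      apply Subtype.ext
      have h3 : ρ.1 ∘ Fin.cast hn = σ.1.1 ∘ Fin.cast hn := h2.symm.trans h1
      funext x
      exact congrFun h3 (Fin.cast hn.symm x)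
    rwa [← this]
  · exact fun h1 => ⟨hn, hC _ _ h1⟩

theorem isIdentity_morOfCoding {t : Edge G a a} {C : G.Coding t.1} (ht : t.1 = G.s0 a)
    (hC : C.IsUnit) : (morOfCoding hG t C).IsIdentity where
  ar_eq _ := hC.1
  arrow {r f i j g h} π := by
    obtain ⟨ρ, hρ, hu⟩ := C.exists_isUnitArrow hG (g := g.1)
      (by rw [ht]; exact congrArg _ g.2.1.symm) π.2
    exact ⟨⟨ρ, hρ⟩, (isArrow_iff hG ht hC π ⟨ρ, hρ⟩).2 hu⟩
  all {r f i j g h} σ := by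
    have hg : t.1 = G.s0 (G.f1 1 g.1) := by rw [ht]; exact congrArg _ g.2.1.symm
    have hm : C.arr (G.s1 0 g.1) ∈ C.arrows (f.edge i i) g.1 g.1 :=
      C.arr_mem hG ((DSimp.f2_s1_0_2 hG.1 _).trans hg.symm) (DSimp.f2_s1_0_1 hG.1 _)
        (DSimp.f2_s1_0_0 hG.1 _) g.2.2
    refine ⟨⟨_, C.post_mem hG hm (Hom.isHom hG σ)⟩, (isArrow_iff hG ht hC _ σ).2 ?_⟩
    exact (C.isUnitArrow_s1 hG hg).post hG (DSimp.IsHom.id hG.1 g.2.2) (Hom.isHom hG σ)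
      ((Hom.isHom hG σ).id_comp hG.1)
  pre τ π σ ρ h hc := by
    rw [isArrow_iff hG ht hC] at h ⊢
    exact h.pre hG (Hom.isHom hG σ) (Hom.isHom hG τ) ((composes_iff_tet hG).1 hc)
  post π σ τ ρ h hc := by
    rw [isArrow_iff hG ht hC] at h ⊢
    exact h.post hG (Hom.isHom hG σ) (Hom.isHom hG τ) ((composes_iff_tet hG).1 hc)
  Sq {r' r} F {i' j' i j g' g h' h} ξ π π' η σ σ' hσ hσ' := by
    rw [isArrow_iff hG ht hC] at hσ hσ'
    change C.pre (F.tri _ _ _) _ _ = C.post (F.tri _ _ _) _ _ ↔ _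
    have kξ := Cross.isHom hG ξ
    have kη := Cross.isHom hG η
    have kσ := isHom_comp (Hom.isHom hG σ)
    have kσ' := isHom_comp (Hom.isHom hG σ')
    obtain ⟨ζ, -, hζ⟩ := kξ.exists_comp hG kσ
    obtain ⟨ζ', -, hζ'⟩ := kσ'.exists_comp hG kη
    have u := hσ.pre hG kσ kξ hζ
    have u' := hσ'.post hG kσ' kη hζ'
    obtain ⟨hn, hC⟩ := hC
    constructor
    · intro he
      rw [he] at u
      have h1 := (hC _ _ u).symm.trans (hC _ _ u')
      obtain rfl : ζ = ζ' := by
        apply Subtype.ext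
        funext x
        exact congrFun h1 (Fin.cast hn.symm x)
      exact ⟨ζ, (composes_iff_tet hG).2 hζ, (composes_iff_tet hG).2 hζ'⟩
    · rintro ⟨ζ₁, h1, h2⟩
      obtain rfl := hζ.unique_013 hG ((composes_iff_tet hG).1 h1)
      obtain rfl := hζ'.unique_013 hG ((composes_iff_tet hG).1 h2)
      exact (hC _ _ u).trans (hC _ _ u').symm

/-- The map `ω`, for a choice of a coding for each edge. -/
noncomputable def omegaMap (C : ∀ t : G.obj 1, G.Coding t) (hC : ∀ a, (C (G.s0 a)).IsUnit) :
    OmegaMap hG where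
  mor t := morOfCoding hG t (C t.1)
  cell α := cellOfTriangle hG _ _ _ α
  identity {a} t ht := isIdentity_morOfCoding hG ht (ht ▸ hC a)
  degenerate_left {a b r t} α hα := by
    have hr : r.1 = G.s0 a := by
      rw [← α.2.1, hα, DSimp.f2_s1_0_2 hG.1, t.2.1]
    have hu : (C r.1).IsUnit := hr ▸ hC a
    refine ⟨isIdentity_morOfCoding hG hr hu, ?_⟩
    intro q f i j k g h l π σ ρ hπ
    rw [isArrow_iff hG hr hu] at hπ
    refine Subtype.ext ?_
    change DSimp.Coding.mul _ _ _ α.1 _ _ _ = _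
    rw [hα]
    have hg : G.f1 1 g.1 = a := g.2.1
    exact DSimp.Coding.mul_of_isUnitArrow_left hG (t.2.1.trans hg.symm) (by rw [hr, hg]) g.2.2 hπ
      (Hom.isHom hG σ) ρ.2
  degenerate_right {a b t s} α hα := by
    have hs : s.1 = G.s0 b := by
      rw [← α.2.2.1, hα, DSimp.f2_s1_1_0 hG.1, t.2.2]
    have hu : (C s.1).IsUnit := hs ▸ hC b
    refine ⟨isIdentity_morOfCoding hG hs hu, ?_⟩
    intro q f i j k g h l π ρ σ hρ
    rw [isArrow_iff hG hs hu] at hρ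
    refine Subtype.ext ?_
    change DSimp.Coding.mul _ _ _ α.1 _ _ _ = _
    rw [hα]
    exact DSimp.Coding.mul_of_isUnitArrow_right hG (by rw [hs, t.2.2]) π.2 hρ (Hom.isHom hG σ)
  tetrahedron σ₀₁₂ σ₀₁₃ σ₀₂₃ σ₁₂₃ Θ h3 h2 h1 h0 := by
    intro r f i j k l g₀ g₁ g₂ g₃ π ρ τ
    exact Subtype.ext (DSimp.Coding.mul_assoc hG ⟨Θ, h3, h2, h1, h0⟩ σ₀₁₂.2.1 σ₀₁₂.2.2.1
      σ₀₁₂.2.2.2 σ₀₁₃.2.2.2 σ₀₁₃.2.2.1 σ₀₂₃.2.2.1 π.2 ρ.2 τ.2)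

/-- The triangles on the edge `t` give the classes of squares over the degenerate edges of `f`. -/
noncomputable def omegaMapCanonical (C : ∀ t : G.obj 1, G.Coding t)
    (hC : ∀ a, (C (G.s0 a)).IsUnit) : (omegaMap hG C hC).Canonical where
  arrows {a b} t {r f i g h} := Equiv.ofBijective
    (fun σ => ⟨(C t.1).arr σ.1, (C t.1).arr_mem hG σ.2.1 σ.2.2.1 σ.2.2.2 g.2.2⟩) <| by
      constructor
      · intro σ σ' he
        exact Subtype.ext ((C t.1).arr_injective hG σ.2.1 σ.2.2.1 σ'.2.1 σ'.2.2.1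
          (congrArg Subtype.val he))
      · rintro ⟨d, hd⟩
        obtain ⟨σ, h1, h2, h3, h4⟩ := (C t.1).exists_arr_eq hG hd
        exact ⟨⟨σ, h1, h2, h3⟩, Subtype.ext h4⟩
  comp {a b} t {r f i j g h g' h'} σ σ' τ ρ Θ h3 h2 h1 h0 :=
    Subtype.ext ((C t.1).post_arr hG σ.2.1 ⟨Θ, h3, h2, h1, h0⟩ (Hom.isHom hG τ).2.2)
  sq {a b} t {r' r} F {i' i g' h' g h} σ' σ ξ η Θ h3 h2 h1 h0 :=
    ((C t.1).post_arr hG σ'.2.1 ⟨Θ, h3, h2, h1, h0⟩ (Cross.isHom hG ξ).2.2).symm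
  cell {a b c r s t} α {q f i g h l} ρ σ τ Θ h3 h2 h0 h1 := by
    refine Subtype.ext (DSimp.Coding.mul_arr hG α.2.1 α.2.2.1 α.2.2.2 ?_ ⟨Θ, h3, h2, h1, h0⟩)
    exact (congrArg _ ρ.2.2.1).trans g.2.2

end Omega

/-! ### Definable relations on tuples -/

section Toolkit

variable {M : Type w} {L : FirstOrder.Language.{u, v}} [L.Structure M] {A : Set M} {α β : Type*}

theorem definable_and {p q : (α → M) → Prop} (hp : A.Definable L {v | p v})
    (hq : A.Definable L {v | q v}) : A.Definable L {v | p v ∧ q v} :=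
  hp.inter hq

theorem definable_exists [Finite β] {p : (α → M) → (β → M) → Prop}
    (h : A.Definable L {v : α ⊕ β → M | p (v ∘ Sum.inl) (v ∘ Sum.inr)}) :
    A.Definable L {v | ∃ u, p v u} := by
  have := h.exists_of_finite
  simpa using this

theorem definable_congr {p q : (α → M) → Prop} (hp : A.Definable L {v | p v})
    (h : ∀ v, p v ↔ q v) : A.Definable L {v | q v} := by
  have : {v | q v} = {v | p v} := by
    ext v
    exact (h v).symm
  rwa [this]

theorem definable_forall_of_finite {ι : Type*} [Finite ι] {p : ι → (α → M) → Prop}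
    (h : ∀ k, A.Definable L {v | p k v}) : A.Definable L {v | ∀ k, p k v} := by
  have := Set.definable_iInter_of_finite h
  refine definable_congr (p := fun v => v ∈ ⋂ k, {v | p k v}) this fun v => ?_
  simp

theorem definable_eq_point {n : ℕ} {x : Fin n → M} (hx : A.Definable L {x}) (φ : Fin n → α) :
    A.Definable L {v : α → M | v ∘ φ = x} :=
  hx.preimage_comp φ

end Toolkit

namespace DSimp

variable {M : Type w} {S : DSimp M}

/-- The graph, on tuples, of a structure map. -/
def FaceR (S : DSimp M) {i j : Fin 4} (t : Fin ((i : ℕ) + 1) →o Fin ((j : ℕ) + 1))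
    (x : Fin (S.ar j) → M) (y : Fin (S.ar i) → M) : Prop :=
  ∃ g : S.obj j, g.1 = x ∧ (S.d t g).1 = y

/-- The relation `Tet` on tuples. -/
def TetR (S : DSimp M) (p q r s : Fin (S.ar 2) → M) : Prop :=
  ∃ p' q' r' s' : S.obj 2, p'.1 = p ∧ q'.1 = q ∧ r'.1 = r ∧ s'.1 = s ∧ S.Tet p' q' r' s'

/-- The relation `Transport` on tuples. -/
def TransportR (S : DSimp M) (κ₀ τ σ τ' σ' β : Fin (S.ar 2) → M) : Prop :=
  ∃ κ₀' τ₁ σ₁ τ₁' σ₁' β' : S.obj 2, κ₀'.1 = κ₀ ∧ τ₁.1 = τ ∧ σ₁.1 = σ ∧ τ₁'.1 = τ' ∧ σ₁'.1 = σ' ∧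
    β'.1 = β ∧ S.Transport κ₀' τ₁ σ₁ τ₁' σ₁' β'

theorem faceR_iff {i j : Fin 4} {t : Fin ((i : ℕ) + 1) →o Fin ((j : ℕ) + 1)} {x : S.obj j}
    {y : S.obj i} : S.FaceR t x.1 y.1 ↔ S.d t x = y := by
  constructor
  · rintro ⟨g, h1, h2⟩
    obtain rfl := Subtype.ext h1
    exact Subtype.ext h2
  · rintro rfl
    exact ⟨x, rfl, rfl⟩

section Definable

variable {L : FirstOrder.Language.{u, v}} [L.Structure M] {A : Set M} {α : Type*}

theorem DefinableOver.mono (hD : S.DefinableOver L ∅) (A : Set M) : S.DefinableOver L A :=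
  ⟨fun i => (hD.1 i).mono (Set.empty_subset A), fun i j t => (hD.2 i j t).mono (Set.empty_subset A)⟩

variable (hD : S.DefinableOver L A)
include hD

theorem definable_faceR {i j : Fin 4} (t : Fin ((i : ℕ) + 1) →o Fin ((j : ℕ) + 1))
    (φ : Fin (S.ar j) → α) (ψ : Fin (S.ar i) → α) :
    A.Definable L {v : α → M | S.FaceR t (v ∘ φ) (v ∘ ψ)} := by
  refine definable_congr ((hD.2 i j t).preimage_comp (Sum.elim φ ψ)) fun v => ?_
  constructor
  · rintro ⟨g, hg⟩
    refine ⟨g, ?_, ?_⟩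
    · exact (congrArg (· ∘ Sum.inl) hg).symm
    · exact (congrArg (· ∘ Sum.inr) hg).symm
  · rintro ⟨g, h1, h2⟩
    refine ⟨g, ?_⟩
    change v ∘ Sum.elim φ ψ = _
    rw [Sum.comp_elim, h1, h2]

theorem definable_tetR (φ₁ φ₂ φ₃ φ₄ : Fin (S.ar 2) → α) :
    A.Definable L {v : α → M | S.TetR (v ∘ φ₁) (v ∘ φ₂) (v ∘ φ₃) (v ∘ φ₄)} := by
  refine definable_congr (definable_exists (β := Fin (S.ar 3)) (p := fun v Θ =>
    S.FaceR (i := 2) (j := 3) (δ (m := 2) 3) Θ (v ∘ φ₁) ∧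
    S.FaceR (i := 2) (j := 3) (δ (m := 2) 2) Θ (v ∘ φ₂) ∧
    S.FaceR (i := 2) (j := 3) (δ (m := 2) 1) Θ (v ∘ φ₃) ∧
    S.FaceR (i := 2) (j := 3) (δ (m := 2) 0) Θ (v ∘ φ₄)) ?_) fun v => ?_
  · refine definable_and ?_ (definable_and ?_ (definable_and ?_ ?_))
    · exact definable_faceR hD _ Sum.inr (Sum.inl ∘ φ₁)
    · exact definable_faceR hD _ Sum.inr (Sum.inl ∘ φ₂)
    · exact definable_faceR hD _ Sum.inr (Sum.inl ∘ φ₃)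
    · exact definable_faceR hD _ Sum.inr (Sum.inl ∘ φ₄)
  · constructor
    · rintro ⟨_, ⟨Θ, rfl, h3⟩, ⟨Θ', e2, h2⟩, ⟨Θ'', e1, h1⟩, ⟨Θ''', e0, h0⟩⟩
      obtain rfl := Subtype.ext e2
      obtain rfl := Subtype.ext e1
      obtain rfl := Subtype.ext e0
      exact ⟨_, _, _, _, h3, h2, h1, h0, _, rfl, rfl, rfl, rfl⟩
    · rintro ⟨_, _, _, _, h3, h2, h1, h0, Θ, rfl, rfl, rfl, rfl⟩
      exact ⟨Θ.1, ⟨Θ, rfl, h3⟩, ⟨Θ, rfl, h2⟩, ⟨Θ, rfl, h1⟩, ⟨Θ, rfl, h0⟩⟩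

theorem definable_transportR (φ₁ φ₂ φ₃ φ₄ φ₅ φ₆ : Fin (S.ar 2) → α) :
    A.Definable L {v : α → M |
      S.TransportR (v ∘ φ₁) (v ∘ φ₂) (v ∘ φ₃) (v ∘ φ₄) (v ∘ φ₅) (v ∘ φ₆)} := by
  refine definable_congr (definable_exists (β := Fin (S.ar 2)) (p := fun v κ =>
    S.TetR (v ∘ φ₂) (v ∘ φ₄) κ (v ∘ φ₁) ∧ S.TetR (v ∘ φ₃) (v ∘ φ₅) κ (v ∘ φ₆)) ?_) fun v => ?_
  · exact definable_and
      (definable_tetR hD (Sum.inl ∘ φ₂) (Sum.inl ∘ φ₄) Sum.inr (Sum.inl ∘ φ₁))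
      (definable_tetR hD (Sum.inl ∘ φ₃) (Sum.inl ∘ φ₅) Sum.inr (Sum.inl ∘ φ₆))
  · constructor
    · rintro ⟨_, ⟨τ, τ', κ, κ₀, h1, h2, rfl, h3, h4⟩, ⟨σ, σ', κ', β, h5, h6, e, h7, h8⟩⟩
      obtain rfl := Subtype.ext e
      exact ⟨κ₀, τ, σ, τ', σ', β, h3, h1, h5, h2, h6, h7, κ', h4, h8⟩
    · rintro ⟨κ₀, τ, σ, τ', σ', β, h3, h1, h5, h2, h6, h7, κ, h4, h8⟩
      exact ⟨κ.1, ⟨_, _, _, _, h1, h2, rfl, h3, h4⟩, ⟨_, _, _, _, h5, h6, rfl, h7, h8⟩⟩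

end Definable

end DSimp

namespace DMap

variable {M : Type w} {S : DSimp M} {I : Type}

/-- The part of a tuple of the shape of a map `D^I → S` that gives the value at a simplex. -/
def sub {k : Fin 4} (c : Fin ((k : ℕ) + 1) → I) (m : Fin (S.ar k)) : Var I S := ⟨k, c, m⟩

/-- The tuples that code maps are described by finitely many conditions, one for each structure map
and each simplex of `D^I`. -/
theorem exists_code_iff (z : Var I S → M) :
    (∃ f : DMap I S, f.code = z) ↔
      ∀ (i j : Fin 4) (t : Fin ((i : ℕ) + 1) →o Fin ((j : ℕ) + 1)) (c : Fin ((j : ℕ) + 1) → I),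
        S.FaceR t (z ∘ sub c) (z ∘ sub (c ∘ t)) := by
  constructor
  · rintro ⟨f, rfl⟩ i j t c
    exact ⟨f.toFun j c, rfl, congrArg Subtype.val (f.natural i j t c)⟩
  · intro h
    have hm : ∀ (k : Fin 4) (c : Fin ((k : ℕ) + 1) → I), z ∘ sub c ∈ S.obj k := fun k c => by
      obtain ⟨g, h1, -⟩ := h k k OrderHom.id c
      rw [← h1]
      exact g.2
    refine ⟨⟨fun k c => ⟨z ∘ sub c, hm k c⟩, fun i j t c => ?_⟩, rfl⟩
    obtain ⟨g, h1, h2⟩ := h i j t c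
    obtain rfl : g = ⟨z ∘ sub c, hm j c⟩ := Subtype.ext h1
    exact Subtype.ext h2

variable {L : FirstOrder.Language.{u, v}} [L.Structure M] {A : Set M} {α : Type*}

theorem definable_code [Finite I] (hD : S.DefinableOver L A) (φ : Var I S → α) :
    A.Definable L {v : α → M | ∃ f : DMap I S, f.code = v ∘ φ} := by
  have hfin : ∀ i j : Fin 4, Finite (Fin ((i : ℕ) + 1) →o Fin ((j : ℕ) + 1)) := fun i j =>
    Finite.of_injective _ DFunLike.coe_injective
  refine definable_congr (definable_forall_of_finite fun i => definable_forall_of_finite fun j =>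
    definable_forall_of_finite fun t => definable_forall_of_finite fun c =>
      DSimp.definable_faceR hD (i := i) (j := j) t (φ ∘ sub c) (φ ∘ sub (c ∘ t)))
    fun v => (exists_code_iff (v ∘ φ)).symm

end DMap

namespace DSimp.Coding

variable {M : Type w} {S : DSimp M} {r s t : S.obj 1}

/-- The graph of the coding, on tuples. -/
def CodeR (C : S.Coding t) (x y : Fin (S.ar 2) → M) (c : Fin C.n → M) : Prop :=
  ∃ τ σ, S.IsSquare t τ σ ∧ τ.1 = x ∧ σ.1 = y ∧ C.code τ σ = c

/-- The coding is definable over `A`. -/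
def IsDefinable (L : FirstOrder.Language.{u, v}) [L.Structure M] (A : Set M) (C : S.Coding t) :
    Prop :=
  A.Definable L {z : Fin (S.ar 2) ⊕ Fin (S.ar 2) ⊕ Fin C.n → M |
    C.CodeR (z ∘ Sum.inl) (z ∘ Sum.inr ∘ Sum.inl) (z ∘ Sum.inr ∘ Sum.inr)}

/-- Membership in `arrows`, on tuples. -/
def ArrowsR (C : S.Coding t) (e g h : Fin (S.ar 1) → M) (c : Fin C.n → M) : Prop :=
  ∃ e' g' h' : S.obj 1, e'.1 = e ∧ g'.1 = g ∧ h'.1 = h ∧ c ∈ C.arrows e' g' h'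

/-- The relation `Pre` on tuples. -/
def PreR (C : S.Coding t) (κ α : Fin (S.ar 2) → M) (c c' : Fin C.n → M) : Prop :=
  ∃ κ' α' : S.obj 2, κ'.1 = κ ∧ α'.1 = α ∧ C.Pre κ' α' c c'

/-- The relation `Post` on tuples. -/
def PostR (C : S.Coding t) (κ β : Fin (S.ar 2) → M) (c c' : Fin C.n → M) : Prop :=
  ∃ κ' β' : S.obj 2, κ'.1 = κ ∧ β'.1 = β ∧ C.Post κ' β' c c'

/-- The relation `MulRel` on tuples. -/
def MulR (A : S.Coding r) (B : S.Coding s) (C : S.Coding t) (α : S.obj 2)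
    (κ : Fin (S.ar 2) → M) (c : Fin A.n → M) (c' : Fin B.n → M) (d : Fin C.n → M) : Prop :=
  ∃ κ' : S.obj 2, κ'.1 = κ ∧ MulRel A B C α κ' c c' d

section Definable

variable {L : FirstOrder.Language.{u, v}} [L.Structure M] {P : Set M} {α : Type*}

theorem IsDefinable.codeR {C : S.Coding t} (hC : C.IsDefinable L P) (φ ψ : Fin (S.ar 2) → α)
    (χ : Fin C.n → α) : P.Definable L {v : α → M | C.CodeR (v ∘ φ) (v ∘ ψ) (v ∘ χ)} :=
  Set.Definable.preimage_comp (Sum.elim φ (Sum.elim ψ χ)) hC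

variable (hD : S.DefinableOver L P)
include hD

theorem IsDefinable.arrowsR {C : S.Coding t} (hC : C.IsDefinable L P)
    (φ₁ φ₂ φ₃ : Fin (S.ar 1) → α) (χ : Fin C.n → α) :
    P.Definable L {v : α → M | C.ArrowsR (v ∘ φ₁) (v ∘ φ₂) (v ∘ φ₃) (v ∘ χ)} := by
  refine definable_congr (definable_exists (β := Fin (S.ar 2)) (p := fun v x =>
    ∃ y, C.CodeR x y (v ∘ χ) ∧
      S.FaceR (i := 1) (j := 2) (δ (m := 1) 0) x (v ∘ φ₁) ∧
      S.FaceR (i := 1) (j := 2) (δ (m := 1) 2) x (v ∘ φ₂) ∧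
      S.FaceR (i := 1) (j := 2) (δ (m := 1) 0) y (v ∘ φ₃))
    (definable_exists (definable_and (hC.codeR (Sum.inl ∘ Sum.inr) Sum.inr (Sum.inl ∘ Sum.inl ∘ χ))
      (definable_and (definable_faceR hD _ (Sum.inl ∘ Sum.inr) (Sum.inl ∘ Sum.inl ∘ φ₁))
      (definable_and (definable_faceR hD _ (Sum.inl ∘ Sum.inr) (Sum.inl ∘ Sum.inl ∘ φ₂))
        (definable_faceR hD _ Sum.inr (Sum.inl ∘ Sum.inl ∘ φ₃))))))) fun v => ?_
  constructor
  · rintro ⟨_, _, ⟨τ, σ, hx, rfl, rfl, hc⟩, ⟨τ', e1, h1⟩, ⟨τ'', e2, h2⟩, ⟨σ', e3, h3⟩⟩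
    obtain rfl := Subtype.ext e1
    obtain rfl := Subtype.ext e2
    obtain rfl := Subtype.ext e3
    exact ⟨_, _, _, h1, h2, h3, τ'', σ', hx, rfl, rfl, rfl, hc⟩
  · rintro ⟨_, _, _, h1, h2, h3, τ, σ, hx, rfl, rfl, rfl, hc⟩
    exact ⟨_, _, ⟨τ, σ, hx, rfl, rfl, hc⟩, ⟨τ, rfl, h1⟩, ⟨τ, rfl, h2⟩, ⟨σ, rfl, h3⟩⟩

theorem IsDefinable.preR (hS : S.IsTwoGroupoid) {C : S.Coding t} (hC : C.IsDefinable L P)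
    (φ₁ φ₂ : Fin (S.ar 2) → α) (χ₁ χ₂ : Fin C.n → α) :
    P.Definable L {v : α → M | C.PreR (v ∘ φ₁) (v ∘ φ₂) (v ∘ χ₁) (v ∘ χ₂)} := by
  refine definable_congr (definable_exists (β := Fin (S.ar 2)) (p := fun v x =>
    ∃ y, ∃ x', C.CodeR x y (v ∘ χ₁) ∧ C.CodeR x' y (v ∘ χ₂) ∧
      S.TetR (v ∘ φ₂) x' x (v ∘ φ₁))
    (definable_exists (definable_exists (definable_and
      (hC.codeR (Sum.inl ∘ Sum.inl ∘ Sum.inr) (Sum.inl ∘ Sum.inr)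
        (Sum.inl ∘ Sum.inl ∘ Sum.inl ∘ χ₁))
      (definable_and (hC.codeR Sum.inr (Sum.inl ∘ Sum.inr) (Sum.inl ∘ Sum.inl ∘ Sum.inl ∘ χ₂))
        (definable_tetR hD (Sum.inl ∘ Sum.inl ∘ Sum.inl ∘ φ₂) Sum.inr (Sum.inl ∘ Sum.inl ∘ Sum.inr)
          (Sum.inl ∘ Sum.inl ∘ Sum.inl ∘ φ₁))))))) fun v => ?_
  constructor
  · rintro ⟨_, _, _, ⟨τ, σ, hx, rfl, rfl, hc⟩, ⟨τ', σ', hx', rfl, e1, hc'⟩,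
      ⟨a, τ₁, τ₂, κ, h1, e2, e3, h2, hT⟩⟩
    obtain rfl := Subtype.ext e1
    obtain rfl := Subtype.ext e2
    obtain rfl := Subtype.ext e3
    exact ⟨κ, a, h2, h1, τ₂, σ', τ₁, hx, hT, hc, hc'⟩
  · rintro ⟨κ, a, h2, h1, τ, σ, τ', hx, hT, hc, hc'⟩
    exact ⟨_, _, _, ⟨τ, σ, hx, rfl, rfl, hc⟩, ⟨τ', σ, isSquare_pre hS hx hT, rfl, rfl, hc'⟩,
      a, τ', τ, κ, h1, rfl, rfl, h2, hT⟩

theorem IsDefinable.postR (hS : S.IsTwoGroupoid) {C : S.Coding t} (hC : C.IsDefinable L P)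
    (φ₁ φ₂ : Fin (S.ar 2) → α) (χ₁ χ₂ : Fin C.n → α) :
    P.Definable L {v : α → M | C.PostR (v ∘ φ₁) (v ∘ φ₂) (v ∘ χ₁) (v ∘ χ₂)} := by
  refine definable_congr (definable_exists (β := Fin (S.ar 2)) (p := fun v x =>
    ∃ y, ∃ x', ∃ y', C.CodeR x y (v ∘ χ₁) ∧ C.CodeR x' y' (v ∘ χ₂) ∧
      S.TransportR (v ∘ φ₁) x y x' y' (v ∘ φ₂))
    (definable_exists (definable_exists (definable_exists (definable_and
      (hC.codeR (Sum.inl ∘ Sum.inl ∘ Sum.inl ∘ Sum.inr) (Sum.inl ∘ Sum.inl ∘ Sum.inr)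
        (Sum.inl ∘ Sum.inl ∘ Sum.inl ∘ Sum.inl ∘ χ₁))
      (definable_and (hC.codeR (Sum.inl ∘ Sum.inr) Sum.inr
          (Sum.inl ∘ Sum.inl ∘ Sum.inl ∘ Sum.inl ∘ χ₂))
        (definable_transportR hD (Sum.inl ∘ Sum.inl ∘ Sum.inl ∘ Sum.inl ∘ φ₁)
          (Sum.inl ∘ Sum.inl ∘ Sum.inl ∘ Sum.inr) (Sum.inl ∘ Sum.inl ∘ Sum.inr)
          (Sum.inl ∘ Sum.inr) Sum.inr
          (Sum.inl ∘ Sum.inl ∘ Sum.inl ∘ Sum.inl ∘ φ₂)))))))) fun v => ?_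
  constructor
  · rintro ⟨_, _, _, _, ⟨τ, σ, hx, rfl, rfl, hc⟩, ⟨τ', σ', hx', rfl, rfl, hc'⟩,
      ⟨κ, τ₁, σ₁, τ₁', σ₁', b, h1, e1, e2, e3, e4, h2, hT⟩⟩
    obtain rfl := Subtype.ext e1
    obtain rfl := Subtype.ext e2
    obtain rfl := Subtype.ext e3
    obtain rfl := Subtype.ext e4
    exact ⟨κ, b, h1, h2, τ₁, σ₁, τ₁', σ₁', hx, hT, hc, hc'⟩
  · rintro ⟨κ, b, h1, h2, τ, σ, τ', σ', hx, hT, hc, hc'⟩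
    exact ⟨_, _, _, _, ⟨τ, σ, hx, rfl, rfl, hc⟩, ⟨τ', σ', hT.isSquare hS hx, rfl, rfl, hc'⟩,
      κ, τ, σ, τ', σ', b, h1, rfl, rfl, rfl, rfl, h2, hT⟩

theorem IsDefinable.mulR (hS : S.IsTwoGroupoid) {A : S.Coding r} {B : S.Coding s} {C : S.Coding t}
    (hA : A.IsDefinable L P) (hB : B.IsDefinable L P) (hC : C.IsDefinable L P)
    {a : S.obj 2} (ha : S.f2 1 a = t) (hp : S.IsPoint L P a)
    (φ : Fin (S.ar 2) → α) (χ₁ : Fin A.n → α) (χ₂ : Fin B.n → α) (χ₃ : Fin C.n → α) :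
    P.Definable L {v : α → M | MulR A B C a (v ∘ φ) (v ∘ χ₁) (v ∘ χ₂) (v ∘ χ₃)} := by
  -- the eight bound tuples stand for `a`, `τ`, `σ`, `τ₂`, `σ₂`, `τ'`, `σ'`, `ζ`, in this order
  let bd : Fin 8 → Fin (S.ar 2) → α ⊕ (Fin 8 × Fin (S.ar 2)) := fun k m => Sum.inr (k, m)
  let pj : Fin 8 → (Fin 8 × Fin (S.ar 2) → M) → Fin (S.ar 2) → M := fun k u m => u (k, m)
  refine definable_congr (definable_exists (β := Fin 8 × Fin (S.ar 2)) (p := fun v u =>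
    pj 0 u = a.1 ∧ A.CodeR (pj 1 u) (pj 2 u) (v ∘ χ₁) ∧ B.CodeR (pj 3 u) (pj 4 u) (v ∘ χ₂) ∧
      C.CodeR (pj 5 u) (pj 7 u) (v ∘ χ₃) ∧
      S.TransportR (v ∘ φ) (pj 1 u) (pj 2 u) (pj 5 u) (pj 6 u) (pj 3 u) ∧
      S.TetR (pj 0 u) (pj 6 u) (pj 7 u) (pj 4 u))
    (definable_and (definable_eq_point hp (bd 0))
    (definable_and (hA.codeR (bd 1) (bd 2) (Sum.inl ∘ χ₁))
    (definable_and (hB.codeR (bd 3) (bd 4) (Sum.inl ∘ χ₂))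
    (definable_and (hC.codeR (bd 5) (bd 7) (Sum.inl ∘ χ₃))
    (definable_and (definable_transportR hD (Sum.inl ∘ φ) (bd 1) (bd 2) (bd 5) (bd 6) (bd 3))
      (definable_tetR hD (bd 0) (bd 6) (bd 7) (bd 4)))))))) fun v => ?_
  constructor
  · rintro ⟨u, h0, ⟨τ, σ, hx, q1, q2, hc⟩, ⟨τ₂, σ₂, hy, q3, q4, hc'⟩, ⟨τ', ζ, hz, q5, q7, hd⟩,
      ⟨κ, τ₁, σ₁, τ₁', σ₁', β, h1, e1, e2, e3, e4, e5, hT⟩,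
      ⟨a', σ₃, ζ', σ₄, e6, e7, e8, e9, hQ⟩⟩
    obtain rfl := Subtype.ext (e1.trans q1.symm)
    obtain rfl := Subtype.ext (e2.trans q2.symm)
    obtain rfl := Subtype.ext (e3.trans q5.symm)
    obtain rfl := Subtype.ext (e5.trans q3.symm)
    obtain rfl := Subtype.ext (e6.trans h0)
    obtain rfl := Subtype.ext (e7.trans e4.symm)
    obtain rfl := Subtype.ext (e8.trans q7.symm)
    obtain rfl := Subtype.ext (e9.trans q4.symm)
    exact ⟨κ, h1, _, _, _, _, _, _, _, hx, hy, hT, hQ, hc, hc', hd⟩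
  · rintro ⟨κ, h1, τ, σ, τ₂, σ₂, τ', σ', ζ, hx, hy, hT, hQ, hc, hc', hd⟩
    let w : Fin 8 → S.obj 2 := ![a, τ, σ, τ₂, σ₂, τ', σ', ζ]
    exact ⟨fun z => (w z.1).1 z.2, rfl, ⟨τ, σ, hx, rfl, rfl, hc⟩, ⟨τ₂, σ₂, hy, rfl, rfl, hc'⟩,
      ⟨τ', ζ, isSquare_mul hS ha (hT.isSquare hS hx) hQ, rfl, rfl, hd⟩,
      ⟨κ, τ, σ, τ', σ', τ₂, h1, rfl, rfl, rfl, rfl, rfl, hT⟩, a, σ', ζ, σ₂, rfl, rfl, rfl, rfl, hQ⟩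

end Definable

theorem pre_eq_iff (hS : S.IsTwoGroupoid) {C : S.Coding t} {κ α : S.obj 2} {c c' : Fin C.n → M}
    (hc : ∃ d, C.Pre κ α c d) : C.pre κ α c = c' ↔ C.Pre κ α c c' := by
  obtain ⟨d, τ, σ, τ', hx, hT, rfl, rfl⟩ := hc
  rw [C.pre_code hS hx hT]
  constructor
  · rintro rfl
    exact ⟨τ, σ, τ', hx, hT, rfl, rfl⟩
  · rintro ⟨τ₁, σ₁, τ₁', hx₁, hT₁, e1, rfl⟩
    rw [← C.pre_code hS hx hT, ← e1, C.pre_code hS hx₁ hT₁]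

theorem post_eq_iff (hS : S.IsTwoGroupoid) {C : S.Coding t} {κ β : S.obj 2} {c c' : Fin C.n → M}
    (hc : ∃ d, C.Post κ β c d) : C.post κ β c = c' ↔ C.Post κ β c c' := by
  obtain ⟨d, τ, σ, τ', σ', hx, hT, rfl, rfl⟩ := hc
  rw [C.post_code hS hx hT]
  constructor
  · rintro rfl
    exact ⟨τ, σ, τ', σ', hx, hT, rfl, rfl⟩
  · rintro ⟨τ₁, σ₁, τ₁', σ₁', hx₁, hT₁, e1, rfl⟩
    rw [← C.post_code hS hx hT, ← e1, C.post_code hS hx₁ hT₁]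

end DSimp.Coding

/-! ### Existence of codings -/

section Quotients

variable {M : Type w} {L : FirstOrder.Language.{u, v}}

/-- A definable relation need not be an equivalence relation in all models of `T`, but having the
same fibre under it is one in every structure. So elimination of imaginaries yields a definable
map that separates exactly the elements with different fibres. -/
theorem EliminatesImaginaries.exists_code {T : L.Theory}
    (hT : EliminatesImaginaries.{u, v, w} T) [L.Structure M] [Nonempty M] [M ⊨ T]
    {β : Type} [Finite β] {R : (β → M) → (β → M) → Prop}
    (hR : (∅ : Set M).Definable L {z : β ⊕ β → M | R (z ∘ Sum.inl) (z ∘ Sum.inr)}) :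
    ∃ (m : ℕ) (c : (β → M) → Fin m → M),
      (∅ : Set M).Definable L {z : β ⊕ Fin m → M | c (z ∘ Sum.inl) = z ∘ Sum.inr} ∧
      ∀ x y, c x = c y ↔ ∀ z, R x z ↔ R y z := by
  obtain ⟨N, ⟨e⟩⟩ := Finite.exists_equiv_fin β
  obtain ⟨φ, hφ⟩ := Set.empty_definable_iff.1 hR
  have hφ' : ∀ x y, R x y ↔ φ.Realize (Sum.elim x y) := fun x y =>
    Set.ext_iff.1 hφ (Sum.elim x y)
  let E : L.Formula (Fin N ⊕ Fin N) :=
    ((φ.relabel (Sum.elim (Sum.inl ∘ Sum.inl ∘ e) Sum.inr)).iff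
      (φ.relabel (Sum.elim (Sum.inl ∘ Sum.inr ∘ e) Sum.inr)) :
        L.Formula ((Fin N ⊕ Fin N) ⊕ β)).iAlls β
  have hE : ∀ (M' : Type w) [L.Structure M'] (x y : Fin N → M'), E.Realize (Sum.elim x y) ↔
      ∀ z, φ.Realize (Sum.elim (x ∘ e) z) ↔ φ.Realize (Sum.elim (y ∘ e) z) := by
    intro M' _ x y
    simp only [E, FirstOrder.Language.Formula.realize_iAlls, FirstOrder.Language.Formula.realize_iff,
      FirstOrder.Language.Formula.realize_relabel, Sum.comp_elim, ← Function.comp_assoc]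
    rfl
  obtain ⟨m, ψ, h⟩ := hT N E fun M' _ _ _ => by
    refine ⟨fun x => ?_, fun {x y} h => ?_, fun {x y z} h h' => ?_⟩
    · exact (hE M' x x).2 fun z => Iff.rfl
    · exact (hE M' y x).2 fun z => ((hE M' x y).1 h z).symm
    · exact (hE M' x z).2 fun w => ((hE M' x y).1 h w).trans ((hE M' y z).1 h' w)
  obtain ⟨c, hc, hc'⟩ := h M
  refine ⟨m, fun x => c (x ∘ e.symm), ?_, fun x y => ?_⟩
  · refine Set.empty_definable_iff.2 ⟨ψ.relabel (Sum.elim (Sum.inl ∘ e.symm) Sum.inr), ?_⟩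
    ext z
    have := hc (z ∘ Sum.inl ∘ e.symm) (z ∘ Sum.inr)
    simp only [Set.mem_ofPred_eq, FirstOrder.Language.Formula.realize_relabel, Sum.comp_elim]
    exact this.symm
  · rw [← hc', hE]
    have he : ∀ x : β → M, (x ∘ e.symm) ∘ e = x := fun x => by
      funext b
      simp
    simp only [he, ← hφ']

end Quotients

namespace DSimp

variable {M : Type w} {S : DSimp M} {L : FirstOrder.Language.{u, v}} [L.Structure M]

/-- The codes of squares given by elimination of imaginaries, at once for all edges. -/
theorem exists_coding {T : L.Theory} (hT : EliminatesImaginaries.{u, v, w} T) [Nonempty M] [M ⊨ T]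
    (hS : S.IsTwoGroupoid) (hD : S.DefinableOver L ∅) (t : S.obj 1) :
    ∃ C : S.Coding t, ∀ A : Set M, S.IsPoint L A t → C.IsDefinable L A := by
  let β := Fin (S.ar 2) ⊕ Fin (S.ar 2)
  let R : (β → M) → (β → M) → Prop := fun x y => ∃ τ σ τ' σ' : S.obj 2,
    τ.1 = x ∘ Sum.inl ∧ σ.1 = x ∘ Sum.inr ∧ τ'.1 = y ∘ Sum.inl ∧ σ'.1 = y ∘ Sum.inr ∧
      S.f2 1 σ = S.f2 1 τ ∧ S.SameClass τ σ τ' σ'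
  have hR : (∅ : Set M).Definable L {z : β ⊕ β → M | R (z ∘ Sum.inl) (z ∘ Sum.inr)} := by
    let p₁ : Fin (S.ar 2) → β ⊕ β := Sum.inl ∘ Sum.inl
    let p₂ : Fin (S.ar 2) → β ⊕ β := Sum.inl ∘ Sum.inr
    let p₃ : Fin (S.ar 2) → β ⊕ β := Sum.inr ∘ Sum.inl
    let p₄ : Fin (S.ar 2) → β ⊕ β := Sum.inr ∘ Sum.inr
    let γ := Fin 3 × Fin (S.ar 1) ⊕ Fin 2 × Fin (S.ar 2)
    let b1 : Fin 3 → Fin (S.ar 1) → (β ⊕ β) ⊕ γ := fun k m => Sum.inr (Sum.inl (k, m))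
    let b2 : Fin 2 → Fin (S.ar 2) → (β ⊕ β) ⊕ γ := fun k m => Sum.inr (Sum.inr (k, m))
    let q1 : Fin 3 → (γ → M) → Fin (S.ar 1) → M := fun k u m => u (Sum.inl (k, m))
    let q2 : Fin 2 → (γ → M) → Fin (S.ar 2) → M := fun k u m => u (Sum.inr (k, m))
    refine definable_congr (definable_exists (β := γ) (p := fun v u =>
      S.FaceR (i := 1) (j := 2) (δ (m := 1) 1) (v ∘ p₁) (q1 0 u) ∧
      S.FaceR (i := 1) (j := 2) (δ (m := 1) 1) (v ∘ p₂) (q1 0 u) ∧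
      S.FaceR (i := 1) (j := 2) (δ (m := 1) 0) (v ∘ p₁) (q1 1 u) ∧
      S.FaceR (i := 1) (j := 2) (δ (m := 1) 0) (v ∘ p₂) (q1 2 u) ∧
      S.FaceR (i := 2) (j := 1) (ς (m := 1) 1) (q1 1 u) (q2 0 u) ∧
      S.FaceR (i := 2) (j := 1) (ς (m := 1) 1) (q1 2 u) (q2 1 u) ∧
      S.TransportR (q2 0 u) (v ∘ p₁) (v ∘ p₂) (v ∘ p₃) (v ∘ p₄) (q2 1 u))
      (definable_and (definable_faceR hD _ (Sum.inl ∘ p₁) (b1 0))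
      (definable_and (definable_faceR hD _ (Sum.inl ∘ p₂) (b1 0))
      (definable_and (definable_faceR hD _ (Sum.inl ∘ p₁) (b1 1))
      (definable_and (definable_faceR hD _ (Sum.inl ∘ p₂) (b1 2))
      (definable_and (definable_faceR hD _ (b1 1) (b2 0))
      (definable_and (definable_faceR hD _ (b1 2) (b2 1))
        (definable_transportR hD (b2 0) (Sum.inl ∘ p₁) (Sum.inl ∘ p₂) (Sum.inl ∘ p₃)
          (Sum.inl ∘ p₄) (b2 1))))))))) fun v => ?_
    constructor
    · rintro ⟨u, ⟨τ, e1, f1⟩, ⟨σ, e2, f2⟩, ⟨τ', e3, f3⟩, ⟨σ', e4, f4⟩, ⟨x, e5, f5⟩, ⟨y, e6, f6⟩,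
        κ, τ₁, σ₁, τ₁', σ₁', β', a1, a2, a3, a4, a5, a6, hT⟩
      obtain rfl := Subtype.ext (e1.trans a2.symm)
      obtain rfl := Subtype.ext (e2.trans a3.symm)
      obtain rfl := Subtype.ext (e3.trans a2.symm)
      obtain rfl := Subtype.ext (e4.trans a3.symm)
      obtain rfl := Subtype.ext (e5.trans f3.symm)
      obtain rfl := Subtype.ext (e6.trans f4.symm)
      obtain rfl := Subtype.ext (f5.trans a1.symm)
      obtain rfl := Subtype.ext (f6.trans a6.symm)
      exact ⟨_, _, _, _, a2, a3, a4, a5, Subtype.ext (f2.trans f1.symm), hT⟩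
    · rintro ⟨τ, σ, τ', σ', a2, a3, a4, a5, he, hT⟩
      let w1 : Fin 3 → S.obj 1 := ![S.f2 1 τ, S.f2 0 τ, S.f2 0 σ]
      let w2 : Fin 2 → S.obj 2 := ![S.s1 1 (S.f2 0 τ), S.s1 1 (S.f2 0 σ)]
      exact ⟨Sum.elim (fun z => (w1 z.1).1 z.2) (fun z => (w2 z.1).1 z.2), ⟨τ, a2, rfl⟩,
        ⟨σ, a3, congrArg Subtype.val he⟩, ⟨τ, a2, rfl⟩, ⟨σ, a3, rfl⟩, ⟨_, rfl, rfl⟩, ⟨_, rfl, rfl⟩,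
        _, τ, σ, τ', σ', _, rfl, a2, a3, a4, a5, rfl, hT⟩
  obtain ⟨m, c, hc, hc'⟩ := hT.exists_code hR
  have hR' : ∀ {τ σ τ' σ' : S.obj 2}, S.IsSquare t τ σ →
      (R (Sum.elim τ.1 σ.1) (Sum.elim τ'.1 σ'.1) ↔ S.SameClass τ σ τ' σ') := by
    intro τ σ τ' σ' hx
    constructor
    · rintro ⟨τ₁, σ₁, τ₁', σ₁', e1, e2, e3, e4, -, h⟩
      obtain rfl := Subtype.ext e1
      obtain rfl := Subtype.ext e2
      obtain rfl := Subtype.ext e3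
      obtain rfl := Subtype.ext e4
      exact h
    · exact fun h => ⟨τ, σ, τ', σ', rfl, rfl, rfl, rfl, hx.2, h⟩
  let C : S.Coding t :=
    { n := m
      code := fun τ σ => c (Sum.elim τ.1 σ.1)
      code_eq_iff := by
        intro τ σ τ' σ' hx hy
        rw [hc']
        constructor
        · exact fun h => (hR' hx).1 ((h _).2 ((hR' hy).2 (SameClass.refl hS hy)))
        · intro h z
          constructor
          · rintro ⟨τ₁, σ₁, τ₁', σ₁', e1, e2, e3, e4, -, h'⟩
            obtain rfl := Subtype.ext e1
            obtain rfl := Subtype.ext e2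
            exact ⟨τ', σ', τ₁', σ₁', rfl, rfl, e3, e4, hy.2,
              (h.symm hS hx).trans hS hy h'⟩
          · rintro ⟨τ₁, σ₁, τ₁', σ₁', e1, e2, e3, e4, -, h'⟩
            obtain rfl := Subtype.ext e1
            obtain rfl := Subtype.ext e2
            exact ⟨τ, σ, τ₁', σ₁', rfl, rfl, e3, e4, hx.2, h.trans hS hx h'⟩ }
  refine ⟨C, fun A hA => ?_⟩
  have hDA := hD.mono A
  let α := Fin (S.ar 2) ⊕ Fin (S.ar 2) ⊕ Fin m
  let p₁ : Fin (S.ar 2) → α := Sum.inl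
  let p₂ : Fin (S.ar 2) → α := Sum.inr ∘ Sum.inl
  let p₃ : Fin m → α := Sum.inr ∘ Sum.inr
  let γ := Fin 2 × Fin (S.ar 1)
  let b : Fin 2 → Fin (S.ar 1) → α ⊕ γ := fun k m => Sum.inr (k, m)
  let q : Fin 2 → (γ → M) → Fin (S.ar 1) → M := fun k u m => u (k, m)
  have hc₀ : A.Definable L {v : α ⊕ γ → M |
      c (Sum.elim (v ∘ Sum.inl ∘ p₁) (v ∘ Sum.inl ∘ p₂)) = v ∘ Sum.inl ∘ p₃} := by
    refine definable_congr ((hc.mono (Set.empty_subset A)).preimage_comp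
      (Sum.elim (Sum.elim (Sum.inl ∘ p₁) (Sum.inl ∘ p₂)) (Sum.inl ∘ p₃))) fun v => ?_
    have : v ∘ Sum.elim (Sum.inl ∘ p₁) (Sum.inl ∘ p₂) =
        Sum.elim (v ∘ Sum.inl ∘ p₁) (v ∘ Sum.inl ∘ p₂) := Sum.comp_elim _ _ _
    rw [← this]
    rfl
  refine definable_congr (definable_exists (β := γ) (p := fun v u => q 0 u = t.1 ∧
    S.FaceR (i := 1) (j := 2) (δ (m := 1) 2) (v ∘ p₂) (q 0 u) ∧
    S.FaceR (i := 1) (j := 2) (δ (m := 1) 1) (v ∘ p₁) (q 1 u) ∧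
    S.FaceR (i := 1) (j := 2) (δ (m := 1) 1) (v ∘ p₂) (q 1 u) ∧
    c (Sum.elim (v ∘ p₁) (v ∘ p₂)) = v ∘ p₃)
    (definable_and (definable_eq_point hA (b 0))
    (definable_and (definable_faceR hDA _ (Sum.inl ∘ p₂) (b 0))
    (definable_and (definable_faceR hDA _ (Sum.inl ∘ p₁) (b 1))
    (definable_and (definable_faceR hDA _ (Sum.inl ∘ p₂) (b 1)) hc₀))))) fun v => ?_
  constructor
  · rintro ⟨u, h0, ⟨σ, e1, h1⟩, ⟨τ, e2, h2⟩, ⟨σ', e3, h3⟩, h4⟩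
    obtain rfl := Subtype.ext (e3.trans e1.symm)
    refine ⟨τ, σ', ⟨Subtype.ext (h1.trans h0), Subtype.ext (h3.trans h2.symm)⟩, e2, e3, ?_⟩
    change c (Sum.elim τ.1 σ'.1) = _
    rw [e2, e3]
    exact h4
  · rintro ⟨τ, σ, ⟨h1, h2⟩, e1, e2, h3⟩
    let w : Fin 2 → S.obj 1 := ![t, S.f2 1 τ]
    refine ⟨fun z => (w z.1).1 z.2, rfl, ⟨σ, e2, congrArg Subtype.val h1⟩, ⟨τ, e1, rfl⟩,
      ⟨σ, e2, congrArg Subtype.val h2⟩, ?_⟩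
    change c (Sum.elim τ.1 σ.1) = _ at h3
    rw [e1, e2] at h3
    exact h3

open Classical in
/-- For a degenerate edge, squares are coded by the triangles they amount to. -/
theorem exists_unit_coding (hS : S.IsTwoGroupoid) (hD : S.DefinableOver L ∅) (a : S.obj 0) :
    ∃ C : S.Coding (S.s0 a), C.IsUnit ∧
      ∀ A : Set M, S.IsPoint L A (S.s0 a) → C.IsDefinable L A := by
  have hex : ∀ {τ σ : S.obj 2}, S.IsSquare (S.s0 a) τ σ →
      ∃ ρ, S.Tet (S.s1 0 (S.f2 2 τ)) σ τ ρ := by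
    intro τ σ hx
    refine Tet.exists_123 hS ?_ (f2_s1_0_1 hS.1 _) hx.2
    rw [f2_s1_0_2 hS.1, origin_eq hS.1, ← hx.2, ← origin_eq hS.1, hx.1, f1_s0 hS.1]
  let code : S.obj 2 → S.obj 2 → S.obj 2 := fun τ σ =>
    if h : ∃ ρ, S.Tet (S.s1 0 (S.f2 2 τ)) σ τ ρ then h.choose else τ
  have hcode : ∀ {τ σ ρ : S.obj 2}, S.Tet (S.s1 0 (S.f2 2 τ)) σ τ ρ → code τ σ = ρ := by
    intro τ σ ρ h
    have h' : ∃ ρ, S.Tet (S.s1 0 (S.f2 2 τ)) σ τ ρ := ⟨ρ, h⟩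
    simp only [code, dif_pos h']
    exact h'.choose_spec.unique_123 hS h
  let C : S.Coding (S.s0 a) :=
    { n := S.ar 2
      code := fun τ σ => (code τ σ).1
      code_eq_iff := by
        intro τ σ τ' σ' hx hy
        obtain ⟨ρ, h⟩ := hex hx
        obtain ⟨ρ', h'⟩ := hex hy
        rw [hcode h, hcode h']
        constructor
        · intro e
          obtain rfl := Subtype.ext e
          have e1 : S.f2 2 τ = S.f2 2 τ' := by
            rw [← f2_s1_0_0 hS.1 (S.f2 2 τ), h.e12 hS.1, ← h'.e12 hS.1, f2_s1_0_0 hS.1]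
          have e2 : S.f2 0 τ' = S.f2 0 τ := (h'.e23 hS.1).trans (h.e23 hS.1).symm
          obtain ⟨κ, hκ⟩ := Tet.exists_023 hS (p := τ) (q := τ') (s := S.s1 1 (S.f2 0 τ)) e1
            (f2_s1_1_2 hS.1 _).symm (by rw [f2_s1_1_1 hS.1, e2])
          refine ⟨κ, hκ, ?_⟩
          have h1 := tet_s2 hS.1 ρ
          rw [← h.e13 hS.1, ← h.e23 hS.1] at h1
          rw [← e1] at h'
          exact tet_0134 hS h h' hκ h1
        · rintro ⟨κ, h1, h2⟩
          have h3 := tet_s2 hS.1 ρ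
          rw [← h.e13 hS.1, ← h.e23 hS.1] at h3
          have h4 := tet_0124 hS h h2 h1 h3
          rw [h1.e01 hS.1] at h4
          rw [h4.unique_123 hS h'] }
  refine ⟨C, ⟨rfl, ?_⟩, fun A hA => ?_⟩
  · rintro d ρ ⟨τ, σ, hx, h, rfl⟩
    exact congrArg Subtype.val (hcode h)
  have hDA := hD.mono A
  let α := Fin (S.ar 2) ⊕ Fin (S.ar 2) ⊕ Fin (S.ar 2)
  let p₁ : Fin (S.ar 2) → α := Sum.inl
  let p₂ : Fin (S.ar 2) → α := Sum.inr ∘ Sum.inl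
  let p₃ : Fin (S.ar 2) → α := Sum.inr ∘ Sum.inr
  let γ := Fin 2 × Fin (S.ar 1) ⊕ Fin (S.ar 2)
  let b : Fin 2 → Fin (S.ar 1) → α ⊕ γ := fun k m => Sum.inr (Sum.inl (k, m))
  let b' : Fin (S.ar 2) → α ⊕ γ := fun m => Sum.inr (Sum.inr m)
  let q : Fin 2 → (γ → M) → Fin (S.ar 1) → M := fun k u m => u (Sum.inl (k, m))
  refine definable_congr (definable_exists (β := γ) (p := fun v u => q 0 u = (S.s0 a).1 ∧
    S.FaceR (i := 1) (j := 2) (δ (m := 1) 2) (v ∘ p₂) (q 0 u) ∧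
    S.FaceR (i := 1) (j := 2) (δ (m := 1) 2) (v ∘ p₁) (q 1 u) ∧
    S.FaceR (i := 2) (j := 1) (ς (m := 1) 0) (q 1 u) (u ∘ Sum.inr) ∧
    S.TetR (u ∘ Sum.inr) (v ∘ p₂) (v ∘ p₁) (v ∘ p₃))
    (definable_and (definable_eq_point hA (b 0))
    (definable_and (definable_faceR hDA _ (Sum.inl ∘ p₂) (b 0))
    (definable_and (definable_faceR hDA _ (Sum.inl ∘ p₁) (b 1))
    (definable_and (definable_faceR hDA _ (b 1) b')
      (definable_tetR hDA b' (Sum.inl ∘ p₂) (Sum.inl ∘ p₁) (Sum.inl ∘ p₃))))))) fun v => ?_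
  constructor
  · rintro ⟨u, h0, ⟨σ, e1, h1⟩, ⟨τ, e2, h2⟩, ⟨g, e3, h3⟩, ι, σ', τ', ρ, a1, a2, a3, a4, hT⟩
    obtain rfl := Subtype.ext (e1.trans a2.symm)
    obtain rfl := Subtype.ext (e2.trans a3.symm)
    obtain rfl := Subtype.ext (e3.trans h2.symm)
    obtain rfl := Subtype.ext (h3.trans a1.symm)
    exact ⟨τ, σ, ⟨Subtype.ext (h1.trans h0), (hT.e03 hS.1)⟩, e2, e1,
      (congrArg Subtype.val (hcode hT)).trans a4⟩
  · rintro ⟨τ, σ, hx, e1, e2, h3⟩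
    obtain ⟨ρ, h⟩ := hex hx
    let w : Fin 2 → S.obj 1 := ![S.s0 a, S.f2 2 τ]
    refine ⟨Sum.elim (fun z => (w z.1).1 z.2) (S.s1 0 (S.f2 2 τ)).1, rfl,
      ⟨σ, e2, congrArg Subtype.val hx.1⟩, ⟨τ, e1, rfl⟩, ⟨_, rfl, rfl⟩, _, σ, τ, ρ, rfl, e2, e1,
      ?_, h⟩
    exact (congrArg Subtype.val (hcode h)).symm.trans h3

/-- A choice of codings for all edges, suitable for the definition of `ω`. -/
theorem exists_codings {T : L.Theory} (hT : EliminatesImaginaries.{u, v, w} T) [Nonempty M] [M ⊨ T]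
    (hS : S.IsTwoGroupoid) (hD : S.DefinableOver L ∅) :
    ∃ C : ∀ t : S.obj 1, S.Coding t, (∀ a, (C (S.s0 a)).IsUnit) ∧
      ∀ (t : S.obj 1) (A : Set M), S.IsPoint L A t → (C t).IsDefinable L A := by
  have h : ∀ t : S.obj 1, ∃ C : S.Coding t, ((∃ a, t = S.s0 a) → C.IsUnit) ∧
      ∀ A : Set M, S.IsPoint L A t → C.IsDefinable L A := by
    intro t
    by_cases ht : ∃ a, t = S.s0 a
    · obtain ⟨a, rfl⟩ := ht
      obtain ⟨C, h1, h2⟩ := exists_unit_coding (L := L) hS hD a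
      exact ⟨C, fun _ => h1, h2⟩
    · obtain ⟨C, h1⟩ := exists_coding hT hS hD t
      exact ⟨C, fun h => absurd h ht, h1⟩
  choose C h1 h2 using h
  exact ⟨C, fun a => h1 _ ⟨a, rfl⟩, h2⟩

end DSimp

/-! ### Definability of the morphisms `ω_t` and of the `2`-morphisms `ω_α` -/

theorem elim_eq {α β γ : Type*} {z : α ⊕ β → γ} {u : α → γ} {v : β → γ}
    (hu : u = z ∘ Sum.inl) (hv : v = z ∘ Sum.inr) : Sum.elim u v = z := by
  rw [hu, hv, Sum.elim_comp_inl_inr]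

namespace DMap

variable {M : Type w} {S : DSimp M} {I : Type} {f : DMap I S}

theorem comp_sub {z : Var I S → M} (hf : f.code = z) {k : Fin 4} (c : Fin ((k : ℕ) + 1) → I) :
    z ∘ sub c = (f.toFun k c).1 := by
  rw [← hf]
  rfl

theorem comp_sub_edge {z : Var I S → M} (hf : f.code = z) (i j : I) :
    z ∘ sub (k := 1) ![i, j] = (f.edge i j).1 := comp_sub hf _

theorem comp_sub_tri {z : Var I S → M} (hf : f.code = z) (i j k : I) :
    z ∘ sub (k := 2) ![i, j, k] = (f.tri i j k).1 := comp_sub hf _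

end DMap

namespace DSimp

variable {M : Type w} {S : DSimp M}

theorem IsPoint.d {L : FirstOrder.Language.{u, v}} [L.Structure M] {A : Set M}
    (hD : S.DefinableOver L A) {i j : Fin 4} (t : Fin ((i : ℕ) + 1) →o Fin ((j : ℕ) + 1))
    {g : S.obj j} (hg : S.IsPoint L A g) : S.IsPoint L A (S.d t g) := by
  refine definable_congr (definable_exists (β := Fin (S.ar j)) (p := fun v x =>
    x = g.1 ∧ S.FaceR t x v) (definable_and (definable_eq_point hg Sum.inr)
      (definable_faceR hD t Sum.inr Sum.inl))) fun v => ?_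
  constructor
  · rintro ⟨_, rfl, g', e, h⟩
    obtain rfl := Subtype.ext e
    exact h.symm
  · rintro rfl
    exact ⟨_, rfl, g, rfl, rfl⟩

namespace Coding

variable {r s t : S.obj 1} {C : S.Coding t} {I : Type} {f : DMap I S} {i i' j j' k : I}
  {g g' h h' m : S.obj 1} {α β : S.obj 2} {c : Fin C.n → M}

theorem boundary_of_mem_arrows (hS : S.Functorial) (hc : c ∈ C.arrows (f.edge i j) g h) :
    (S.f1 1 g = S.f1 1 t ∧ S.f1 0 g = f.vertex i) ∧ S.f1 1 h = S.f1 0 t ∧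
      S.f1 0 h = f.vertex j := by
  obtain ⟨τ, σ, hx, h1, h2, h3, -⟩ := hc
  refine ⟨⟨?_, ?_⟩, ?_, ?_⟩
  · rw [← h1, origin_eq hS, ← hx.2, ← origin_eq hS, hx.1]
  · rw [← h1, middle_eq hS, h2, f.f1_edge_1]
  · rw [← h3, ← middle_eq hS, hx.1]
  · rw [← h3, ← end_eq hS, hx.2, end_eq hS, h2, f.f1_edge_0]

theorem pre_graph (hS : S.IsTwoGroupoid) (hα : IsHom f i i' g g' α)
    (hc : c ∈ C.arrows (f.edge i' j) g' h) :
    C.Pre (f.tri i i' j) α c (C.pre (f.tri i i' j) α c) := by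
  refine (pre_eq_iff hS ?_).1 rfl
  obtain ⟨τ, σ, hx, h1, h2, h3, rfl⟩ := hc
  obtain ⟨τ', h4⟩ := exists_pre hS hα h1 h2
  exact ⟨_, τ, σ, τ', hx, h4, rfl, rfl⟩

theorem post_graph (hS : S.IsTwoGroupoid) (hc : c ∈ C.arrows (f.edge i j) g h)
    (hβ : IsHom f j j' h h' β) : C.Post (f.tri i j j') β c (C.post (f.tri i j j') β c) := by
  refine (post_eq_iff hS ?_).1 rfl
  obtain ⟨τ, σ, hx, h1, h2, h3, rfl⟩ := hc
  obtain ⟨τ', σ', h4⟩ := exists_post hS hx h2 h3 hβ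
  exact ⟨_, τ, σ, τ', σ', hx, h4, rfl, rfl⟩

theorem mul_graph (hS : S.IsTwoGroupoid) {A : S.Coding r} {B : S.Coding s}
    (h01 : S.f2 2 α = r) (h12 : S.f2 0 α = s) (h02 : S.f2 1 α = t) {a : Fin A.n → M}
    {b : Fin B.n → M} (ha : a ∈ A.arrows (f.edge i j) g h) (hb : b ∈ B.arrows (f.edge j k) h m) :
    MulRel A B C α (f.tri i j k) a b (mul A B C α (f.tri i j k) a b) := by
  obtain ⟨τ, σ, hx, h1, h2, h3, rfl⟩ := ha
  obtain ⟨τ₂, σ₂, hy, h4, h5, h6, rfl⟩ := hb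
  obtain ⟨τ', σ', ζ, h7, h8⟩ := exists_mul hS h01 h12 hx hy h2 h3 h4 h5
  rw [mul_code hS h02 hx hy h7 h8]
  exact ⟨τ, σ, τ₂, σ₂, τ', σ', ζ, hx, hy, h7, h8, rfl, rfl, rfl⟩

theorem eq_mul_of_mulRel (hS : S.IsTwoGroupoid) {A : S.Coding r} {B : S.Coding s}
    (h02 : S.f2 1 α = t) {a : Fin A.n → M} {b : Fin B.n → M} {d : Fin C.n → M}
    (h : MulRel A B C α (f.tri i j k) a b d) : mul A B C α (f.tri i j k) a b = d := by
  obtain ⟨τ, σ, τ₂, σ₂, τ', σ', ζ, hx, hy, h7, h8, rfl, rfl, rfl⟩ := h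
  exact mul_code hS h02 hx hy h7 h8

theorem pre_eq (hS : S.IsTwoGroupoid) {κ : S.obj 2} {c' : Fin C.n → M} (h : C.Pre κ α c c') :
    C.pre κ α c = c' := (pre_eq_iff hS ⟨_, h⟩).2 h

theorem post_eq (hS : S.IsTwoGroupoid) {κ : S.obj 2} {c' : Fin C.n → M} (h : C.Post κ α c c') :
    C.post κ α c = c' := (post_eq_iff hS ⟨_, h⟩).2 h

theorem arrowsR_iff {e : S.obj 1} {x y : Fin (S.ar 1) → M} :
    C.ArrowsR e.1 x y c ↔ ∃ g h : S.obj 1, g.1 = x ∧ h.1 = y ∧ c ∈ C.arrows e g h := by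
  constructor
  · rintro ⟨e', g, h, e1, e2, e3, hc⟩
    obtain rfl := Subtype.ext e1
    exact ⟨g, h, e2, e3, hc⟩
  · rintro ⟨g, h, e2, e3, hc⟩
    exact ⟨e, g, h, rfl, e2, e3, hc⟩

theorem preR_iff {κ : S.obj 2} {x : Fin (S.ar 2) → M} {c' : Fin C.n → M} :
    C.PreR κ.1 x c c' ↔ ∃ α : S.obj 2, α.1 = x ∧ C.Pre κ α c c' := by
  constructor
  · rintro ⟨κ', α, e1, e2, h⟩
    obtain rfl := Subtype.ext e1
    exact ⟨α, e2, h⟩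
  · rintro ⟨α, e2, h⟩
    exact ⟨κ, α, rfl, e2, h⟩

theorem postR_iff {κ : S.obj 2} {x : Fin (S.ar 2) → M} {c' : Fin C.n → M} :
    C.PostR κ.1 x c c' ↔ ∃ α : S.obj 2, α.1 = x ∧ C.Post κ α c c' := by
  constructor
  · rintro ⟨κ', α, e1, e2, h⟩
    obtain rfl := Subtype.ext e1
    exact ⟨α, e2, h⟩
  · rintro ⟨α, e2, h⟩
    exact ⟨κ, α, rfl, e2, h⟩

theorem mulR_iff {A : S.Coding r} {B : S.Coding s} {κ : S.obj 2} {a : Fin A.n → M}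
    {b : Fin B.n → M} {d : Fin C.n → M} : MulR A B C α κ.1 a b d ↔ MulRel A B C α κ a b d := by
  constructor
  · rintro ⟨κ', e1, h⟩
    obtain rfl := Subtype.ext e1
    exact h
  · exact fun h => ⟨κ, rfl, h⟩

end Coding

end DSimp

section Omega

variable {M : Type w} {G : DSimp M} (hG : G.IsTwoGroupoid) {L : FirstOrder.Language.{u, v}}
  [L.Structure M] {P : Set M} (hD : G.DefinableOver L P) {a b c : G.obj 0}

open DSimp DSimp.Coding

include hG in
theorem isHom_of_faces {I : Type} {f : DMap I G} {i j : I} {α : G.obj 2}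
    (h : G.f2 0 α = f.edge i j) :
    DSimp.IsHom f i j (G.f2 2 α) (G.f2 1 α) α ∧ G.f1 1 (G.f2 2 α) = G.f1 1 (G.f2 1 α) ∧
      G.f1 0 (G.f2 2 α) = f.vertex i ∧ G.f1 0 (G.f2 1 α) = f.vertex j :=
  ⟨⟨rfl, rfl, h⟩, origin_eq hG.1 α, by rw [middle_eq hG.1, h, f.f1_edge_1],
    by rw [end_eq hG.1, h, f.f1_edge_0]⟩

include hD

theorem definable_P {t : Edge G a b} {C : G.Coding t.1} (hC : C.IsDefinable L P) (r : ℕ)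
    (i j : Fin (r + 1)) :
    P.Definable L {z : DMap.Var (Fin (r + 1)) G ⊕ Fin (G.ar 1) ⊕ Fin (G.ar 1) ⊕ Fin C.n → M |
      ∃ (f : DMap (Fin (r + 1)) G) (g : (omegaObj hG a).Ob f i) (h : (omegaObj hG b).Ob f j)
        (π : (morOfCoding hG t C).P f g h),
        z = Sum.elim f.code (Sum.elim g.1.1 (Sum.elim h.1.1 π.1))} := by
  refine definable_congr (definable_and (DMap.definable_code hD Sum.inl)
    (hC.arrowsR hD (Sum.inl ∘ DMap.sub (k := 1) ![i, j]) (Sum.inr ∘ Sum.inl)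
      (Sum.inr ∘ Sum.inr ∘ Sum.inl) (Sum.inr ∘ Sum.inr ∘ Sum.inr))) fun z => ?_
  constructor
  · rintro ⟨⟨f, hf⟩, hc⟩
    simp only [← Function.comp_assoc] at hc
    rw [DMap.comp_sub_edge hf, arrowsR_iff] at hc
    obtain ⟨g, h, e1, e2, hc⟩ := hc
    obtain ⟨⟨b1, b2⟩, b3, b4⟩ := boundary_of_mem_arrows hG.1 hc
    exact ⟨f, ⟨g, b1.trans t.2.1, b2⟩, ⟨h, b3.trans t.2.2, b4⟩, ⟨_, hc⟩,
      (elim_eq hf (elim_eq e1 (elim_eq e2 rfl))).symm⟩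
  · rintro ⟨f, g, h, π, rfl⟩
    exact ⟨⟨f, rfl⟩, arrowsR_iff.2 ⟨g.1, h.1, rfl, rfl, π.2⟩⟩

theorem definable_pre {t : Edge G a b} {C : G.Coding t.1} (hC : C.IsDefinable L P) (r : ℕ)
    (i i' j : Fin (r + 1)) :
    P.Definable L {z : DMap.Var (Fin (r + 1)) G ⊕ Fin (G.ar 2) ⊕ Fin (G.ar 1) ⊕ Fin C.n ⊕
        Fin C.n → M |
      ∃ (f : DMap (Fin (r + 1)) G) (g : (omegaObj hG a).Ob f i) (g' : (omegaObj hG a).Ob f i')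
        (h : (omegaObj hG b).Ob f j) (σ : (omegaObj hG a).Hom f g g')
        (π : (morOfCoding hG t C).P f g' h),
        z = Sum.elim f.code (Sum.elim σ.1.1 (Sum.elim h.1.1
          (Sum.elim π.1 ((morOfCoding hG t C).pre σ π).1)))} := by
  refine definable_congr (definable_and (DMap.definable_code hD Sum.inl)
    (definable_and (hC.preR hD hG (Sum.inl ∘ DMap.sub (k := 2) ![i, i', j]) (Sum.inr ∘ Sum.inl)
      (Sum.inr ∘ Sum.inr ∘ Sum.inr ∘ Sum.inl) (Sum.inr ∘ Sum.inr ∘ Sum.inr ∘ Sum.inr))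
    (definable_and (definable_faceR hD (i := 1) (j := 2) (δ (m := 1) 0) (Sum.inr ∘ Sum.inl)
      (Sum.inl ∘ DMap.sub (k := 1) ![i, i']))
    (definable_exists (β := Fin (G.ar 1)) (p := fun z g' =>
      G.FaceR (i := 1) (j := 2) (δ (m := 1) 1) (z ∘ Sum.inr ∘ Sum.inl) g' ∧
      C.ArrowsR (z ∘ Sum.inl ∘ DMap.sub (k := 1) ![i', j]) g' (z ∘ Sum.inr ∘ Sum.inr ∘ Sum.inl)
        (z ∘ Sum.inr ∘ Sum.inr ∘ Sum.inr ∘ Sum.inl))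
      (definable_and (definable_faceR hD _ (Sum.inl ∘ Sum.inr ∘ Sum.inl) Sum.inr)
        (hC.arrowsR hD (Sum.inl ∘ Sum.inl ∘ DMap.sub (k := 1) ![i', j]) Sum.inr
          (Sum.inl ∘ Sum.inr ∘ Sum.inr ∘ Sum.inl)
          (Sum.inl ∘ Sum.inr ∘ Sum.inr ∘ Sum.inr ∘ Sum.inl))))))) fun z => ?_
  constructor
  · rintro ⟨⟨f, hf⟩, h1, h2, _, h3, h4⟩
    simp only [← Function.comp_assoc (f := z)] at h1 h2 h4
    rw [DMap.comp_sub_tri hf, preR_iff] at h1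
    rw [DMap.comp_sub_edge hf] at h2
    rw [DMap.comp_sub_edge hf, arrowsR_iff] at h4
    obtain ⟨α, e1, h1⟩ := h1
    obtain ⟨α', e2, h2⟩ := h2
    obtain ⟨α'', e3, h3⟩ := h3
    obtain ⟨g', h, e4, e5, hc⟩ := h4
    obtain rfl := Subtype.ext (e2.trans e1.symm)
    obtain rfl := Subtype.ext (e3.trans e1.symm)
    obtain rfl := Subtype.ext (e4.trans h3.symm)
    obtain ⟨b0, b1, b2, b3⟩ := isHom_of_faces hG (Subtype.ext h2)
    obtain ⟨⟨b4, -⟩, b6, b7⟩ := boundary_of_mem_arrows hG.1 hc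
    exact ⟨f, ⟨_, (b1.trans b4).trans t.2.1, b2⟩, ⟨_, b4.trans t.2.1, b3⟩, ⟨h, b6.trans t.2.2, b7⟩,
      ⟨_, b0⟩, ⟨_, hc⟩, (elim_eq hf (elim_eq e1 (elim_eq e5 (elim_eq rfl (pre_eq hG h1))))).symm⟩
  · rintro ⟨f, g, g', h, σ, π, rfl⟩
    exact ⟨⟨f, rfl⟩, preR_iff.2 ⟨σ.1, rfl, pre_graph hG (Hom.isHom hG σ) π.2⟩,
      ⟨σ.1, rfl, congrArg Subtype.val σ.2.2.2⟩, g'.1.1, ⟨σ.1, rfl, congrArg Subtype.val σ.2.2.1⟩,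
      arrowsR_iff.2 ⟨g'.1, h.1, rfl, rfl, π.2⟩⟩

theorem definable_post {t : Edge G a b} {C : G.Coding t.1} (hC : C.IsDefinable L P) (r : ℕ)
    (i j j' : Fin (r + 1)) :
    P.Definable L {z : DMap.Var (Fin (r + 1)) G ⊕ Fin (G.ar 1) ⊕ Fin (G.ar 2) ⊕ Fin C.n ⊕
        Fin C.n → M |
      ∃ (f : DMap (Fin (r + 1)) G) (g : (omegaObj hG a).Ob f i) (h : (omegaObj hG b).Ob f j)
        (h' : (omegaObj hG b).Ob f j') (π : (morOfCoding hG t C).P f g h)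
        (τ : (omegaObj hG b).Hom f h h'),
        z = Sum.elim f.code (Sum.elim g.1.1 (Sum.elim τ.1.1
          (Sum.elim π.1 ((morOfCoding hG t C).post π τ).1)))} := by
  refine definable_congr (definable_and (DMap.definable_code hD Sum.inl)
    (definable_and (hC.postR hD hG (Sum.inl ∘ DMap.sub (k := 2) ![i, j, j'])
      (Sum.inr ∘ Sum.inr ∘ Sum.inl)
      (Sum.inr ∘ Sum.inr ∘ Sum.inr ∘ Sum.inl) (Sum.inr ∘ Sum.inr ∘ Sum.inr ∘ Sum.inr))
    (definable_and (definable_faceR hD (i := 1) (j := 2) (δ (m := 1) 0)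
      (Sum.inr ∘ Sum.inr ∘ Sum.inl) (Sum.inl ∘ DMap.sub (k := 1) ![j, j']))
    (definable_exists (β := Fin (G.ar 1)) (p := fun z h =>
      G.FaceR (i := 1) (j := 2) (δ (m := 1) 2) (z ∘ Sum.inr ∘ Sum.inr ∘ Sum.inl) h ∧
      C.ArrowsR (z ∘ Sum.inl ∘ DMap.sub (k := 1) ![i, j]) (z ∘ Sum.inr ∘ Sum.inl) h
        (z ∘ Sum.inr ∘ Sum.inr ∘ Sum.inr ∘ Sum.inl))
      (definable_and (definable_faceR hD _ (Sum.inl ∘ Sum.inr ∘ Sum.inr ∘ Sum.inl) Sum.inr)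
        (hC.arrowsR hD (Sum.inl ∘ Sum.inl ∘ DMap.sub (k := 1) ![i, j])
          (Sum.inl ∘ Sum.inr ∘ Sum.inl) Sum.inr
          (Sum.inl ∘ Sum.inr ∘ Sum.inr ∘ Sum.inr ∘ Sum.inl))))))) fun z => ?_
  constructor
  · rintro ⟨⟨f, hf⟩, h1, h2, _, h3, h4⟩
    simp only [← Function.comp_assoc (f := z)] at h1 h2 h4
    rw [DMap.comp_sub_tri hf, postR_iff] at h1
    rw [DMap.comp_sub_edge hf] at h2
    rw [DMap.comp_sub_edge hf, arrowsR_iff] at h4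
    obtain ⟨α, e1, h1⟩ := h1
    obtain ⟨α', e2, h2⟩ := h2
    obtain ⟨α'', e3, h3⟩ := h3
    obtain ⟨g, h, e4, e5, hc⟩ := h4
    obtain rfl := Subtype.ext (e2.trans e1.symm)
    obtain rfl := Subtype.ext (e3.trans e1.symm)
    obtain rfl := Subtype.ext (e5.trans h3.symm)
    obtain ⟨b0, b1, b2, b3⟩ := isHom_of_faces hG (Subtype.ext h2)
    obtain ⟨⟨b4, b5⟩, b6, -⟩ := boundary_of_mem_arrows hG.1 hc
    exact ⟨f, ⟨g, b4.trans t.2.1, b5⟩, ⟨_, b6.trans t.2.2, b2⟩, ⟨_, (b1.symm.trans b6).trans t.2.2,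
      b3⟩, ⟨_, hc⟩, ⟨_, b0⟩,
      (elim_eq hf (elim_eq e4 (elim_eq e1 (elim_eq rfl (post_eq hG h1))))).symm⟩
  · rintro ⟨f, g, h, h', π, σ, rfl⟩
    exact ⟨⟨f, rfl⟩, postR_iff.2 ⟨σ.1, rfl, post_graph hG π.2 (Hom.isHom hG σ)⟩,
      ⟨σ.1, rfl, congrArg Subtype.val σ.2.2.2⟩, h.1.1, ⟨σ.1, rfl, congrArg Subtype.val σ.2.1⟩,
      arrowsR_iff.2 ⟨g.1, h.1, rfl, rfl, π.2⟩⟩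

open Sum in
theorem definable_Sq {t : Edge G a b} {C : G.Coding t.1} (hC : C.IsDefinable L P) (r' r : ℕ)
    (i' j' : Fin (r' + 1)) (i j : Fin (r + 1)) :
    P.Definable L {z : DMap.Var (Fin (r' + 1) ⊕ Fin (r + 1)) G ⊕ Fin (G.ar 2) ⊕
        Fin C.n ⊕ Fin C.n ⊕ Fin (G.ar 2) → M |
      ∃ (F : DMap (Fin (r' + 1) ⊕ Fin (r + 1)) G)
        (g' : (omegaObj hG a).Ob (F.comp inl) i') (g : (omegaObj hG a).Ob (F.comp inr) i)
        (h' : (omegaObj hG b).Ob (F.comp inl) j') (h : (omegaObj hG b).Ob (F.comp inr) j)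
        (ξ : (omegaObj hG a).Cross F g' g) (π : (morOfCoding hG t C).P (F.comp inr) g h)
        (π' : (morOfCoding hG t C).P (F.comp inl) g' h')
        (η : (omegaObj hG b).Cross F h' h), (morOfCoding hG t C).Sq F ξ π π' η ∧
        z = Sum.elim F.code (Sum.elim ξ.1.1 (Sum.elim π.1 (Sum.elim π'.1 η.1.1)))} := by
  let I := Fin (r' + 1) ⊕ Fin (r + 1)
  let Z := DMap.Var I G ⊕ Fin (G.ar 2) ⊕ Fin C.n ⊕ Fin C.n ⊕ Fin (G.ar 2)
  let pξ : Fin (G.ar 2) → Z := inr ∘ inl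
  let pπ : Fin C.n → Z := inr ∘ inr ∘ inl
  let pπ' : Fin C.n → Z := inr ∘ inr ∘ inr ∘ inl
  let pη : Fin (G.ar 2) → Z := inr ∘ inr ∘ inr ∘ inr
  let ed : I → I → Fin (G.ar 1) → Z := fun i j => inl ∘ DMap.sub (k := 1) ![i, j]
  let tr : I → I → I → Fin (G.ar 2) → Z := fun i j k => inl ∘ DMap.sub (k := 2) ![i, j, k]
  -- the bound tuples stand for the common value of the two compositions and for `g'`, `g`, `h'`, `h`
  let γ := Fin C.n ⊕ Fin 4 × Fin (G.ar 1)
  let bd : Fin C.n → Z ⊕ γ := inr ∘ inl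
  let bo : Fin 4 → Fin (G.ar 1) → Z ⊕ γ := fun k m => inr (inr (k, m))
  let qd : (γ → M) → Fin C.n → M := fun u => u ∘ inl
  let qo : Fin 4 → (γ → M) → Fin (G.ar 1) → M := fun k u m => u (inr (k, m))
  refine definable_congr (definable_and (DMap.definable_code hD (inl : DMap.Var I G → Z))
    (definable_exists (β := γ) (p := fun z u =>
      C.PreR (z ∘ tr (inl i') (inr i) (inr j)) (z ∘ pξ) (z ∘ pπ) (qd u) ∧
      C.PostR (z ∘ tr (inl i') (inl j') (inr j)) (z ∘ pη) (z ∘ pπ') (qd u) ∧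
      G.FaceR (i := 1) (j := 2) (δ (m := 1) 0) (z ∘ pξ) (z ∘ ed (inl i') (inr i)) ∧
      G.FaceR (i := 1) (j := 2) (δ (m := 1) 2) (z ∘ pξ) (qo 0 u) ∧
      G.FaceR (i := 1) (j := 2) (δ (m := 1) 1) (z ∘ pξ) (qo 1 u) ∧
      G.FaceR (i := 1) (j := 2) (δ (m := 1) 0) (z ∘ pη) (z ∘ ed (inl j') (inr j)) ∧
      G.FaceR (i := 1) (j := 2) (δ (m := 1) 2) (z ∘ pη) (qo 2 u) ∧
      G.FaceR (i := 1) (j := 2) (δ (m := 1) 1) (z ∘ pη) (qo 3 u) ∧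
      C.ArrowsR (z ∘ ed (inr i) (inr j)) (qo 1 u) (qo 3 u) (z ∘ pπ) ∧
      C.ArrowsR (z ∘ ed (inl i') (inl j')) (qo 0 u) (qo 2 u) (z ∘ pπ'))
    (definable_and (hC.preR hD hG (inl ∘ tr _ _ _) (inl ∘ pξ) (inl ∘ pπ) bd)
    (definable_and (hC.postR hD hG (inl ∘ tr _ _ _) (inl ∘ pη) (inl ∘ pπ') bd)
    (definable_and (definable_faceR hD _ (inl ∘ pξ) (inl ∘ ed _ _))
    (definable_and (definable_faceR hD _ (inl ∘ pξ) (bo 0))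
    (definable_and (definable_faceR hD _ (inl ∘ pξ) (bo 1))
    (definable_and (definable_faceR hD _ (inl ∘ pη) (inl ∘ ed _ _))
    (definable_and (definable_faceR hD _ (inl ∘ pη) (bo 2))
    (definable_and (definable_faceR hD _ (inl ∘ pη) (bo 3))
    (definable_and (hC.arrowsR hD (inl ∘ ed _ _) (bo 1) (bo 3) (inl ∘ pπ))
      (hC.arrowsR hD (inl ∘ ed _ _) (bo 0) (bo 2) (inl ∘ pπ'))))))))))))) fun z => ?_
  constructor
  · rintro ⟨⟨F, hf⟩, u, h1, h2, h3, h4, h5, h6, h7, h8, h9, h10⟩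
    have et : ∀ i j k, z ∘ tr i j k = (F.tri i j k).1 := DMap.comp_sub_tri hf
    have ee : ∀ i j, z ∘ ed i j = (F.edge i j).1 := DMap.comp_sub_edge hf
    rw [et] at h1 h2
    rw [ee] at h3 h6 h9 h10
    obtain ⟨ξ, e1, h1⟩ := preR_iff.1 h1
    obtain ⟨η, e2, h2⟩ := postR_iff.1 h2
    rw [← e1] at h3 h4 h5
    rw [← e2] at h6 h7 h8
    have k3 := faceR_iff.1 h3
    have k6 := faceR_iff.1 h6
    obtain ⟨g, h, e3, e4, hc⟩ := arrowsR_iff.1 h9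
    obtain ⟨g', h', e5, e6, hc'⟩ := arrowsR_iff.1 h10
    rw [← e5] at h4
    rw [← e3] at h5
    rw [← e6] at h7
    rw [← e4] at h8
    have k4 := faceR_iff.1 h4
    have k5 := faceR_iff.1 h5
    have k7 := faceR_iff.1 h7
    have k8 := faceR_iff.1 h8
    obtain ⟨⟨b1, b2⟩, b3, b4⟩ := boundary_of_mem_arrows hG.1 hc
    obtain ⟨⟨b5, b6⟩, b7, b8⟩ := boundary_of_mem_arrows hG.1 hc'
    refine ⟨F, ⟨g', b5.trans t.2.1, b6⟩, ⟨g, b1.trans t.2.1, b2⟩, ⟨h', b7.trans t.2.2, b8⟩,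
      ⟨h, b3.trans t.2.2, b4⟩, ⟨ξ, k4, k5, k3⟩, ⟨z ∘ pπ, ?_⟩, ⟨z ∘ pπ', ?_⟩, ⟨η, k7, k8, k6⟩, ?_,
      (elim_eq hf (elim_eq e1 (elim_eq rfl (elim_eq rfl e2)))).symm⟩
    · change _ ∈ C.arrows ((F.comp inr).edge i j) g h
      rwa [DMap.edge_comp]
    · change _ ∈ C.arrows ((F.comp inl).edge i' j') g' h'
      rwa [DMap.edge_comp]
    · exact (pre_eq hG h1).trans (post_eq hG h2).symm
  · rintro ⟨F, g', g, h', h, ξ, π, π', η, hs, rfl⟩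
    let w : Fin 4 → G.obj 1 := ![g'.1, g.1, h'.1, h.1]
    have hs' : C.pre _ ξ.1 π.1 = C.post _ η.1 π'.1 := hs
    refine ⟨⟨F, rfl⟩, Sum.elim (C.pre (F.tri (inl i') (inr i) (inr j)) ξ.1 π.1)
        (fun x => (w x.1).1 x.2),
      preR_iff.2 ⟨ξ.1, rfl, pre_graph hG (Cross.isHom hG ξ) (mem_comp π.2)⟩, ?_,
      faceR_iff.2 ξ.2.2.2, faceR_iff.2 ξ.2.1, faceR_iff.2 ξ.2.2.1,
      faceR_iff.2 η.2.2.2, faceR_iff.2 η.2.1, faceR_iff.2 η.2.2.1,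
      arrowsR_iff.2 ⟨g.1, h.1, rfl, rfl, mem_comp π.2⟩,
      arrowsR_iff.2 ⟨g'.1, h'.1, rfl, rfl, mem_comp π'.2⟩⟩
    rw [hs']
    exact postR_iff.2 ⟨η.1, rfl, post_graph hG (mem_comp π'.2) (Cross.isHom hG η)⟩

theorem morOfCoding_definableOver {t : Edge G a b} {C : G.Coding t.1} (hC : C.IsDefinable L P) :
    (morOfCoding hG t C).DefinableOver L P where
  P := definable_P hG hD hC
  pre := definable_pre hG hD hC
  post := definable_post hG hD hC
  Sq := definable_Sq hG hD hC

theorem cellOfTriangle_definableOver {r : Edge G a b} {s : Edge G b c} {t : Edge G a c}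
    {A : G.Coding r.1} {B : G.Coding s.1} {C : G.Coding t.1} (hA : A.IsDefinable L P)
    (hB : B.IsDefinable L P) (hC : C.IsDefinable L P) {α : Triangle G r s t}
    (hα : G.IsPoint L P α.1) : (cellOfTriangle hG A B C α).DefinableOver L P := by
  intro q i j k
  change P.Definable L {z : DMap.Var (Fin (q + 1)) G ⊕ Fin (G.ar 1) ⊕ Fin (G.ar 1) ⊕
    Fin (G.ar 1) ⊕ Fin A.n ⊕ Fin B.n ⊕ Fin C.n → M | _}
  refine definable_congr (definable_and (DMap.definable_code hD Sum.inl)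
    (definable_and (hA.arrowsR hD (Sum.inl ∘ DMap.sub (k := 1) ![i, j]) (Sum.inr ∘ Sum.inl)
      (Sum.inr ∘ Sum.inr ∘ Sum.inl) (Sum.inr ∘ Sum.inr ∘ Sum.inr ∘ Sum.inr ∘ Sum.inl))
    (definable_and (hB.arrowsR hD (Sum.inl ∘ DMap.sub (k := 1) ![j, k])
      (Sum.inr ∘ Sum.inr ∘ Sum.inl) (Sum.inr ∘ Sum.inr ∘ Sum.inr ∘ Sum.inl)
      (Sum.inr ∘ Sum.inr ∘ Sum.inr ∘ Sum.inr ∘ Sum.inr ∘ Sum.inl))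
    (IsDefinable.mulR hD hG hA hB hC α.2.2.2 hα (Sum.inl ∘ DMap.sub (k := 2) ![i, j, k])
      (Sum.inr ∘ Sum.inr ∘ Sum.inr ∘ Sum.inr ∘ Sum.inl)
      (Sum.inr ∘ Sum.inr ∘ Sum.inr ∘ Sum.inr ∘ Sum.inr ∘ Sum.inl)
      (Sum.inr ∘ Sum.inr ∘ Sum.inr ∘ Sum.inr ∘ Sum.inr ∘ Sum.inr))))) fun z => ?_
  constructor
  · rintro ⟨⟨f, hf⟩, h1, h2, h3⟩
    have ee : ∀ i j, z ∘ Sum.inl ∘ DMap.sub (k := 1) ![i, j] = (f.edge i j).1 :=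
      DMap.comp_sub_edge hf
    rw [ee] at h1 h2
    rw [show z ∘ Sum.inl ∘ DMap.sub (k := 2) ![i, j, k] = (f.tri i j k).1 from
      DMap.comp_sub_tri hf _ _ _] at h3
    rw [mulR_iff] at h3
    obtain ⟨g, h, e1, e2, ha⟩ := arrowsR_iff.1 h1
    obtain ⟨h', l, e3, e4, hb⟩ := arrowsR_iff.1 h2
    obtain rfl := Subtype.ext (e3.trans e2.symm)
    obtain ⟨⟨b1, b2⟩, b3, b4⟩ := boundary_of_mem_arrows hG.1 ha
    obtain ⟨-, b5, b6⟩ := boundary_of_mem_arrows hG.1 hb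
    exact ⟨f, ⟨g, b1.trans r.2.1, b2⟩, ⟨_, b3.trans r.2.2, b4⟩, ⟨l, b5.trans s.2.2, b6⟩,
      ⟨_, ha⟩, ⟨_, hb⟩, (elim_eq hf (elim_eq e1 (elim_eq e2 (elim_eq e4 (elim_eq rfl
        (elim_eq rfl (eq_mul_of_mulRel hG α.2.2.2 h3))))))).symm⟩
  · rintro ⟨f, g, h, l, π, ρ, rfl⟩
    exact ⟨⟨f, rfl⟩, arrowsR_iff.2 ⟨g.1, h.1, rfl, rfl, π.2⟩,
      arrowsR_iff.2 ⟨h.1, l.1, rfl, rfl, ρ.2⟩,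
      mulR_iff.2 (mul_graph hG α.2.1 α.2.2.1 α.2.2.2 π.2 ρ.2)⟩

theorem omegaMapCanonical_definableOver {C : ∀ t : G.obj 1, G.Coding t}
    (hC : ∀ a, (C (G.s0 a)).IsUnit) {t : Edge G a b} (hCt : (C t.1).IsDefinable L P)
    (ht : G.IsPoint L P t.1) : (omegaMapCanonical hG C hC).DefinableOver L P t := by
  intro r i
  -- the bound tuples stand for `t`, for the side `g` and for the degenerate triangle on it
  let Z := DMap.Var (Fin (r + 1)) G ⊕ Fin (G.ar 2) ⊕ Fin (C t.1).n
  let γ := Fin 2 × Fin (G.ar 1) ⊕ Fin (G.ar 2)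
  let b1 : Fin 2 → Fin (G.ar 1) → Z ⊕ γ := fun k m => Sum.inr (Sum.inl (k, m))
  let b2 : Fin (G.ar 2) → Z ⊕ γ := Sum.inr ∘ Sum.inr
  let q1 : Fin 2 → (γ → M) → Fin (G.ar 1) → M := fun k u m => u (Sum.inl (k, m))
  refine definable_congr (definable_and (DMap.definable_code hD (Sum.inl : _ → Z))
    (definable_exists (β := γ) (p := fun z u => q1 0 u = t.1.1 ∧
      G.FaceR (i := 1) (j := 2) (δ (m := 1) 2) (z ∘ Sum.inr ∘ Sum.inl) (q1 0 u) ∧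
      G.FaceR (i := 1) (j := 2) (δ (m := 1) 1) (z ∘ Sum.inr ∘ Sum.inl) (q1 1 u) ∧
      G.FaceR (i := 0) (j := 1) (δ (m := 0) 0) (q1 1 u)
        (z ∘ Sum.inl ∘ DMap.sub (k := 0) fun _ => i) ∧
      G.FaceR (i := 2) (j := 1) (ς (m := 1) 1) (q1 1 u) (u ∘ Sum.inr) ∧
      (C t.1).CodeR (u ∘ Sum.inr) (z ∘ Sum.inr ∘ Sum.inl) (z ∘ Sum.inr ∘ Sum.inr))
    (definable_and (definable_eq_point ht (b1 0))
    (definable_and (definable_faceR hD _ (Sum.inl ∘ Sum.inr ∘ Sum.inl) (b1 0))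
    (definable_and (definable_faceR hD _ (Sum.inl ∘ Sum.inr ∘ Sum.inl) (b1 1))
    (definable_and (definable_faceR hD _ (b1 1) (Sum.inl ∘ Sum.inl ∘ DMap.sub (k := 0) fun _ => i))
    (definable_and (definable_faceR hD _ (b1 1) b2)
      (hCt.codeR b2 (Sum.inl ∘ Sum.inr ∘ Sum.inl) (Sum.inl ∘ Sum.inr ∘ Sum.inr))))))))) fun z => ?_
  constructor
  · rintro ⟨⟨f, hf⟩, u, h0, ⟨σ, e2, h2⟩, ⟨σ', e1, h1⟩, h3, h5, τ, σ'', hx, e5, e6, hd⟩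
    obtain rfl := Subtype.ext (e1.trans e2.symm)
    obtain rfl := Subtype.ext (e6.trans e2.symm)
    rw [← h1] at h3 h5
    rw [← e5] at h5
    have h3' : G.FaceR (i := 0) (j := 1) (δ (m := 0) 0) (G.f2 1 σ'').1 (f.vertex i).1 := by
      rw [DMap.vertex, ← DMap.comp_sub hf]
      exact h3
    have k3 : G.f1 0 (G.f2 1 σ'') = f.vertex i := faceR_iff.1 h3'
    have k5 : G.s1 1 (G.f2 1 σ'') = τ := faceR_iff.1 h5
    have k0 : G.f2 2 σ'' = t.1 := Subtype.ext (h2.trans h0)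
    refine ⟨f, ⟨G.f2 1 σ'', (origin_eq hG.1 _).symm.trans ((congrArg _ k0).trans t.2.1), k3⟩,
      ⟨G.f2 0 σ'', (middle_eq hG.1 _).symm.trans ((congrArg _ k0).trans t.2.2),
        (end_eq hG.1 _).symm.trans k3⟩,
      ⟨σ'', k0, rfl, rfl⟩, (elim_eq hf (elim_eq e2 ?_)).symm⟩
    rw [← k5] at hd
    exact hd
  · rintro ⟨f, g, h, σ, rfl⟩
    let w : Fin 2 → G.obj 1 := ![t.1, G.f2 1 σ.1]
    exact ⟨⟨f, rfl⟩, Sum.elim (fun x => (w x.1).1 x.2) (G.s1 1 (G.f2 1 σ.1)).1, rfl,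
      faceR_iff.2 σ.2.1, faceR_iff.2 rfl, faceR_iff.2 ((congrArg _ σ.2.2.1).trans g.2.2),
      faceR_iff.2 rfl, _, _, isSquare_arr hG σ.2.1, rfl, rfl, rfl⟩

end Omega

/-! ### Formulas of the base in the language of `T_G` -/

namespace Interp

variable {M : Type w} {G : DSimp M} (x : Interp G) (L : FirstOrder.Language.{u, v}) [L.Structure M]

/-- An element of the base sort. -/
def inBase (m : M) : x.Univ := Sum.inl m

/-- The set of tuples of elements of the base sort that satisfy `p`, as a set of tuples in the
structure `x`, is definable in the language of `T_G`. -/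
def BaseDefinable {α : Type*} (p : (α → M) → Prop) : Prop :=
  (∅ : Set x.Univ).Definable (CoverLang L G.ar) {w : α → x.Univ | ∃ v : α → M, w = x.inBase ∘ v ∧ p v}

theorem definable_relMap {α : Type*} {n : ℕ} (R : CoverRel L G.ar n) (φ : Fin n → α) :
    (∅ : Set x.Univ).Definable (CoverLang L G.ar) {w : α → x.Univ | x.relMap L R (w ∘ φ)} := by
  refine Set.empty_definable_iff.2 ⟨FirstOrder.Language.Relations.formula (L := CoverLang L G.ar)
    (n := n) R fun i => FirstOrder.Language.Term.var (φ i), ?_⟩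
  ext w
  exact (FirstOrder.Language.Formula.realize_rel (L := CoverLang L G.ar) (M := x.Univ) (k := n)
    (R := R) (ts := fun i => FirstOrder.Language.Term.var (φ i))).symm

theorem definable_eq {α : Type*} (i j : α) :
    (∅ : Set x.Univ).Definable (CoverLang L G.ar) {w : α → x.Univ | w i = w j} := by
  refine Set.empty_definable_iff.2 ⟨FirstOrder.Language.Term.equal (L := CoverLang L G.ar)
    (FirstOrder.Language.Term.var i) (FirstOrder.Language.Term.var j), ?_⟩
  ext w
  change _ ↔ FirstOrder.Language.Formula.Realize (M := x.Univ) _ w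
  rw [FirstOrder.Language.Formula.realize_equal]
  rfl

variable {x L}

theorem eq_inBase_comp_iff {α : Type*} {w : α → x.Univ} :
    (∃ v : α → M, w = x.inBase ∘ v) ↔ ∀ i, ∃ m : M, w i = x.inBase m := by
  constructor
  · rintro ⟨v, rfl⟩ i
    exact ⟨v i, rfl⟩
  · intro h
    choose v hv using h
    exact ⟨v, funext hv⟩

theorem inBase_injective : Function.Injective x.inBase := Sum.inl_injective

theorem inBase_comp_injective {α : Type*} {v v' : α → M} (h : x.inBase ∘ v = x.inBase ∘ v') :
    v = v' := inBase_injective.comp_left h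

theorem inSort_injective {i : Fin 4} :
    Function.Injective (x.inSort : x.S.obj i → x.Univ) := fun _ _ h =>
  sigma_mk_injective (β := fun i : Fin 4 => (x.S.obj i : Type w)) (Sum.inr_injective (α := M) (β := Σ i : Fin 4, x.S.obj i) h)

theorem relMap_e_iff {i : Fin 4} {u : Fin (G.ar i) → x.Univ} {s : x.Univ} :
    x.relMap L (CoverRel.e i) (Fin.snoc u s) ↔
      ∃ g : G.obj i, u = x.inBase ∘ g.1 ∧ s = x.inSort (x.e i g) := by
  refine exists_congr fun g => ?_
  simp only [Fin.snoc_castSucc, Fin.snoc_last]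
  exact and_congr_left' funext_iff.symm

namespace BaseDefinable

variable {α β : Type*} [Finite α] {p q : (α → M) → Prop}

variable (x L α) in
theorem univ : x.BaseDefinable L fun _ : α → M => True := by
  refine definable_congr (definable_forall_of_finite fun i : α =>
    x.definable_relMap L CoverRel.base fun _ => i) fun w => ?_
  simp only [and_true]
  exact eq_inBase_comp_iff.symm

theorem imp (hp : x.BaseDefinable L p) (hq : x.BaseDefinable L q) :
    x.BaseDefinable L fun v => p v → q v := by
  refine definable_congr (definable_and (univ x L α) (hp.compl.union hq)) fun w => ?_
  constructor
  · rintro ⟨⟨v, rfl, -⟩, h⟩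
    refine ⟨v, rfl, fun hv => ?_⟩
    rcases h with h | ⟨v', e, h⟩
    · exact absurd ⟨v, rfl, hv⟩ h
    · obtain rfl := inBase_comp_injective e
      exact h
  · rintro ⟨v, rfl, h⟩
    refine ⟨⟨v, rfl, trivial⟩, ?_⟩
    by_cases hv : p v
    · exact Or.inr ⟨v, rfl, h hv⟩
    · refine Or.inl ?_
      rintro ⟨v', e, h'⟩
      obtain rfl := inBase_comp_injective e
      exact hv h'

omit [Finite α] in
theorem false : x.BaseDefinable L fun _ : α → M => False := by
  refine definable_congr (p := fun _ => False) Set.definable_empty fun w => ?_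
  simp

theorem not (hp : x.BaseDefinable L p) : x.BaseDefinable L fun v => ¬ p v :=
  hp.imp false

omit [Finite α] in
theorem congr (hp : x.BaseDefinable L p) (h : ∀ v, p v ↔ q v) : x.BaseDefinable L q := by
  obtain rfl : p = q := funext fun v => propext (h v)
  exact hp

omit [Finite α] in
theorem comp [Finite β] (hp : x.BaseDefinable L p) (φ : α → β) :
    x.BaseDefinable L fun v : β → M => p (v ∘ φ) := by
  refine definable_congr (definable_and (univ x L β)
    (Set.Definable.preimage_comp φ hp)) fun w => ?_
  constructor
  · rintro ⟨⟨v, rfl, -⟩, v', e, h⟩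
    have e' : v ∘ φ = v' := inBase_comp_injective e
    exact ⟨v, rfl, by rwa [← e'] at h⟩
  · rintro ⟨v, rfl, h⟩
    exact ⟨⟨v, rfl, trivial⟩, v ∘ φ, rfl, h⟩

theorem and (hp : x.BaseDefinable L p) (hq : x.BaseDefinable L q) :
    x.BaseDefinable L fun v => p v ∧ q v :=
  (hp.imp hq.not).not.congr fun v => by tauto

theorem forall_of_finite {ι : Type*} [Finite ι] {p : ι → (α → M) → Prop}
    (h : ∀ k, x.BaseDefinable L (p k)) : x.BaseDefinable L fun v => ∀ k, p k v := by
  refine definable_congr (definable_and (univ x L α) (definable_forall_of_finite h)) fun w => ?_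
  constructor
  · rintro ⟨⟨v, rfl, -⟩, h⟩
    refine ⟨v, rfl, fun k => ?_⟩
    obtain ⟨v', e, h'⟩ := h k
    obtain rfl := inBase_comp_injective e
    exact h'
  · rintro ⟨v, rfl, h⟩
    exact ⟨⟨v, rfl, trivial⟩, fun k => ⟨v, rfl, h k⟩⟩

omit [Finite α] in
theorem ex [Finite β] {p : (α → M) → (β → M) → Prop}
    (h : x.BaseDefinable L fun v : α ⊕ β → M => p (v ∘ Sum.inl) (v ∘ Sum.inr)) :
    x.BaseDefinable L fun v => ∃ u, p v u := by
  refine definable_congr (definable_exists (β := β) (p := fun w u =>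
    ∃ v : α → M, ∃ v' : β → M, w = x.inBase ∘ v ∧ u = x.inBase ∘ v' ∧ p v v')
    (definable_congr h fun w => ?_)) fun w => ?_
  · constructor
    · rintro ⟨v, rfl, h⟩
      exact ⟨v ∘ Sum.inl, v ∘ Sum.inr, rfl, rfl, h⟩
    · rintro ⟨v, v', e, e', h⟩
      exact ⟨Sum.elim v v', (elim_eq e.symm e'.symm).symm.trans (Sum.comp_elim _ _ _).symm, h⟩
  · constructor
    · rintro ⟨_, v, v', rfl, rfl, h⟩
      exact ⟨v, rfl, v', h⟩
    · rintro ⟨v, rfl, v', h⟩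
      exact ⟨_, v, v', rfl, rfl, h⟩

theorem eq (i j : α) : x.BaseDefinable L fun v : α → M => v i = v j := by
  refine definable_congr (definable_and (univ x L α) (x.definable_eq L i j)) fun w => ?_
  constructor
  · rintro ⟨⟨v, rfl, -⟩, h⟩
    exact ⟨v, rfl, inBase_injective h⟩
  · rintro ⟨v, rfl, h⟩
    exact ⟨⟨v, rfl, trivial⟩, congrArg x.inBase h⟩

theorem rel {n : ℕ} (R : L.Relations n) (φ : Fin n → α) :
    x.BaseDefinable L fun v => FirstOrder.Language.Structure.RelMap R (v ∘ φ) := by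
  refine definable_congr (definable_and (univ x L α)
    (x.definable_relMap L (CoverRel.rel R) φ)) fun w => ?_
  constructor
  · rintro ⟨⟨v, rfl, -⟩, m, e, h⟩
    obtain rfl : v ∘ φ = m := funext fun k => inBase_injective (e k)
    exact ⟨v, rfl, h⟩
  · rintro ⟨v, rfl, h⟩
    exact ⟨⟨v, rfl, trivial⟩, v ∘ φ, fun _ => rfl, h⟩

theorem fn {n : ℕ} (f : L.Functions n) (φ : Fin n → α) (j : α) :
    x.BaseDefinable L fun v => FirstOrder.Language.Structure.funMap f (v ∘ φ) = v j := by
  refine definable_congr (definable_and (univ x L α)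
    (x.definable_relMap L (CoverRel.fn f) (Fin.snoc φ j))) fun w => ?_
  rw [Fin.comp_snoc]
  constructor
  · rintro ⟨⟨v, rfl, -⟩, m, e, h⟩
    simp only [Fin.snoc_castSucc, Fin.snoc_last] at e h
    obtain rfl : v ∘ φ = m := funext fun k => inBase_injective (e k)
    exact ⟨v, rfl, (inBase_injective h).symm⟩
  · rintro ⟨v, rfl, h⟩
    refine ⟨⟨v, rfl, trivial⟩, v ∘ φ, ?_⟩
    simp only [Fin.snoc_castSucc, Fin.snoc_last, h]
    exact ⟨fun _ => rfl, rfl⟩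

/-- The graph of a term, which has to be unfolded since the language of `T_G` is relational. -/
theorem term (t : L.Term α) :
    x.BaseDefinable L fun v : α ⊕ Unit → M => t.realize (v ∘ Sum.inl) = v (Sum.inr ()) := by
  induction t with
  | var i => exact eq (Sum.inl i) (Sum.inr ())
  | func f ts ih =>
    rename_i n
    refine (ex (β := Fin n) (p := fun v u =>
      (∀ k, (ts k).realize (v ∘ Sum.inl) = u k) ∧
        FirstOrder.Language.Structure.funMap f u = v (Sum.inr ())) ?_).congr fun v => ?_
    · refine (forall_of_finite fun k => ?_).and (fn f Sum.inr (Sum.inl (Sum.inr ())))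
      exact (ih k).comp (Sum.elim (Sum.inl ∘ Sum.inl) fun _ => Sum.inr k)
    · constructor
      · rintro ⟨u, h1, h2⟩
        rw [← h2, FirstOrder.Language.Term.realize_func]
        simp only [h1]
      · intro h
        exact ⟨_, fun k => rfl, h⟩

theorem boundedFormula {n : ℕ} (φ : L.BoundedFormula α n) :
    x.BaseDefinable L fun v : α ⊕ Fin n → M => φ.Realize (v ∘ Sum.inl) (v ∘ Sum.inr) := by
  induction φ with
  | falsum => exact false
  | equal t₁ t₂ =>
    rename_i n
    refine (ex (β := Unit) (p := fun v u => t₁.realize v = u () ∧ t₂.realize v = u ())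
      ((term t₁).and (term t₂))).congr fun v => ?_
    simp only [FirstOrder.Language.BoundedFormula.Realize, Sum.elim_comp_inl_inr]
    constructor
    · rintro ⟨u, h1, h2⟩
      exact h1.trans h2.symm
    · exact fun h => ⟨fun _ => _, h, rfl⟩
  | rel R ts =>
    rename_i n l
    refine (ex (β := Fin l) (p := fun v u => (∀ k, (ts k).realize v = u k) ∧
      FirstOrder.Language.Structure.RelMap R u)
      ((forall_of_finite fun k => (term (ts k)).comp (Sum.elim Sum.inl fun _ => Sum.inr k)).and
        (rel R Sum.inr))).congr fun v => ?_
    simp only [FirstOrder.Language.BoundedFormula.Realize, Sum.elim_comp_inl_inr]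
    constructor
    · rintro ⟨u, h1, h2⟩
      simpa only [h1] using h2
    · exact fun h => ⟨_, fun k => rfl, h⟩
  | imp φ ψ hφ hψ => exact hφ.imp hψ
  | all φ ih =>
    rename_i n
    refine ((ex (α := α ⊕ Fin n) (β := Unit) (p := fun v u =>
      ¬ φ.Realize (v ∘ Sum.inl) (Fin.snoc (v ∘ Sum.inr) (u ()))) ?_).not).congr fun v => ?_
    · refine (ih.comp (β := (α ⊕ Fin n) ⊕ Unit) (Sum.elim (Sum.inl ∘ Sum.inl)
        (Fin.snoc (Sum.inl ∘ Sum.inr) (Sum.inr ())))).not.congr fun v => ?_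
      have e : v ∘ Fin.snoc (α := fun _ => (α ⊕ Fin n) ⊕ Unit) (Sum.inl ∘ Sum.inr) (Sum.inr ()) =
          Fin.snoc (α := fun _ => M) ((v ∘ Sum.inl) ∘ Sum.inr) ((v ∘ Sum.inr) ()) :=
        Fin.comp_snoc _ _ _
      rw [← e]
      rfl
    · simp only [FirstOrder.Language.BoundedFormula.Realize, not_exists, not_not]
      exact ⟨fun h a => h fun _ => a, fun h u => h (u ())⟩

theorem formula (φ : L.Formula α) : x.BaseDefinable L fun v : α → M => φ.Realize v := by
  refine ((boundedFormula φ).comp (β := α) (Sum.elim id Fin.elim0)).congr fun v => ?_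
  exact iff_of_eq (congrArg (FirstOrder.Language.BoundedFormula.Realize φ v)
    (Subsingleton.elim _ _))

end BaseDefinable

end Interp

/-! ### The objects `ω_a` -/

section Omega

variable {M : Type w} {G : DSimp M} (hG : G.IsTwoGroupoid) {L : FirstOrder.Language.{u, v}}
  [L.Structure M] {A : Set M} {a : G.obj 0}

/-- In `ω_a`, the map `e` identifies `G` with `G^*`, so that all subsets of `G^*_2` that are definable
in the base are definable in the language of `T_G`, with the same parameters. -/
theorem omegaObj_isTwoStable : (omegaObj hG a).IsTwoStable L := by
  intro r' r k Θ
  let x := omegaObj hG a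
  have h : ∀ p : Fin (r' + 1) × Fin (r + 1), ∃ ψ : (CoverLang L G.ar).Formula (Fin 2 ⊕ Fin k),
      ∀ (ξ ξ' : G.obj 2) (z : Fin k → M),
        (Θ p.1 p.2).Realize (Sum.elim (Sum.elim ξ.1 ξ'.1) z) ↔
          ψ.Realize (Sum.elim ![x.inSort ξ, x.inSort ξ'] (x.inBase ∘ z)) := by
    rintro ⟨i', i⟩
    -- `ψ` says that the tuples corresponding under `e` to its two arguments satisfy `Θ`
    let γ := Fin (G.ar 2) ⊕ Fin (G.ar 2)
    have hd : (∅ : Set x.Univ).Definable (CoverLang L G.ar) {w : Fin 2 ⊕ Fin k → x.Univ |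
        ∃ u : γ → x.Univ,
          x.relMap L (CoverRel.e 2) (Fin.snoc (u ∘ Sum.inl) (w (Sum.inl 0))) ∧
          x.relMap L (CoverRel.e 2) (Fin.snoc (u ∘ Sum.inr) (w (Sum.inl 1))) ∧
          ∃ v : γ ⊕ Fin k → M, Sum.elim u (w ∘ Sum.inr) = x.inBase ∘ v ∧ (Θ i' i).Realize v} := by
      refine definable_exists (definable_and ?_ (definable_and ?_ ?_))
      · refine definable_congr (x.definable_relMap L (CoverRel.e 2)
          (Fin.snoc (Sum.inr ∘ Sum.inl) (Sum.inl (Sum.inl 0)))) fun w => ?_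
        rw [Fin.comp_snoc]
        rfl
      · refine definable_congr (x.definable_relMap L (CoverRel.e 2)
          (Fin.snoc (Sum.inr ∘ Sum.inr) (Sum.inl (Sum.inl 1)))) fun w => ?_
        rw [Fin.comp_snoc]
        rfl
      · refine definable_congr (Set.Definable.preimage_comp
          (Sum.elim Sum.inr (Sum.inl ∘ Sum.inr) : γ ⊕ Fin k → (Fin 2 ⊕ Fin k) ⊕ γ)
          (Interp.BaseDefinable.formula (x := x) (Θ i' i))) fun w => ?_
        change (∃ v, w ∘ _ = _ ∧ _) ↔ _
        rw [Sum.comp_elim]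
        rfl
    obtain ⟨ψ, hψ⟩ := Set.empty_definable_iff.1 hd
    refine ⟨ψ, fun ξ ξ' z => ?_⟩
    refine Iff.trans ?_ (Set.ext_iff.1 hψ _)
    constructor
    · intro h
      refine ⟨x.inBase ∘ Sum.elim ξ.1 ξ'.1, Interp.relMap_e_iff.2 ⟨ξ, rfl, rfl⟩,
        Interp.relMap_e_iff.2 ⟨ξ', rfl, rfl⟩, _, ?_, h⟩
      exact (Sum.comp_elim x.inBase (Sum.elim ξ.1 ξ'.1) z).symm
    · rintro ⟨u, h1, h2, v, e, h⟩
      obtain ⟨η, h1, e1⟩ := Interp.relMap_e_iff.1 h1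
      obtain ⟨η', h2, e2⟩ := Interp.relMap_e_iff.1 h2
      obtain rfl : ξ = η := Interp.inSort_injective (x := x) e1
      obtain rfl : ξ' = η' := Interp.inSort_injective (x := x) e2
      have e' : v = Sum.elim (Sum.elim ξ.1 ξ'.1) z := by
        apply Interp.inBase_comp_injective (x := x)
        rw [← e, Sum.comp_elim x.inBase (Sum.elim _ _), Sum.comp_elim x.inBase]
        exact congrArg₂ Sum.elim (elim_eq h1.symm h2.symm).symm rfl
      rw [e'] at h
      exact h
  choose ψ hψ using h
  refine ⟨(Finset.univ : Finset (Fin (r' + 1) × Fin (r + 1))).toList.map fun p => ⟨k, ψ p⟩, ?_⟩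
  intro F F' R z _ hR i' i
  refine ⟨⟨k, ψ (i', i)⟩, List.mem_map.2 ⟨(i', i), by simp, rfl⟩, x.inBase ∘ z, fun ξ ξ' => ?_⟩
  exact (hR i' i ξ ξ').trans (hψ (i', i) ξ ξ' z)

theorem omegaObj_isObjectOver (hD : G.DefinableOver L A) (ha : G.IsPoint L A a) :
    (omegaObj hG a).IsObjectOver L A := by
  refine ⟨⟨hD, fun i => ?_, ha⟩, omegaObj_isTwoStable hG⟩
  refine definable_congr (DSimp.definable_faceR hD (i := i) (j := i) OrderHom.id Sum.inl Sum.inr)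
    fun z => ?_
  constructor
  · rintro ⟨g, h1, h2⟩
    rw [hG.1.1] at h2
    exact ⟨g, (elim_eq h1 h2).symm⟩
  · rintro ⟨g, rfl⟩
    exact ⟨g, rfl, congrArg Subtype.val (hG.1.1 i g)⟩

end Omega

/-! ### Definability of the `2`-groupoid of points -/

theorem DefinableTwoGroupoid.points_definableOver {L : FirstOrder.Language.{u, v}} {T : L.Theory}
    (G : DefinableTwoGroupoid.{u, v, w} T) (M : Type w) [L.Structure M] [Nonempty M] [M ⊨ T] :
    (G.points M).DefinableOver L ∅ := by
  refine ⟨fun i => Set.empty_definable_iff.2 ⟨G.formulas.carrier i, rfl⟩, fun i j t => ?_⟩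
  have hf := G.functional M
  refine definable_congr (p := fun z : Fin (G.formulas.ar j) ⊕ Fin (G.formulas.ar i) → M =>
    (G.formulas.carrier j).Realize (z ∘ Sum.inl) ∧ (G.formulas.carrier i).Realize (z ∘ Sum.inr) ∧
      (G.formulas.graph t).Realize z) ?_ fun z => ?_
  · refine Set.empty_definable_iff.2 ⟨(G.formulas.carrier j).relabel Sum.inl ⊓
      ((G.formulas.carrier i).relabel Sum.inr ⊓ G.formulas.graph t), ?_⟩
    ext z
    simp only [Set.mem_ofPred_eq, FirstOrder.Language.Formula.realize_inf,
      FirstOrder.Language.Formula.realize_relabel]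
  · constructor
    · rintro ⟨h1, h2, h3⟩
      let g : (G.points M).obj j := ⟨z ∘ Sum.inl, h1⟩
      have hs := (hf i j t g.1 g.2).choose_spec
      refine ⟨g, (elim_eq rfl ?_).symm⟩
      refine (hs.2 (z ∘ Sum.inr) ⟨h2, ?_⟩).symm
      change (G.formulas.graph t).Realize (Sum.elim (z ∘ Sum.inl) (z ∘ Sum.inr))
      rwa [Sum.elim_comp_inl_inr]
    · rintro ⟨g, rfl⟩
      have hs := (hf i j t g.1 g.2).choose_spec.1
      exact ⟨g.2, hs.1, hs.2⟩

end DefGpd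

/-- Work in a model `M` of `T`; every structure `A` for `T`, and every extension of such structures,
lies in one. The map `ω : G(M) → I²(M)` extends `a ↦ ω_a`, and for each `A` it restricts to a map
`G(A) → I²(A)`; so these maps are compatible with extensions of `A`. -/
theorem mainTheorem4 {L : FirstOrder.Language.{u, v}} (T : L.Theory)
    (hT : DefGpd.EliminatesImaginaries.{u, v, w} T)
    (G : DefGpd.DefinableTwoGroupoid.{u, v, w} T)
    (M : Type w) [L.Structure M] [Nonempty M] [M ⊨ T] :
    ∃ (ω : DefGpd.OmegaMap (G := G.points M) (G.isTwoGroupoid M)) (can : ω.Canonical),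
      ∀ A : Set M,
        (∀ a : (G.points M).obj 0, (G.points M).IsPoint L A a →
          (DefGpd.omegaObj (G.isTwoGroupoid M) a).IsObjectOver L A) ∧
        (∀ (a b : (G.points M).obj 0) (t : DefGpd.Edge (G.points M) a b),
          (G.points M).IsPoint L A t.1 →
            (ω.mor t).DefinableOver L A ∧ can.DefinableOver L A t) ∧
        (∀ (a b c : (G.points M).obj 0) (r : DefGpd.Edge (G.points M) a b)
          (s : DefGpd.Edge (G.points M) b c) (t : DefGpd.Edge (G.points M) a c)
          (σ : DefGpd.Triangle (G.points M) r s t),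
          (G.points M).IsPoint L A σ.1 → (ω.cell σ).DefinableOver L A) := by
  have hG := G.isTwoGroupoid M
  have hD := G.points_definableOver M
  obtain ⟨C, hC, hCd⟩ := DefGpd.DSimp.exists_codings (L := L) hT hG hD
  refine ⟨DefGpd.omegaMap hG C hC, DefGpd.omegaMapCanonical hG C hC, fun A => ⟨?_, ?_, ?_⟩⟩
  · exact fun a ha => DefGpd.omegaObj_isObjectOver hG (hD.mono A) ha
  · exact fun a b t ht => ⟨DefGpd.morOfCoding_definableOver hG (hD.mono A) (hCd _ A ht),
      DefGpd.omegaMapCanonical_definableOver hG (hD.mono A) hC (hCd _ A ht) ht⟩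
  · intro a b c r s t σ hσ
    -- the edges of an `A`-point are `A`-points
    have hp : ∀ k, (G.points M).IsPoint L A ((G.points M).f2 k σ.1) := fun k =>
      hσ.d (hD.mono A) _
    exact DefGpd.cellOfTriangle_definableOver hG (hD.mono A)
      (hCd _ A (σ.2.1 ▸ hp 2)) (hCd _ A (σ.2.2.1 ▸ hp 0)) (hCd _ A (σ.2.2.2 ▸ hp 1)) hσ
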